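/- Let $\Delta(t)=t_1t_2-t_3^2$, let $\Sigma=\{y\in\mathbb R^3:\Delta(y)>0,\ y_1>0\}$, let $T_\Sigma=\mathbb R^3+i\Sigma\subset\mathbb C^3$, and let $\Pi^+$ be the upper half-plane. The Hardy space $H^2(T_\Sigma)$ consists of the holomorphic $F$ on $T_\Sigma$ with $$\|F\|_{H^2(T_\Sigma)}^2=\sup_{y\in\Sigma}\int_{\mathbb R^3}|F(x+iy)|^2\,dx<\infty .$$ For $\alpha>-1$, the Bergman space $A^2_\alpha(\Pi^+\times\Pi^+)$ consists of the holomorphic $G$ on $\Pi^+\times\Pi^+$ with $$\|G\|_{A^2_\alpha}^2=\int_{\Pi^+\times\Pi^+}|G(x_1+iy_1,x_2+iy_2)|^2\,y_1^{\alpha}y_2^{\alpha}\,dx_1dx_2dy_1dy_2<\infty .$$ With $\langle z,t\rangle=\tfrac12(z_1t_1+z_2t_2)+z_3t_3$, let $\Box$ be the differential operator in $x=\operatorname{Re} z$ determined by $\Box e^{i\langle z,\xi\rangle}=\Delta(\xi)e^{i\langle z,\xi\rangle}$, that is, $\Box=-4\,\partial_{x_1}\partial_{x_2}+\partial_{x_3}^2$.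 For a function $F$ on $T_\Sigma$ put $(RF)(z_1,z_2)=F(z_1,z_2,0)$ for $z_1,z_2\in\Pi^+$. Let $m\ge 0$ be an integer. (1) For every $F\in H^2(T_\Sigma)$ the function $R\Box^mF$ belongs to $A^2_{2m-\frac12}(\Pi^+\times\Pi^+)$, and $$\|R\Box^mF\|_{A^2_{2m-\frac12}(\Pi^+\times\Pi^+)}^2\le\frac{4\pi^{5/2}\,(2m)!\,\Gamma(2m+\frac12)}{2m+\frac12}\,\|F\|_{H^2(T_\Sigma)}^2 .$$ (2) Conversely, for every $G\in A^2_{2m-\frac12}(\Pi^+\times\Pi^+)$ there exists $F\in H^2(T_\Sigma)$ such that $R\Box^mF=G$ and $$\|F\|_{H^2(T_\Sigma)}^2=\frac{4\,\Gamma(m+\frac32)^2}{\bigl(\Gamma(2m+\frac12)\,m!\bigr)^2}\,\|G\|_{A^2_{2m-\frac12}(\Pi^+\times\Pi^+)}^2 .$$ -/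

import Mathlib

namespace TubeSigma

/-- The determinant function `Δ(t) = t₁ t₂ - t₃²` (coordinates are numbered from `0`). -/
def det (t : Fin 3 → ℝ) : ℝ := t 0 * t 1 - t 2 ^ 2

/-- The spherical cone `Σ = {y ∈ ℝ³ : y₁ y₂ - y₃² > 0, y₁ > 0}`. -/
def cone : Set (Fin 3 → ℝ) := {y | 0 < det y ∧ 0 < y 0}

/-- The tube domain `T_Σ = ℝ³ + iΣ`. -/
def tube : Set (Fin 3 → ℂ) := {z | (fun j => (z j).im) ∈ cone}

/-- The pairing `⟨z, t⟩ = (z₁ t₁ + z₂ t₂) / 2 + z₃ t₃`, for which `Σ` is self-dual. -/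
noncomputable def pairing (z : Fin 3 → ℂ) (t : Fin 3 → ℝ) : ℂ :=
  (z 0 * t 0 + z 1 * t 1) / 2 + z 2 * t 2

/-- The norm of the Hardy space `H²(T_Σ)`, with values in `[0, ∞]`. -/
noncomputable def hardyNorm (F : (Fin 3 → ℂ) → ℂ) : ENNReal :=
  (⨆ y ∈ cone, ∫⁻ x : Fin 3 → ℝ,
    ‖F (fun j => (x j : ℂ) + (y j : ℂ) * Complex.I)‖ₑ ^ 2) ^ (1 / 2 : ℝ)

/-- `F ∈ H²(T_Σ)`: only the values of `F` on `T_Σ` matter. -/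
def MemHardy (F : (Fin 3 → ℂ) → ℂ) : Prop :=
  DifferentiableOn ℂ F tube ∧ hardyNorm F < ⊤

/-- The operator `(1/i) ∂/∂x_j`, where `z_j = x_j + i y_j`. -/
noncomputable def partialD (j : Fin 3) (F : (Fin 3 → ℂ) → ℂ) : (Fin 3 → ℂ) → ℂ :=
  fun z => (1 / Complex.I) * lineDeriv ℝ F z (Pi.single j 1)

/-- The operator `□ = Δ((1/i) ∂/∂x)`. The gradient is taken with respect to `pairing`, so that
its components are `2 ∂/∂x₁`, `2 ∂/∂x₂`, `∂/∂x₃`; that is, `□ = -4 ∂₁∂₂ + ∂₃²`, the differential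
operator with `□ e^{i⟨z, ξ⟩} = Δ(ξ) e^{i⟨z, ξ⟩}` (see `box_exp`). -/
noncomputable def box (F : (Fin 3 → ℂ) → ℂ) : (Fin 3 → ℂ) → ℂ :=
  fun z => 4 * partialD 0 (partialD 1 F) z - partialD 2 (partialD 2 F) z

/-- The product `Π⁺ × Π⁺` of two upper half-planes. -/
def biHalfPlane : Set (ℂ × ℂ) := {z | 0 < z.1.im ∧ 0 < z.2.im}

/-- The norm of the weighted Bergman space `A²_{(α₁, α₂)}(Π⁺ × Π⁺)`, with values in `[0, ∞]`. -/
noncomputable def bergmanNorm (α₁ α₂ : ℝ) (G : ℂ × ℂ → ℂ) : ENNReal :=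
  (∫⁻ z in biHalfPlane,
    ‖G z‖ₑ ^ 2 * ENNReal.ofReal (z.1.im ^ α₁ * z.2.im ^ α₂)) ^ (1 / 2 : ℝ)

/-- `G ∈ A²_{(α₁, α₂)}(Π⁺ × Π⁺)`: only the values of `G` on `Π⁺ × Π⁺` matter. -/
def MemBergman (α₁ α₂ : ℝ) (G : ℂ × ℂ → ℂ) : Prop :=
  DifferentiableOn ℂ G biHalfPlane ∧ bergmanNorm α₁ α₂ G < ⊤

/-- The restriction `(RF)(z₁, z₂) = F(z₁, z₂, 0)`. -/
def restrict (F : (Fin 3 → ℂ) → ℂ) : ℂ × ℂ → ℂ := fun z => F ![z.1, z.2, 0]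

/-- `F` is an extension of `G` if `RF = G` on `Π⁺ × Π⁺`. -/
def IsExtension (F : (Fin 3 → ℂ) → ℂ) (G : ℂ × ℂ → ℂ) : Prop :=
  ∀ z ∈ biHalfPlane, restrict F z = G z

theorem partialD_exp (j : Fin 3) (c : ℂ) (ξ : Fin 3 → ℝ) :
    partialD j (fun z => c * Complex.exp (Complex.I * pairing z ξ)) =
      fun z => c * pairing (Pi.single j 1) ξ * Complex.exp (Complex.I * pairing z ξ) := by
  funext z
  have h : HasLineDerivAt ℝ (fun z => c * Complex.exp (Complex.I * pairing z ξ))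
      (c * (Complex.exp (Complex.I * pairing z ξ) *
        (Complex.I * pairing (Pi.single j 1) ξ))) z (Pi.single j (1 : ℂ)) := by
    have h1 : HasDerivAt (fun t : ℝ => Complex.I * pairing z ξ +
        (t : ℂ) * (Complex.I * pairing (Pi.single j 1) ξ))
        (Complex.I * pairing (Pi.single j 1) ξ) (0 : ℝ) := by
      simpa using ((Complex.ofRealCLM.hasDerivAt (x := (0 : ℝ))).mul_const
        (Complex.I * pairing (Pi.single j 1) ξ)).const_add (Complex.I * pairing z ξ)
    have h2 := (h1.cexp).const_mul c
    have e : (fun t : ℝ => c * Complex.exp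
        (Complex.I * pairing (z + t • (Pi.single j 1 : Fin 3 → ℂ)) ξ)) =
        fun t : ℝ => c * Complex.exp (Complex.I * pairing z ξ +
        (t : ℂ) * (Complex.I * pairing (Pi.single j 1) ξ)) := by
      funext t
      congr 2
      simp only [pairing, Pi.add_apply, Pi.smul_apply, Complex.real_smul]
      ring
    unfold HasLineDerivAt
    rw [e]
    simpa using h2
  simp only [partialD, h.lineDeriv]
  field_simp

/-- The identity that characterizes `□`. -/
theorem box_exp (ξ : Fin 3 → ℝ) (z : Fin 3 → ℂ) :
    box (fun z => Complex.exp (Complex.I * pairing z ξ)) z =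
      (det ξ : ℂ) * Complex.exp (Complex.I * pairing z ξ) := by
  have h1 : (fun z => Complex.exp (Complex.I * pairing z ξ)) =
      fun z => 1 * Complex.exp (Complex.I * pairing z ξ) := by simp
  simp only [box]
  rw [h1, partialD_exp, partialD_exp, partialD_exp, partialD_exp]
  simp [pairing, det]
  ring

end TubeSigma

/-! Everything is read off on the frequency side. A function in the Hardy space is a Fourier–Laplace
integral `F(z) = ∫ e^{2πi z·η} f(η) dη` with `f ∈ L²` carried by the dual cone `η₀, η₁ ≥ 0`, `η₂² ≤
4η₀η₁`, and its norm is that of `f`. The operator `□` multiplies `f` by `4π²(4η₀η₁ - η₂²)`, and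
setting `z₃ = 0` integrates out `η₂`. So `R□ᵐF` is the Fourier–Laplace integral of `g(a) = ∫ (4π²(r²
- s²))ᵐ f(a, s) ds` over `|s| ≤ r = 2√(a₀a₁)`. By Plancherel and Tonelli the Bergman norm of such an
integral is the `L²` norm of `g` with weight `Γ(α+1)² / ((4π)²a₀a₁)^{α+1}` on the quadrant, where `α
= 2m - 1/2`.

For the first part, Cauchy–Schwarz in `s` bounds `|g(a)|²` by `∫|f(a, s)|² ds` times a constant
multiple of `r^{4m+1}`. This power cancels the weight exactly, since `2(α+1) = 4m+1`
(`enorm_integral_glue_sq_le`, `restrict_const_identity`, `restrict_box_le`). The resulting constant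
is smaller than the stated one by the factor `8π³`.

For the second part, represent `G` by a density `g`, which must vanish off the quadrant because the
weight is infinite there. Take `f(a, ·)` constant on each slice of the cone, normalized so that the
slice integral above is `g(a)`. The same power count turns the norm of `f` into an exact multiple of
the norm of `G` (`integral_boxSymbol_mul_extendDensity`, `lintegral_extendDensity_sq`,
`exists_extension`).

Both parts rest on one Paley–Wiener theorem for tubes over open convex sets,
`exists_eq_fourierLaplace`. Its core is that the integral of `F` times an entire Gaussian over the
slice above `y` does not depend on `y` (`integral_mul_gauss_eq`); pairing with Gaussians centered at
all real points then shows that the Fourier transforms of any two slices differ only by the expected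
exponential factor. The required local bound on slices is immediate in the Hardy space, and comes
from the mean value property in the Bergman space (`sliceNorm_locally_bounded`). -/

namespace TubeSigma

open MeasureTheory
open scoped ENNReal

/-! ### The `L²` Fourier transform and its agreement with Fourier integrals. -/

section FourierL2

open FourierTransform SchwartzMap
open scoped RealInnerProductSpace

variable {V : Type*} [NormedAddCommGroup V] [InnerProductSpace ℝ V] [FiniteDimensional ℝ V]
  [MeasurableSpace V] [BorelSpace V]

theorem eLpNorm_two_sq {α : Type*} [MeasurableSpace α] {μ : Measure α} (u : α → ℂ) :
    eLpNorm u 2 μ ^ 2 = ∫⁻ x, ‖u x‖ₑ ^ 2 ∂μ := by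
  rw [eLpNorm_eq_lintegral_rpow_enorm_toReal (by norm_num) (by norm_num)]
  simp only [ENNReal.toReal_ofNat, ENNReal.rpow_ofNat, one_div]
  rw [← ENNReal.rpow_natCast, ← ENNReal.rpow_mul]
  norm_num

theorem memLp_two_iff {α : Type*} [MeasurableSpace α] {μ : Measure α} {u : α → ℂ}
    (hu : AEStronglyMeasurable u μ) : MemLp u 2 μ ↔ ∫⁻ x, ‖u x‖ₑ ^ 2 ∂μ < ∞ := by
  rw [← eLpNorm_two_sq]
  simp [MemLp, hu, ENNReal.pow_lt_top_iff]

theorem lintegral_Lp_two_sq (U : Lp ℂ 2 (volume : Measure V)) :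
    ∫⁻ x, ‖U x‖ₑ ^ 2 = ‖U‖ₑ ^ 2 := by
  rw [← eLpNorm_two_sq, Lp.enorm_def]

theorem continuous_fourierInv {u : V → ℂ} (hu : Integrable u) : Continuous (𝓕⁻ u) := by
  have h : Continuous (𝓕 u) :=
    VectorFourier.fourierIntegral_continuous Real.continuous_fourierChar
      (by exact continuous_inner) hu
  have e : 𝓕⁻ u = fun w => 𝓕 u (-w) := funext fun w => Real.fourierInv_eq_fourier_neg u w
  rw [e]
  exact h.comp continuous_neg

theorem integral_mul_fourierInv_eq {u : V → ℂ} (hu : Integrable u) (ψ : 𝓢(V, ℂ)) :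
    ∫ x, ψ x * 𝓕⁻ u x = ∫ x, (𝓕⁻ ψ) x * u x := by
  -- With the form `-innerₗ V` the general Fourier integral is the inverse transform.
  have h := VectorFourier.integral_fourierIntegral_smul_eq_flip (L := -innerₗ V) (μ := volume)
    (ν := volume) (e := Real.fourierChar) (f := ⇑ψ) (g := u) Real.continuous_fourierChar
    (by exact (continuous_inner (𝕜 := ℝ) (E := V)).neg) ψ.integrable hu
  have e1 : ∀ v : V → ℂ, VectorFourier.fourierIntegral Real.fourierChar volume (-innerₗ V) v =
      𝓕⁻ v := by
    intro v; ext w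
    simp [VectorFourier.fourierIntegral, Real.fourierInv_eq]
  have e2 : (-innerₗ V).flip = -innerₗ V := by
    ext x y
    simp [real_inner_comm]
  rw [e2, e1, e1] at h
  simp only [smul_eq_mul] at h
  rw [← h, fourierInv_coe]

/-- The `L²` transform is characterized through tempered distributions. Both sides are locally
integrable and have the same pairing with every test function, by the multiplication formula for the
integrable `u`. -/
theorem ae_fourierInv_toLp {u : V → ℂ} (hu : Integrable u) (hu2 : MemLp u 2) :
    (𝓕⁻ (hu2.toLp u) : Lp ℂ 2 (volume : Measure V)) =ᵐ[volume] 𝓕⁻ u := by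
  refine ae_eq_of_integral_contDiff_smul_eq ((Lp.memLp _).locallyIntegrable (by norm_num))
    (continuous_fourierInv hu).locallyIntegrable ?_
  intro g hg hgs
  set ψ : 𝓢(V, ℂ) := HasCompactSupport.toSchwartzMap (f := fun x => (g x : ℂ))
    (hgs.comp_left (g := fun x : ℝ => (x : ℂ)) (by simp))
    (Complex.ofRealCLM.contDiff.comp hg) with hψ
  have h1 := congrArg (fun T => T ψ) (Lp.fourierInv_toTemperedDistribution_eq (hu2.toLp u))
  simp only [TemperedDistribution.fourierInv_apply, Lp.toTemperedDistribution_apply] at h1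
  have h2 := integral_mul_fourierInv_eq hu ψ
  have e : ∀ x, ψ x = (g x : ℂ) := fun x => rfl
  simp only [e, smul_eq_mul] at h1 h2
  simp only [Complex.real_smul]
  rw [← h1, h2]
  refine integral_congr_ae ?_
  filter_upwards [hu2.coeFn_toLp] with x hx
  rw [hx]

theorem lintegral_fourierInv_sq {u : V → ℂ} (hu : Integrable u) (hu2 : MemLp u 2) :
    ∫⁻ x, ‖𝓕⁻ u x‖ₑ ^ 2 = ∫⁻ x, ‖u x‖ₑ ^ 2 := by
  have h1 : ∫⁻ x, ‖𝓕⁻ u x‖ₑ ^ 2 = ∫⁻ x, ‖(𝓕⁻ (hu2.toLp u) : Lp ℂ 2 (volume : Measure V)) x‖ₑ ^ 2 :=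
    lintegral_congr_ae (by filter_upwards [ae_fourierInv_toLp hu hu2] with x hx; rw [hx])
  have h2 : ∫⁻ x, ‖u x‖ₑ ^ 2 = ∫⁻ x, ‖hu2.toLp u x‖ₑ ^ 2 :=
    lintegral_congr_ae (by filter_upwards [hu2.coeFn_toLp] with x hx; rw [hx])
  rw [h1, h2, lintegral_Lp_two_sq, lintegral_Lp_two_sq]
  congr 1
  have := (Lp.fourierTransformₗᵢ V ℂ).symm.norm_map (hu2.toLp u)
  rw [← ofReal_norm, ← ofReal_norm]
  congr 1

/-- Parseval for the pair `U` and the inverse transform of the conjugate of `γ`. Only `γ` has to be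
integrable, so `U` may be any `L²` slice. -/
theorem integral_fourier_mul {U : Lp ℂ 2 (volume : Measure V)} {γ : V → ℂ} (hγ : Integrable γ)
    (hγ2 : MemLp γ 2) : ∫ x, (𝓕 U : Lp ℂ 2 (volume : Measure V)) x * γ x = ∫ x, U x * 𝓕 γ x := by
  set δ : V → ℂ := fun x => starRingEnd ℂ (γ x) with hδ
  have hδi : Integrable δ := memLp_one_iff_integrable.1 (memLp_one_iff_integrable.2 hγ).star
  have hδ2 : MemLp δ 2 := hγ2.star
  have h := Lp.inner_fourier_eq (𝓕⁻ (hδ2.toLp δ)) U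
  rw [fourier_fourierInv_eq, L2.inner_def, L2.inner_def] at h
  have e1 : ∫ x, (𝓕 U : Lp ℂ 2 (volume : Measure V)) x * γ x =
      ∫ x, inner ℂ (hδ2.toLp δ x) ((𝓕 U : Lp ℂ 2 (volume : Measure V)) x) := by
    refine integral_congr_ae ?_
    filter_upwards [hδ2.coeFn_toLp] with x hx
    rw [hx]
    simp [hδ]
  have e2 : ∫ x, U x * 𝓕 γ x = ∫ x, inner ℂ
      ((𝓕⁻ (hδ2.toLp δ) : Lp ℂ 2 (volume : Measure V)) x) (U x) := by
    refine integral_congr_ae ?_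
    filter_upwards [ae_fourierInv_toLp hδi hδ2] with x hx
    have : starRingEnd ℂ (𝓕⁻ δ x) = 𝓕 γ x := by
      rw [Real.fourierInv_eq', Real.fourier_eq', ← integral_conj]
      congr 1; ext v
      simp [hδ, ← Complex.exp_conj, Complex.conj_ofNat]
    rw [hx]
    simp only [RCLike.inner_apply, this]
  rw [e1, e2, h]

end FourierL2

/-! ### Passage from Euclidean space to coordinate space `ι → ℝ`. -/

section Transfer

open FourierTransform

variable {ι : Type*} [Fintype ι]

/-- The Fourier–Laplace integral `∫ e^{2πi z·η} f(η) dη`. -/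
noncomputable def fourierLaplace (f : (ι → ℝ) → ℂ) (z : ι → ℂ) : ℂ :=
  ∫ η : ι → ℝ, Complex.exp (2 * Real.pi * Complex.I * ∑ j, z j * η j) * f η

theorem integral_toLp (f : EuclideanSpace ℝ ι → ℂ) :
    ∫ x : ι → ℝ, f (WithLp.toLp 2 x) = ∫ x, f x :=
  (PiLp.volume_preserving_toLp ι).integral_comp (MeasurableEquiv.toLp 2 (ι → ℝ)).measurableEmbedding f

theorem integral_ofLp (f : (ι → ℝ) → ℂ) :
    ∫ x : EuclideanSpace ℝ ι, f (WithLp.ofLp x) = ∫ x, f x :=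
  (PiLp.volume_preserving_ofLp ι).integral_comp
    (MeasurableEquiv.toLp 2 (ι → ℝ)).symm.measurableEmbedding f

theorem lintegral_ofLp (f : (ι → ℝ) → ℝ≥0∞) :
    ∫⁻ x : EuclideanSpace ℝ ι, f (WithLp.ofLp x) = ∫⁻ x, f x :=
  (PiLp.volume_preserving_ofLp ι).lintegral_comp_emb
    (MeasurableEquiv.toLp 2 (ι → ℝ)).symm.measurableEmbedding f

theorem lintegral_toLp (f : EuclideanSpace ℝ ι → ℝ≥0∞) :
    ∫⁻ x : ι → ℝ, f (WithLp.toLp 2 x) = ∫⁻ x, f x :=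
  (PiLp.volume_preserving_toLp ι).lintegral_comp_emb
    (MeasurableEquiv.toLp 2 (ι → ℝ)).measurableEmbedding f

theorem fourierLaplace_ofReal (f : (ι → ℝ) → ℂ) (x : ι → ℝ) :
    fourierLaplace f (fun j => (x j : ℂ)) =
      𝓕⁻ (fun v : EuclideanSpace ℝ ι => f (WithLp.ofLp v)) (WithLp.toLp 2 x) := by
  rw [Real.fourierInv_eq', fourierLaplace, ← integral_ofLp]
  congr 1; ext v
  simp only [PiLp.inner_apply, smul_eq_mul, RCLike.inner_apply, conj_trivial]
  congr 2
  push_cast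
  ring

theorem fourierLaplace_neg_ofReal (f : (ι → ℝ) → ℂ) (x : ι → ℝ) :
    fourierLaplace f (fun j => -(x j : ℂ)) =
      𝓕 (fun v : EuclideanSpace ℝ ι => f (WithLp.ofLp v)) (WithLp.toLp 2 x) := by
  have := fourierLaplace_ofReal f (-x)
  simp only [Pi.neg_apply, Complex.ofReal_neg] at this
  rw [this, Real.fourierInv_eq_fourier_neg]
  simp

theorem integrable_ofLp {f : (ι → ℝ) → ℂ} (hf : Integrable f) :
    Integrable (fun v : EuclideanSpace ℝ ι => f (WithLp.ofLp v)) :=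
  (PiLp.volume_preserving_ofLp ι).integrable_comp_of_integrable hf

theorem memLp_ofLp {f : (ι → ℝ) → ℂ} (hf : MemLp f 2) :
    MemLp (fun v : EuclideanSpace ℝ ι => f (WithLp.ofLp v)) 2 :=
  hf.comp_measurePreserving (PiLp.volume_preserving_ofLp ι)

theorem lintegral_fourierLaplace_sq {f : (ι → ℝ) → ℂ} (hf : Integrable f) (hf2 : MemLp f 2) :
    ∫⁻ x : ι → ℝ, ‖fourierLaplace f (fun j => (x j : ℂ))‖ₑ ^ 2 = ∫⁻ η, ‖f η‖ₑ ^ 2 := by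
  simp only [fourierLaplace_ofReal]
  rw [lintegral_toLp (fun v => ‖𝓕⁻ (fun v : EuclideanSpace ℝ ι => f (WithLp.ofLp v)) v‖ₑ ^ 2),
    lintegral_fourierInv_sq (integrable_ofLp hf) (memLp_ofLp hf2),
    lintegral_ofLp (fun v => ‖f v‖ₑ ^ 2)]

/-- When the right side is infinite there is nothing to prove. This form serves slice integrals that
are known to be integrable but not yet square integrable. -/
theorem lintegral_fourierLaplace_sq_le {f : (ι → ℝ) → ℂ} (hf : Integrable f) :
    ∫⁻ x : ι → ℝ, ‖fourierLaplace f (fun j => (x j : ℂ))‖ₑ ^ 2 ≤ ∫⁻ η, ‖f η‖ₑ ^ 2 := by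
  by_cases h : ∫⁻ η, ‖f η‖ₑ ^ 2 < ∞
  · exact (lintegral_fourierLaplace_sq hf ((memLp_two_iff hf.1).2 h)).le
  · rw [not_lt_top_iff.1 h]; exact le_top

theorem continuous_fourierLaplace_ofReal {f : (ι → ℝ) → ℂ} (hf : Integrable f) :
    Continuous fun x : ι → ℝ => fourierLaplace f (fun j => (x j : ℂ)) := by
  simp only [fourierLaplace_ofReal]
  exact (continuous_fourierInv (integrable_ofLp hf)).comp (PiLp.continuous_toLp 2 _)

/-- Existence of the `L²` Fourier transform, with the properties used below. -/
theorem exists_fourier_of_memLp {u : (ι → ℝ) → ℂ} (hu : MemLp u 2) :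
    ∃ v : (ι → ℝ) → ℂ, MemLp v 2 ∧ ∫⁻ η, ‖v η‖ₑ ^ 2 = ∫⁻ x, ‖u x‖ₑ ^ 2 ∧
      (∀ γ : (ι → ℝ) → ℂ, Integrable γ → MemLp γ 2 →
        ∫ η, v η * γ η = ∫ x, u x * fourierLaplace γ (fun j => -(x j : ℂ))) ∧
      (Integrable v → ∀ᵐ x, u x = fourierLaplace v (fun j => (x j : ℂ))) := by
  set U := (memLp_ofLp hu).toLp _ with hU
  have hUe := (memLp_ofLp hu).coeFn_toLp
  set W : Lp ℂ 2 (volume : Measure (EuclideanSpace ℝ ι)) := 𝓕 U with hW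
  refine ⟨fun η => W (WithLp.toLp 2 η),
    (Lp.memLp W).comp_measurePreserving (PiLp.volume_preserving_toLp ι), ?_, ?_, ?_⟩
  · rw [lintegral_toLp (fun v => ‖W v‖ₑ ^ 2), lintegral_Lp_two_sq, ← lintegral_ofLp]
    have : ‖W‖ₑ = ‖U‖ₑ := by
      rw [← ofReal_norm, ← ofReal_norm, Lp.norm_fourier_eq]
    rw [this, ← lintegral_Lp_two_sq]
    refine lintegral_congr_ae ?_
    filter_upwards [hUe] with x hx
    rw [hx]
  · intro γ hγ hγ2
    have h := integral_fourier_mul (U := U) (integrable_ofLp hγ) (memLp_ofLp hγ2)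
    simp only [fourierLaplace_neg_ofReal]
    rw [integral_toLp (fun v => W v * γ (WithLp.ofLp v)), h,
      ← integral_ofLp]
    refine integral_congr_ae ?_
    filter_upwards [hUe] with x hx
    rw [hx]
  · intro hv
    have hW1 : Integrable (fun v => W v) := by
      simpa using integrable_ofLp hv
    have h1 := ae_fourierInv_toLp hW1 (Lp.memLp W)
    rw [Lp.toLp_coeFn, hW, fourierInv_fourier_eq] at h1
    have h2 : ∀ᵐ x : EuclideanSpace ℝ ι, u (WithLp.ofLp x) = 𝓕⁻ (⇑W) x := by
      filter_upwards [hUe, h1] with x hx hx1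
      rw [← hx, ← hx1]
    have h3 := (PiLp.volume_preserving_toLp ι).quasiMeasurePreserving.ae h2
    filter_upwards [h3] with x hx
    rw [fourierLaplace_ofReal]
    exact hx

end Transfer

/-! ### Mean value inequalities and holomorphic parameter integrals. -/

section MeanValue

/-- Functions are constrained only on their domains; cutting them off there supplies the global
measurability that Tonelli needs. -/
theorem measurable_indicator_of_continuousOn {X : Type*} [TopologicalSpace X] [MeasurableSpace X]
    [BorelSpace X] {f : X → ℂ} {s : Set X} (hf : ContinuousOn f s) (hs : MeasurableSet s) :
    Measurable (s.indicator f) := by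
  classical
  rw [← Set.piecewise_eq_indicator]
  exact hf.measurable_piecewise continuous_const.continuousOn hs

/-- The mean value property is applied to the holomorphic function `g²`, followed by the triangle
inequality. The angle runs over `(-π, π)` to match polar coordinates. -/
theorem enorm_sq_le_lintegral_circle {g : ℂ → ℂ} {c : ℂ} {R ρ : ℝ}
    (hg : DifferentiableOn ℂ g (Metric.ball c R)) (h0 : 0 < ρ) (hR : ρ < R) :
    ENNReal.ofReal (2 * Real.pi) * ‖g c‖ₑ ^ 2 ≤
      ∫⁻ θ in Set.Ioo (-Real.pi) Real.pi, ‖g (circleMap c ρ θ)‖ₑ ^ 2 := by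
  have hsub : Metric.closedBall c ρ ⊆ Metric.ball c R := Metric.closedBall_subset_ball hR
  have h1 : Real.circleAverage (fun z => g z ^ 2) c ρ = g c ^ 2 := by
    refine DiffContOnCl.circleAverage (f := fun z => g z ^ 2) ?_
    rw [abs_of_pos h0]
    exact ((hg.pow 2).mono (by rw [closure_ball c h0.ne']; exact hsub)).diffContOnCl
  rw [Real.circleAverage_eq_integral_add (-Real.pi),
    intervalIntegral.integral_comp_add_right (fun θ => g (circleMap c ρ θ) ^ 2)] at h1
  have e : (2 * Real.pi + -Real.pi) = Real.pi := by ring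
  rw [zero_add, e, intervalIntegral.integral_of_le (by linarith [Real.pi_pos])] at h1
  have h2 : ((2 * Real.pi : ℝ) : ℂ) * g c ^ 2 =
      ∫ θ in Set.Ioc (-Real.pi) Real.pi, g (circleMap c ρ θ) ^ 2 := by
    rw [← h1, Complex.real_smul, ← mul_assoc]
    rw [← Complex.ofReal_mul, mul_inv_cancel₀ (by positivity)]
    simp
  have h3 := enorm_integral_le_lintegral_enorm (μ := volume.restrict (Set.Ioc (-Real.pi) Real.pi))
    (fun θ => g (circleMap c ρ θ) ^ 2)
  have e2 : ‖((2 * Real.pi : ℝ) : ℂ)‖ₑ = ENNReal.ofReal (2 * Real.pi) := by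
    rw [← ofReal_norm, Complex.norm_real, Real.norm_of_nonneg (by positivity)]
  rw [← h2, enorm_mul, e2] at h3
  simp only [enorm_pow] at h3
  rwa [← restrict_Ioo_eq_restrict_Ioc] at h3

theorem enorm_sq_le_lintegral_ball {g : ℂ → ℂ} {c : ℂ} {R : ℝ}
    (hg : DifferentiableOn ℂ g (Metric.ball c R)) (hR : 0 < R) :
    ENNReal.ofReal (Real.pi * R ^ 2) * ‖g c‖ₑ ^ 2 ≤ ∫⁻ ζ in Metric.ball c R, ‖g ζ‖ₑ ^ 2 := by
  set f : ℂ → ℂ := (Metric.ball c R).indicator g with hf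
  have hfm : Measurable f :=
    measurable_indicator_of_continuousOn hg.continuousOn Metric.isOpen_ball.measurableSet
  have hfm' : Measurable fun w => ‖f (c + w)‖ₑ ^ 2 :=
    (hfm.comp (measurable_const.add measurable_id)).enorm.pow_const 2
  have h1 : ∫⁻ ζ in Metric.ball c R, ‖g ζ‖ₑ ^ 2 = ∫⁻ w, ‖f (c + w)‖ₑ ^ 2 := by
    rw [lintegral_add_left_eq_self (fun w => ‖f w‖ₑ ^ 2) c,
      ← lintegral_indicator Metric.isOpen_ball.measurableSet]
    refine lintegral_congr fun w => ?_
    by_cases hw : w ∈ Metric.ball c R <;> simp [hf, hw]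
  rw [h1, ← Complex.lintegral_comp_polarCoord_symm, polarCoord_target, Measure.volume_eq_prod,
    ← Measure.prod_restrict, lintegral_prod]
  swap
  · refine Measurable.aemeasurable ?_
    refine (measurable_fst.ennreal_ofReal).smul (hfm'.comp ?_)
    have : Continuous fun p : ℝ × ℝ => Complex.polarCoord.symm p := by
      simp only [Complex.polarCoord_symm_apply]
      fun_prop
    exact this.measurable
  have key : ∀ ρ ∈ Set.Ioo 0 R, ENNReal.ofReal ρ * (ENNReal.ofReal (2 * Real.pi) * ‖g c‖ₑ ^ 2) ≤
      ∫⁻ θ in Set.Ioo (-Real.pi) Real.pi,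
        ENNReal.ofReal ρ • ‖f (c + Complex.polarCoord.symm (ρ, θ))‖ₑ ^ 2 := by
    intro ρ hρ
    simp only [smul_eq_mul]
    rw [lintegral_const_mul']
    swap
    · exact ENNReal.ofReal_ne_top
    gcongr
    refine (enorm_sq_le_lintegral_circle hg hρ.1 hρ.2).trans (le_of_eq ?_)
    refine lintegral_congr fun θ => ?_
    have e : c + Complex.polarCoord.symm (ρ, θ) = circleMap c ρ θ := by
      simp [Complex.polarCoord_symm_apply, circleMap, Complex.exp_mul_I]
    have hm : circleMap c ρ θ ∈ Metric.ball c R :=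
      Metric.sphere_subset_closedBall.trans (Metric.closedBall_subset_ball hρ.2)
        (circleMap_mem_sphere c hρ.1.le θ)
    rw [e, hf, Set.indicator_of_mem hm]
  calc ENNReal.ofReal (Real.pi * R ^ 2) * ‖g c‖ₑ ^ 2
      = ∫⁻ ρ in Set.Ioo 0 R, ENNReal.ofReal ρ * (ENNReal.ofReal (2 * Real.pi) * ‖g c‖ₑ ^ 2) := by
        rw [lintegral_mul_const _ (by fun_prop), ← ofReal_integral_eq_lintegral_ofReal,
          ← integral_Ioc_eq_integral_Ioo, ← intervalIntegral.integral_of_le hR.le, integral_id,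
          ← mul_assoc, ← ENNReal.ofReal_mul (by simp; positivity)]
        · congr 2; ring
        · exact (continuous_id.integrableOn_Icc (a := 0) (b := R)).mono_set Set.Ioo_subset_Icc_self
        · filter_upwards [ae_restrict_mem measurableSet_Ioo] with x hx using hx.1.le
    _ ≤ ∫⁻ ρ in Set.Ioo 0 R, ∫⁻ θ in Set.Ioo (-Real.pi) Real.pi,
          ENNReal.ofReal ρ • ‖f (c + Complex.polarCoord.symm (ρ, θ))‖ₑ ^ 2 :=
        setLIntegral_mono' measurableSet_Ioo key
    _ ≤ _ := lintegral_mono_set Set.Ioo_subset_Ioi_self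

/-- Domination of `g` alone suffices: Cauchy's estimate on circles of radius `r / 2` dominates the
derivative by `B / (r / 2)`. -/
theorem differentiableOn_integral {X : Type*} [MeasurableSpace X] {μ : Measure X}
    {g : X → ℂ → ℂ} {U : Set ℂ} (hU : IsOpen U) (hg : ∀ x, DifferentiableOn ℂ (g x) U)
    (hm : ∀ ζ ∈ U, AEStronglyMeasurable (fun x => g x ζ) μ)
    (hb : ∀ ζ₀ ∈ U, ∃ r > 0, ∃ B : X → ℝ, Integrable B μ ∧
      ∀ᵐ x ∂μ, ∀ ζ ∈ Metric.ball ζ₀ r, ‖g x ζ‖ ≤ B x) :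
    DifferentiableOn ℂ (fun ζ => ∫ x, g x ζ ∂μ) U := by
  intro ζ₀ h₀
  obtain ⟨r₁, hr₁, hsub⟩ := Metric.isOpen_iff.1 hU ζ₀ h₀
  obtain ⟨r₂, hr₂, B, hB, hle⟩ := hb ζ₀ h₀
  set r := min r₁ r₂ with hr
  have hr0 : 0 < r := lt_min hr₁ hr₂
  have hsubU : Metric.ball ζ₀ r ⊆ U := (Metric.ball_subset_ball (min_le_left _ _)).trans hsub
  have hsub2 : Metric.ball ζ₀ r ⊆ Metric.ball ζ₀ r₂ := Metric.ball_subset_ball (min_le_right _ _)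
  have hder : ∀ x, ∀ ζ ∈ Metric.ball ζ₀ r, HasDerivAt (g x) (deriv (g x) ζ) ζ := fun x ζ hζ =>
    ((hg x).differentiableAt (hU.mem_nhds (hsubU hζ))).hasDerivAt
  have hint : ∀ ζ ∈ Metric.ball ζ₀ r, Integrable (fun x => g x ζ) μ := fun ζ hζ =>
    hB.mono' (hm ζ (hsubU hζ)) (by filter_upwards [hle] with x hx using hx ζ (hsub2 hζ))
  refine (hasDerivAt_integral_of_dominated_loc_of_deriv_le (F := fun ζ x => g x ζ)
    (F' := fun ζ x => deriv (g x) ζ) (bound := fun x => B x / (r / 2))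
    (Metric.ball_mem_nhds ζ₀ (half_pos hr0)) ?_ (hint ζ₀ (Metric.mem_ball_self hr0)) ?_ ?_
    (hB.div_const _) ?_).2.differentiableAt.differentiableWithinAt
  · filter_upwards [hU.mem_nhds h₀] with ζ hζ using hm ζ hζ
  · have ht : Filter.Tendsto (fun n : ℕ => (((r / 2) * (1 / ((n : ℝ) + 1)) : ℝ) : ℂ))
        Filter.atTop (nhdsWithin 0 {0}ᶜ) := by
      refine tendsto_nhdsWithin_iff.2 ⟨?_, Filter.Eventually.of_forall fun n => ?_⟩
      · have := (tendsto_one_div_add_atTop_nhds_zero_nat (𝕜 := ℝ)).const_mul (r / 2)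
        rw [mul_zero] at this
        exact (Complex.continuous_ofReal.tendsto' 0 0 (by simp)).comp this
      · have : (r / 2) * (1 / ((n : ℝ) + 1)) ≠ 0 := by positivity
        simpa only [Set.mem_compl_iff, Set.mem_singleton_iff, Complex.ofReal_eq_zero] using this
    refine aestronglyMeasurable_of_tendsto_ae Filter.atTop
      (f := fun n : ℕ => fun x => (((r / 2) * (1 / ((n : ℝ) + 1)) : ℝ) : ℂ)⁻¹ •
        (g x (ζ₀ + (((r / 2) * (1 / ((n : ℝ) + 1)) : ℝ) : ℂ)) - g x ζ₀)) ?_ ?_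
    · intro n
      refine AEStronglyMeasurable.const_mul (f := fun x => g x _ - g x ζ₀)
        ((hm _ (hsubU ?_)).sub (hm _ h₀)) _
      have h1 : 1 / ((n : ℝ) + 1) ≤ 1 := by
        rw [div_le_one (by positivity)]; linarith [n.cast_nonneg (α := ℝ)]
      have h2 : 0 ≤ 1 / ((n : ℝ) + 1) := by positivity
      rw [Metric.mem_ball, dist_eq_norm, add_sub_cancel_left, Complex.norm_real,
        Real.norm_of_nonneg (by positivity)]
      nlinarith
    · refine Filter.Eventually.of_forall fun x => ?_
      exact (hasDerivAt_iff_tendsto_slope_zero.1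
        (hder x ζ₀ (Metric.mem_ball_self hr0))).comp ht
  · filter_upwards [hle] with x hx ζ hζ
    have hcl : Metric.closedBall ζ (r / 2) ⊆ Metric.ball ζ₀ r := by
      intro w hw
      rw [Metric.mem_closedBall] at hw
      rw [Metric.mem_ball] at hζ ⊢
      linarith [dist_triangle w ζ ζ₀]
    refine Complex.norm_deriv_le_of_forall_mem_sphere_norm_le (half_pos hr0) ?_ ?_
    · refine DifferentiableOn.diffContOnCl ?_
      rw [closure_ball ζ (half_pos hr0).ne']
      exact (hg x).mono (hcl.trans hsubU)
    · exact fun w hw => hx w (hsub2 (hcl (Metric.sphere_subset_closedBall hw)))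
  · refine Filter.Eventually.of_forall fun x ζ hζ => hder x ζ ?_
    exact Metric.ball_subset_ball (by linarith) hζ

end MeanValue

/-! ### Independence of Gaussian pairings from the slice. -/

section Contour

variable {ι : Type*}

/-- The point `x + iy`. -/
def tubePoint (x y : ι → ℝ) : ι → ℂ := fun j => (x j : ℂ) + (y j : ℂ) * Complex.I

/-- The tube domain `ℝⁿ + iΩ`. -/
def tubeOver (Ω : Set (ι → ℝ)) : Set (ι → ℂ) := {z | (fun j => (z j).im) ∈ Ω}

theorem tubePoint_im (x y : ι → ℝ) : (fun j => (tubePoint x y j).im) = y := by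
  ext j; simp [tubePoint]

theorem tubePoint_re_im (z : ι → ℂ) :
    tubePoint (fun j => (z j).re) (fun j => (z j).im) = z := by
  ext j; simp [tubePoint]

theorem tubePoint_mem {Ω : Set (ι → ℝ)} {x y : ι → ℝ} : tubePoint x y ∈ tubeOver Ω ↔ y ∈ Ω := by
  simp only [tubeOver, Set.mem_ofPred_eq, tubePoint_im]

theorem isOpen_tubeOver {Ω : Set (ι → ℝ)} (hΩ : IsOpen Ω) : IsOpen (tubeOver Ω) :=
  hΩ.preimage (by fun_prop)

theorem continuous_tubePoint_left (y : ι → ℝ) : Continuous fun x : ι → ℝ => tubePoint x y := by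
  unfold tubePoint; fun_prop

theorem tubePoint_add_smul (x y v : ι → ℝ) (ζ : ℂ) :
    tubePoint x y + (fun j => ζ * (v j : ℂ)) = tubePoint (x + ζ.re • v) (y + ζ.im • v) := by
  ext j
  apply Complex.ext <;> simp [tubePoint]

variable [Fintype ι]

/-- The squared `L²` norm of the slice `x ↦ F(x + iy)`. -/
noncomputable def sliceNorm (F : (ι → ℂ) → ℂ) (y : ι → ℝ) : ℝ≥0∞ :=
  ∫⁻ x : ι → ℝ, ‖F (tubePoint x y)‖ₑ ^ 2

/-- The entire Gaussian centered at the real point `b`. -/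
noncomputable def gauss (b : ι → ℝ) (z : ι → ℂ) : ℂ :=
  Complex.exp (-Real.pi * ∑ j, (z j - b j) ^ 2)

theorem norm_gauss_le (b x y : ι → ℝ) : ‖gauss b (tubePoint x y)‖ ≤
    Real.exp (Real.pi * ∑ j, (b j ^ 2 + y j ^ 2)) * Real.exp (-(Real.pi / 2) * ∑ j, x j ^ 2) := by
  rw [gauss, Complex.norm_exp, ← Real.exp_add]
  refine Real.exp_le_exp.2 ?_
  have : ((-(Real.pi : ℂ)) * ∑ j, (tubePoint x y j - b j) ^ 2).re =
      -Real.pi * ∑ j, ((x j - b j) ^ 2 - y j ^ 2) := by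
    rw [← Complex.ofReal_neg, Complex.re_ofReal_mul, Complex.re_sum]
    congr 1
    refine Finset.sum_congr rfl fun j _ => ?_
    simp [tubePoint, pow_two]
  rw [this, neg_mul, neg_mul, ← sub_nonneg]
  have h2 : Real.pi * ∑ j, (b j ^ 2 + y j ^ 2) + -(Real.pi / 2 * ∑ j, x j ^ 2) -
      -(Real.pi * ∑ j, ((x j - b j) ^ 2 - y j ^ 2)) =
      Real.pi * ∑ j, (2 * (b j - x j / 2) ^ 2) := by
    rw [div_mul_eq_mul_div, mul_div_assoc, Finset.sum_div, ← mul_neg, ← mul_neg, ← mul_add,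
      ← mul_sub, ← Finset.sum_neg_distrib, ← Finset.sum_neg_distrib, ← Finset.sum_add_distrib,
      ← Finset.sum_sub_distrib]
    congr 1
    refine Finset.sum_congr rfl fun j _ => ?_
    ring
  rw [h2]
  have := Real.pi_pos
  positivity

theorem integrable_exp_neg_sum_sq : Integrable fun x : ι → ℝ => Real.exp (-Real.pi * ∑ j, x j ^ 2) := by
  have := (GaussianFourier.integrable_cexp_neg_mul_sum_add (ι := ι) (b := (Real.pi : ℂ))
    (by simpa using Real.pi_pos) 0).norm
  refine this.congr (Filter.Eventually.of_forall fun x => ?_)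
  simp only [Pi.zero_apply, zero_mul, Finset.sum_const_zero, add_zero, Complex.norm_exp]
  congr 1
  have : (-(Real.pi : ℂ) * ∑ j, (x j : ℂ) ^ 2) = ((-Real.pi * ∑ j, x j ^ 2 : ℝ) : ℂ) := by
    push_cast; ring
  rw [this, Complex.ofReal_re]

theorem differentiable_gauss (b : ι → ℝ) : Differentiable ℂ (gauss b) := by
  unfold gauss; fun_prop

/-- Move from `y` to `y'` along the complex line `ζ ↦ x + iy + ζ(y' - y)`. The integral over `x` is
holomorphic in `ζ`, and translation invariance makes it independent of `Re ζ`. Its derivative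
therefore vanishes, and the values at `0` and `i` agree. -/
theorem integral_mul_gauss_eq {Ω : Set (ι → ℝ)} (hΩ : IsOpen Ω) (hc : Convex ℝ Ω)
    {F : (ι → ℂ) → ℂ} (hF : DifferentiableOn ℂ F (tubeOver Ω)) (hFm : Measurable F)
    (hN : ∀ y ∈ Ω, ∃ C < ∞, ∀ᶠ y' in nhds y, sliceNorm F y' ≤ C) (b : ι → ℝ)
    {y y' : ι → ℝ} (hy : y ∈ Ω) (hy' : y' ∈ Ω) :
    ∫ x : ι → ℝ, F (tubePoint x y) * gauss b (tubePoint x y) =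
      ∫ x : ι → ℝ, F (tubePoint x y') * gauss b (tubePoint x y') := by
  set v : ι → ℝ := y' - y with hv
  set H : (ι → ℂ) → ℂ := fun z => F z * gauss b z with hH
  have hHd : DifferentiableOn ℂ H (tubeOver Ω) := hF.mul (differentiable_gauss b).differentiableOn
  have hHm : Measurable H := hFm.mul (differentiable_gauss b).continuous.measurable
  set S : Set ℂ := {ζ | y + ζ.im • v ∈ Ω} with hS
  have hSc : Continuous fun ζ : ℂ => y + ζ.im • v := by fun_prop
  have hSo : IsOpen S := hΩ.preimage hSc
  have hSconv : Convex ℝ S := by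
    intro ζ hζ ξ hξ s t hs ht hst
    have := hc hζ hξ hs ht hst
    simp only [hS, Set.mem_ofPred_eq]
    convert this using 1
    simp only [Complex.add_im, Complex.smul_im, smul_eq_mul, smul_add, add_smul, mul_smul]
    have : y = s • y + t • y := by rw [← add_smul, hst, one_smul]
    nth_rw 1 [this]
    abel
  set h : ℂ → ℂ := fun ζ => ∫ x : ι → ℝ, H (tubePoint x y + (fun j => ζ * (v j : ℂ))) with hh
  have hmem : ∀ (x : ι → ℝ) (ζ : ℂ), ζ ∈ S →
      tubePoint x y + (fun j => ζ * (v j : ℂ)) ∈ tubeOver Ω := by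
    intro x ζ hζ
    rw [tubePoint_add_smul]
    exact tubePoint_mem.2 hζ
  have hinv : ∀ ζ : ℂ, h ζ = ∫ x : ι → ℝ, H (tubePoint x (y + ζ.im • v)) := by
    intro ζ
    simp only [hh, tubePoint_add_smul]
    exact integral_add_right_eq_self (fun x => H (tubePoint x (y + ζ.im • v))) (ζ.re • v)
  have hlin : ∀ (x : ι → ℝ), Differentiable ℂ
      fun ζ : ℂ => tubePoint x y + (fun j => ζ * (v j : ℂ)) := by
    intro x
    fun_prop
  have hd : DifferentiableOn ℂ h S := by
    refine differentiableOn_integral hSo ?_ ?_ ?_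
    · intro x
      exact hHd.comp (hlin x).differentiableOn fun ζ hζ => hmem x ζ hζ
    · intro ζ _
      refine (hHm.comp ?_).aestronglyMeasurable
      exact ((continuous_tubePoint_left y).add continuous_const).measurable
    · intro ζ₀ hζ₀
      obtain ⟨C, hC, hCe⟩ := hN _ hζ₀
      have h1 : ∀ᶠ ζ in nhds ζ₀, ζ ∈ S ∧ sliceNorm F (y + ζ.im • v) ≤ C :=
        (hSo.eventually_mem hζ₀).and (hSc.continuousAt.eventually hCe)
      obtain ⟨R, hR, hball⟩ := Metric.eventually_nhds_iff_ball.1 h1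
      set r := R / 2 with hr
      have hr0 : 0 < r := half_pos hR
      have hbd : ∃ K, ∀ ζ ∈ Metric.closedBall ζ₀ r,
          Real.exp (Real.pi * ∑ j, ((b j - ζ.re * v j) ^ 2 + (y j + ζ.im * v j) ^ 2)) ≤ K := by
        have := (isCompact_closedBall ζ₀ r).bddAbove_image (f := fun ζ : ℂ =>
          Real.exp (Real.pi * ∑ j, ((b j - ζ.re * v j) ^ 2 + (y j + ζ.im * v j) ^ 2)))
          (by fun_prop)
        obtain ⟨K, hK⟩ := this
        exact ⟨K, fun ζ hζ => hK ⟨ζ, hζ, rfl⟩⟩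
      obtain ⟨K, hK⟩ := hbd
      set Q : (ι → ℝ) → ℝ≥0∞ := fun x =>
        ∫⁻ ζ in Metric.ball ζ₀ R, ‖F (tubePoint x y + (fun j => ζ * (v j : ℂ)))‖ₑ ^ 2 with hQ
      have hjm : Measurable fun p : (ι → ℝ) × ℂ =>
          ‖F (tubePoint p.1 y + (fun j => p.2 * (v j : ℂ)))‖ₑ ^ 2 := by
        refine (hFm.comp ?_).enorm.pow_const 2
        refine Continuous.measurable ?_
        exact ((continuous_tubePoint_left y).comp continuous_fst).add (by fun_prop)
      have hQm : Measurable Q := Measurable.lintegral_prod_right' hjm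
      have hQi : ∫⁻ x, Q x < ∞ := by
        simp only [hQ]
        rw [lintegral_lintegral_swap hjm.aemeasurable]
        calc _ ≤ ∫⁻ ζ in Metric.ball ζ₀ R, C := by
              refine setLIntegral_mono' Metric.isOpen_ball.measurableSet fun ζ hζ => ?_
              refine le_trans (le_of_eq ?_) (hball ζ hζ).2
              simp only [tubePoint_add_smul, sliceNorm]
              exact lintegral_add_right_eq_self
                (fun x => ‖F (tubePoint x (y + ζ.im • v))‖ₑ ^ 2) (ζ.re • v)
          _ < ∞ := by
              rw [setLIntegral_const]
              exact ENNReal.mul_lt_top hC measure_ball_lt_top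
      -- The dominating function comes from `|F||γ| ≤ |F|² + |γ|²`. The mean value inequality bounds
      -- `|F|²` by `Q / (πr²)`, where `Q` is integrable in `x` by Tonelli and the local bound on
      -- slices; `|γ|²` is bounded by a fixed Gaussian. The choice `r = R / 2` keeps the discs of
      -- radius `r` inside the one that defines `Q`.
      refine ⟨r, hr0, fun x => (Q x).toReal / (Real.pi * r ^ 2) +
        K ^ 2 * Real.exp (-Real.pi * ∑ j, x j ^ 2), ?_, ?_⟩
      · exact ((integrable_toReal_of_lintegral_ne_top hQm.aemeasurable hQi.ne).div_const _).add
          (integrable_exp_neg_sum_sq.const_mul _)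
      · filter_upwards [ae_lt_top hQm hQi.ne] with x hx ζ hζ
        have hsub : Metric.ball ζ r ⊆ Metric.ball ζ₀ R := by
          intro w hw
          rw [Metric.mem_ball] at hw hζ ⊢
          linarith [dist_triangle w ζ ζ₀]
        have h2 : ‖F (tubePoint x y + (fun j => ζ * (v j : ℂ)))‖ ^ 2 ≤
            (Q x).toReal / (Real.pi * r ^ 2) := by
          have hsub' : Metric.ball ζ r ⊆ S := fun w hw => (hball w (hsub hw)).1
          have h3 := enorm_sq_le_lintegral_ball
            (g := fun ζ => F (tubePoint x y + (fun j => ζ * (v j : ℂ)))) (c := ζ) (R := r)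
            (hF.comp (hlin x).differentiableOn fun w hw => hmem x w (hsub' hw)) hr0
          have h4 := h3.trans (lintegral_mono_set (μ := volume) hsub)
          rw [le_div_iff₀ (by positivity), mul_comm]
          have h5 := ENNReal.toReal_mono hx.ne h4
          rwa [ENNReal.toReal_mul, ENNReal.toReal_pow, toReal_enorm,
            ENNReal.toReal_ofReal (by positivity)] at h5
        have h6 : ‖gauss b (tubePoint x y + (fun j => ζ * (v j : ℂ)))‖ ≤
            K * Real.exp (-(Real.pi / 2) * ∑ j, x j ^ 2) := by
          have e : gauss b (tubePoint x y + (fun j => ζ * (v j : ℂ))) =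
              gauss (b - ζ.re • v) (tubePoint x (y + ζ.im • v)) := by
            rw [tubePoint_add_smul]
            simp only [gauss, tubePoint]
            congr 3; ext j
            simp only [Pi.add_apply, Pi.sub_apply, Pi.smul_apply, smul_eq_mul]
            push_cast; ring
          rw [e]
          refine (norm_gauss_le _ _ _).trans ?_
          gcongr
          exact hK ζ (Metric.ball_subset_closedBall hζ)
        have h7 : K ^ 2 * Real.exp (-Real.pi * ∑ j, x j ^ 2) =
            (K * Real.exp (-(Real.pi / 2) * ∑ j, x j ^ 2)) ^ 2 := by
          rw [mul_pow, ← Real.exp_nat_mul]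
          congr 2; push_cast; ring
        rw [h7, hH, norm_mul]
        set A := ‖F (tubePoint x y + (fun j => ζ * (v j : ℂ)))‖
        set G := ‖gauss b (tubePoint x y + (fun j => ζ * (v j : ℂ)))‖
        have hG : G ^ 2 ≤ (K * Real.exp (-(Real.pi / 2) * ∑ j, x j ^ 2)) ^ 2 :=
          pow_le_pow_left₀ (norm_nonneg _) h6 2
        nlinarith [sq_nonneg (A - G), sq_nonneg (A + G)]
  have h0S : (0 : ℂ) ∈ S := by simpa [hS] using hy
  have h1S : Complex.I ∈ S := by simpa [hS, hv] using hy'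
  have hderiv : Set.EqOn (deriv h) 0 S := by
    intro ζ hζ
    have h1 : HasDerivAt h (deriv h ζ) ζ :=
      (hd.differentiableAt (hSo.mem_nhds hζ)).hasDerivAt
    -- The complex derivative is computed along the real direction, in which `h` is constant.
    have h2 : HasDerivAt (fun t : ℝ => h (ζ + t)) (deriv h ζ) 0 := by
      have h3 : HasDerivAt (fun w => h (ζ + w)) (deriv h ζ) ((0 : ℝ) : ℂ) :=
        HasDerivAt.comp_const_add ζ _ (by simpa only [Complex.ofReal_zero, add_zero] using h1)
      exact h3.comp_ofReal
    have h4 : (fun t : ℝ => h (ζ + t)) = fun _ => h ζ := by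
      ext t
      rw [hinv, hinv]; simp
    rw [h4] at h2
    exact h2.unique (hasDerivAt_const _ _)
  have := hSo.is_const_of_deriv_eq_zero hSconv.isPreconnected hd hderiv h0S h1S
  rw [hinv, hinv] at this
  simpa [hv] using this

end Contour

/-! ### Densities with exponential weights and their Fourier–Laplace integrals. -/

section Admissible

variable {ι : Type*} [Fintype ι]

/-- The weight `e^{-2π y·η}`. -/
noncomputable def expWeight (y η : ι → ℝ) : ℝ := Real.exp (-(2 * Real.pi) * ∑ j, y j * η j)

/-- `f` is measurable and `e^{-2π y·η} f ∈ L²` for all `y ∈ Ω`. -/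
def Admissible (Ω : Set (ι → ℝ)) (f : (ι → ℝ) → ℂ) : Prop :=
  Measurable f ∧ ∀ y ∈ Ω, MemLp (fun η => (expWeight y η : ℂ) * f η) 2

theorem expWeight_pos (y η : ι → ℝ) : 0 < expWeight y η := Real.exp_pos _

theorem continuous_expWeight (y : ι → ℝ) : Continuous (expWeight y) := by
  unfold expWeight; fun_prop

theorem expWeight_add (y y' η : ι → ℝ) :
    expWeight (y + y') η = expWeight y η * expWeight y' η := by
  simp only [expWeight, Pi.add_apply, add_mul, Finset.sum_add_distrib, mul_add, Real.exp_add]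

theorem expWeight_single [DecidableEq ι] (j : ι) (t : ℝ) (η : ι → ℝ) :
    expWeight (Pi.single j t) η = Real.exp (-(2 * Real.pi * t * η j)) := by
  simp only [expWeight, Pi.single_apply, ite_mul, zero_mul, Finset.sum_ite_eq', Finset.mem_univ,
    if_true]
  congr 1; ring

theorem norm_expWeight_mul (y η : ι → ℝ) (c : ℂ) :
    ‖(expWeight y η : ℂ) * c‖ = expWeight y η * ‖c‖ := by
  rw [norm_mul, Complex.norm_real, Real.norm_of_nonneg (expWeight_pos y η).le]

theorem integrable_exp_neg_mul_norm {c : ℝ} (hc : 0 < c) :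
    Integrable fun η : ι → ℝ => Real.exp (-c * ‖η‖) := by
  set n : ℕ := Module.finrank ℝ (ι → ℝ) + 1 with hn
  -- With `d ≤ 1` one has `log(d(1 + ‖η‖)) ≤ d‖η‖`, and `dn ≤ c` then gives `e^{-c‖η‖} ≤ (d(1 +
  -- ‖η‖))^{-n}`, integrable because `n` exceeds the dimension.
  set d : ℝ := min (c / n) 1 with hd
  have hn0 : (0 : ℝ) < n := by rw [hn]; positivity
  have hd0 : 0 < d := lt_min (div_pos hc hn0) one_pos
  have h := (integrable_one_add_norm (E := ι → ℝ) (μ := volume) (r := n)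
    (by rw [hn]; push_cast; linarith)).const_mul ((d⁻¹) ^ n)
  refine h.mono' (by fun_prop) (Filter.Eventually.of_forall fun η => ?_)
  rw [Real.norm_of_nonneg (Real.exp_pos _).le, Real.rpow_neg (by positivity), Real.rpow_natCast,
    ← inv_pow, ← mul_pow, ← mul_inv, ← Real.exp_log (x := d * (1 + ‖η‖)) (by positivity),
    ← Real.exp_neg, ← Real.exp_nat_mul, Real.exp_le_exp]
  have h1 : Real.log (d * (1 + ‖η‖)) ≤ d * ‖η‖ := by
    rw [Real.log_le_iff_le_exp (by positivity)]
    have := Real.add_one_le_exp (d * ‖η‖)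
    have : d ≤ 1 := min_le_right _ _
    nlinarith [norm_nonneg η]
  have h2 : d * n ≤ c := by
    calc d * n ≤ c / n * n := by gcongr; exact min_le_left _ _
      _ = c := by field_simp
  nlinarith [norm_nonneg η, mul_le_mul_of_nonneg_left h1 hn0.le,
    mul_le_mul_of_nonneg_right h2 (norm_nonneg η)]

theorem exp_mul_norm_le_sum {c : ℝ} (hc : 0 < c) (η : ι → ℝ) :
    Real.exp (c * ‖η‖) ≤ 1 + ∑ j, (Real.exp (c * η j) + Real.exp (-(c * η j))) := by
  set S := 1 + ∑ j, (Real.exp (c * η j) + Real.exp (-(c * η j))) with hS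
  have hS1 : 1 ≤ S := by
    rw [hS]; simp only [le_add_iff_nonneg_right]; positivity
  rw [← Real.le_log_iff_exp_le (by linarith), mul_comm, ← le_div_iff₀ hc,
    pi_norm_le_iff_of_nonneg (div_nonneg (Real.log_nonneg hS1) hc.le)]
  intro j
  rw [le_div_iff₀ hc, Real.le_log_iff_exp_le (by linarith), Real.norm_eq_abs, mul_comm]
  have h1 : Real.exp (c * η j) + Real.exp (-(c * η j)) ≤
      ∑ j, (Real.exp (c * η j) + Real.exp (-(c * η j))) :=
    Finset.single_le_sum (f := fun j => Real.exp (c * η j) + Real.exp (-(c * η j)))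
      (fun j _ => by positivity) (Finset.mem_univ j)
  rcases abs_cases (η j) with ⟨h, _⟩ | ⟨h, _⟩ <;> rw [h]
  · linarith [Real.exp_pos (-(c * η j))]
  · rw [mul_neg]; linarith [Real.exp_pos (c * η j)]

namespace Admissible

variable {Ω : Set (ι → ℝ)} {f g : (ι → ℝ) → ℂ}

/-- Openness leaves room to shift `y` by `±δ` in every coordinate. The sum of the shifted weights
dominates `e^{2πδ‖η‖}` times the original one, so a little exponential decay comes for free. -/
theorem exists_memLp_exp (hΩ : IsOpen Ω) (hf : Admissible Ω f) {y : ι → ℝ} (hy : y ∈ Ω) :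
    ∃ c > 0, MemLp (fun η => (Real.exp (c * ‖η‖) : ℂ) * ((expWeight y η : ℂ) * f η)) 2 := by
  classical
  obtain ⟨r, hr, hball⟩ := Metric.isOpen_iff.1 hΩ y hy
  set δ := r / 2 with hδ
  have hδ0 : 0 < δ := half_pos hr
  have hmem : ∀ j, ∀ t : ℝ, |t| ≤ δ → y + Pi.single j t ∈ Ω := by
    intro j t ht
    refine hball ?_
    rw [mem_ball_iff_norm, add_sub_cancel_left, Pi.norm_single, Real.norm_eq_abs]
    linarith
  refine ⟨2 * Real.pi * δ, by positivity, ?_⟩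
  have hG : MemLp (fun η => ‖(expWeight y η : ℂ) * f η‖ +
      ∑ j, (‖(expWeight (y + Pi.single j (-δ)) η : ℂ) * f η‖ +
        ‖(expWeight (y + Pi.single j δ) η : ℂ) * f η‖)) 2 := by
    refine (hf.2 y hy).norm.add (memLp_finsetSum _ fun j _ => ?_)
    exact (hf.2 _ (hmem j _ (by rw [abs_neg, abs_of_pos hδ0]))).norm.add
      (hf.2 _ (hmem j _ (by rw [abs_of_pos hδ0]))).norm
  refine hG.mono' ?_ (Filter.Eventually.of_forall fun η => ?_)
  · refine Measurable.aestronglyMeasurable ?_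
    have h1 := hf.1
    have h2 := (continuous_expWeight y).measurable
    fun_prop
  · simp only [norm_expWeight_mul]
    simp only [expWeight_add, expWeight_single]
    rw [norm_mul, norm_expWeight_mul, Complex.norm_real, Real.norm_of_nonneg (Real.exp_pos _).le]
    refine (mul_le_mul_of_nonneg_right (exp_mul_norm_le_sum (by positivity) η)
      (mul_nonneg (expWeight_pos y η).le (norm_nonneg _))).trans (le_of_eq ?_)
    rw [add_mul, one_mul, Finset.sum_mul]
    congr 1
    refine Finset.sum_congr rfl fun j _ => ?_
    have e : -(2 * Real.pi * -δ * η j) = 2 * Real.pi * δ * η j := by ring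
    rw [e]
    ring

/-- Half of the exponential gain is kept; the other half, `e^{-c‖η‖/2} ∈ L²`, turns `L²` into `L¹`
by Cauchy–Schwarz. -/
theorem exists_integrable_exp (hΩ : IsOpen Ω) (hf : Admissible Ω f) {y : ι → ℝ} (hy : y ∈ Ω) :
    ∃ c > 0, Integrable (fun η => Real.exp (c * ‖η‖) * (expWeight y η * ‖f η‖)) := by
  obtain ⟨c, hc, h⟩ := hf.exists_memLp_exp hΩ hy
  refine ⟨c / 2, half_pos hc, ?_⟩
  have h1 : MemLp (fun η : ι → ℝ => Real.exp (-(c / 2) * ‖η‖)) 2 := by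
    rw [memLp_two_iff_integrable_sq (by fun_prop)]
    refine (integrable_exp_neg_mul_norm (ι := ι) hc).congr (Filter.Eventually.of_forall fun η => ?_)
    simp only
    rw [← Real.exp_nat_mul]
    congr 1; push_cast; ring
  refine (h1.integrable_mul h.norm).congr (Filter.Eventually.of_forall fun η => ?_)
  simp only [Pi.mul_apply]
  rw [norm_mul, norm_expWeight_mul, Complex.norm_real, Real.norm_of_nonneg (Real.exp_pos _).le,
    ← mul_assoc, ← Real.exp_add]
  congr 2; ring

theorem integrable (hΩ : IsOpen Ω) (hf : Admissible Ω f) {y : ι → ℝ} (hy : y ∈ Ω) :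
    Integrable (fun η => (expWeight y η : ℂ) * f η) := by
  obtain ⟨c, hc, h⟩ := hf.exists_integrable_exp hΩ hy
  refine h.mono' (hf.2 y hy).1 (Filter.Eventually.of_forall fun η => ?_)
  rw [norm_expWeight_mul]
  exact le_mul_of_one_le_left (mul_nonneg (expWeight_pos y η).le (norm_nonneg _))
    (Real.one_le_exp (by positivity))

theorem const_mul (hf : Admissible Ω f) (c : ℂ) : Admissible Ω fun η => c * f η :=
  ⟨hf.1.const_mul c, fun y hy => by
    simpa only [mul_left_comm] using (hf.2 y hy).const_mul c⟩

theorem add (hf : Admissible Ω f) (hg : Admissible Ω g) : Admissible Ω fun η => f η + g η :=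
  ⟨hf.1.add hg.1, fun y hy => by simpa only [mul_add] using! (hf.2 y hy).add (hg.2 y hy)⟩

/-- The exponential gain absorbs a polynomial factor: `|η_j| ≤ c⁻¹ e^{c‖η‖}`. This lets `□` act on
densities. -/
theorem coord_mul (hΩ : IsOpen Ω) (hf : Admissible Ω f) (j : ι) :
    Admissible Ω fun η => (η j : ℂ) * f η := by
  have hm : Measurable fun η : ι → ℝ => (η j : ℂ) * f η := by
    have := hf.1
    fun_prop
  refine ⟨hm, fun y hy => ?_⟩
  obtain ⟨c, hc, h⟩ := hf.exists_memLp_exp hΩ hy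
  refine (h.const_mul ((c⁻¹ : ℝ) : ℂ)).mono ?_ (Filter.Eventually.of_forall fun η => ?_)
  · have := (continuous_expWeight y).measurable
    exact Measurable.aestronglyMeasurable (by fun_prop)
  · rw [norm_expWeight_mul, norm_mul, norm_mul, norm_mul, norm_expWeight_mul, Complex.norm_real,
      Complex.norm_real, Complex.norm_real, Real.norm_of_nonneg (Real.exp_pos _).le,
      Real.norm_of_nonneg (inv_pos.2 hc).le]
    have h1 : ‖η j‖ ≤ c⁻¹ * Real.exp (c * ‖η‖) := by
      have h2 := norm_le_pi_norm η j
      have h3 := Real.add_one_le_exp (c * ‖η‖)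
      rw [inv_mul_eq_div, le_div_iff₀ hc]
      nlinarith
    calc expWeight y η * (‖η j‖ * ‖f η‖) = ‖η j‖ * (expWeight y η * ‖f η‖) := by ring
      _ ≤ c⁻¹ * Real.exp (c * ‖η‖) * (expWeight y η * ‖f η‖) :=
        mul_le_mul_of_nonneg_right h1 (mul_nonneg (expWeight_pos y η).le (norm_nonneg _))
      _ = _ := by ring

end Admissible

theorem exp_pairing_tubePoint (x y η : ι → ℝ) :
    Complex.exp (2 * Real.pi * Complex.I * ∑ j, tubePoint x y j * η j) =
      Complex.exp (2 * Real.pi * Complex.I * ∑ j, (x j : ℂ) * η j) * (expWeight y η : ℂ) := by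
  rw [expWeight, Complex.ofReal_exp, ← Complex.exp_add]
  congr 1
  push_cast
  simp only [tubePoint, add_mul, Finset.sum_add_distrib, mul_add, mul_right_comm _ Complex.I,
    ← Finset.sum_mul]
  linear_combination (2 * Real.pi * ∑ j, (y j : ℂ) * η j) * Complex.I_mul_I

theorem norm_exp_pairing (z : ι → ℂ) (η : ι → ℝ) :
    ‖Complex.exp (2 * Real.pi * Complex.I * ∑ j, z j * η j)‖ =
      expWeight (fun j => (z j).im) η := by
  rw [← tubePoint_re_im z, exp_pairing_tubePoint, tubePoint_re_im, norm_mul, Complex.norm_real,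
    Real.norm_of_nonneg (expWeight_pos _ _).le]
  have : (2 * Real.pi * Complex.I * ∑ j, ((z j).re : ℂ) * η j) =
      ((2 * Real.pi * ∑ j, (z j).re * η j : ℝ) : ℂ) * Complex.I := by
    push_cast; ring
  rw [this, Complex.norm_exp_ofReal_mul_I, one_mul]

theorem fourierLaplace_tubePoint (f : (ι → ℝ) → ℂ) (x y : ι → ℝ) :
    fourierLaplace f (tubePoint x y) =
      fourierLaplace (fun η => (expWeight y η : ℂ) * f η) (fun j => (x j : ℂ)) := by
  simp only [fourierLaplace, exp_pairing_tubePoint]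
  congr 1; ext η
  ring

theorem sliceNorm_fourierLaplace {Ω : Set (ι → ℝ)} (hΩ : IsOpen Ω) {f : (ι → ℝ) → ℂ}
    (hf : Admissible Ω f) {y : ι → ℝ} (hy : y ∈ Ω) :
    sliceNorm (fourierLaplace f) y = ∫⁻ η, ‖(expWeight y η : ℂ) * f η‖ₑ ^ 2 := by
  simp only [sliceNorm, fourierLaplace_tubePoint]
  exact lintegral_fourierLaplace_sq (hf.integrable hΩ hy) (hf.2 y hy)

theorem hasFDerivAt_fourierLaplace {Ω : Set (ι → ℝ)} (hΩ : IsOpen Ω) {f : (ι → ℝ) → ℂ}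
    (hf : Admissible Ω f) {z : ι → ℂ} (hz : z ∈ tubeOver Ω) :
    ∃ L : (ι → ℂ) →L[ℂ] ℂ, HasFDerivAt (fourierLaplace f) L z ∧ ∀ v, L v =
      fourierLaplace (fun η => (2 * Real.pi * Complex.I * ∑ j, v j * η j) * f η) z := by
  set y : ι → ℝ := fun j => (z j).im with hy
  obtain ⟨c, hc, hint⟩ := hf.exists_integrable_exp hΩ hz
  set n : ℝ := ((Fintype.card ι : ℕ) : ℝ) with hn
  have hn0 : 0 ≤ n := Nat.cast_nonneg _
  -- For `w` within `r` of `z` the weight changes by at most `e^{2πnr‖η‖} ≤ e^{c‖η‖/2}`, which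
  -- leaves the other half of the gain for the factor `‖η‖` of the derivative. The `+ 1` covers an
  -- empty index type.
  set r : ℝ := c / (2 * (2 * Real.pi * n + 1)) with hr
  have hπ := Real.pi_pos
  have hr0 : 0 < r := by positivity
  set ℓ : (ι → ℝ) → ((ι → ℂ) →L[ℂ] ℂ) := fun η =>
    (2 * Real.pi * Complex.I) • ∑ j, (η j : ℂ) • ContinuousLinearMap.proj (R := ℂ) (φ := fun _ : ι => ℂ) j with hℓ
  have hℓa : ∀ η v, ℓ η v = 2 * Real.pi * Complex.I * ∑ j, v j * η j := by
    intro η v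
    simp [hℓ, mul_comm]
  have hℓn : ∀ η, ‖ℓ η‖ ≤ 2 * Real.pi * n * ‖η‖ := by
    intro η
    refine ContinuousLinearMap.opNorm_le_bound _ (by positivity) fun v => ?_
    rw [hℓa, norm_mul]
    have h1 : ‖(2 * Real.pi * Complex.I : ℂ)‖ = 2 * Real.pi := by
      simp [abs_of_pos hπ]
    have h2 : ‖∑ j, v j * (η j : ℂ)‖ ≤ n * (‖v‖ * ‖η‖) := by
      refine (norm_sum_le _ _).trans ?_
      rw [hn, ← nsmul_eq_mul, ← Finset.card_univ]
      refine Finset.sum_le_card_nsmul _ _ _ fun j _ => ?_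
      rw [norm_mul, Complex.norm_real]
      exact mul_le_mul (norm_le_pi_norm v j) (norm_le_pi_norm η j) (norm_nonneg _) (norm_nonneg _)
    rw [h1]
    nlinarith
  have hℓc : Continuous ℓ := by
    rw [hℓ]
    fun_prop
  have hlin : ∀ (η : ι → ℝ) (w : ι → ℂ), HasFDerivAt
      (fun w : ι → ℂ => Complex.exp (2 * Real.pi * Complex.I * ∑ j, w j * η j) * f η)
      ((Complex.exp (2 * Real.pi * Complex.I * ∑ j, w j * η j) * f η) • ℓ η) w := by
    intro η w
    have h1 : HasFDerivAt (fun w : ι → ℂ => 2 * Real.pi * Complex.I * ∑ j, w j * η j) (ℓ η) w := by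
      have := (ℓ η).hasFDerivAt (x := w)
      refine this.congr_of_eventuallyEq (Filter.Eventually.of_forall fun v => ?_)
      exact (hℓa η v).symm
    have h2 := (h1.cexp).mul_const (f η)
    rwa [smul_smul, mul_comm (f η)] at h2
  have hmeas : ∀ w : ι → ℂ, Measurable fun η : ι → ℝ =>
      Complex.exp (2 * Real.pi * Complex.I * ∑ j, w j * η j) * f η := by
    intro w
    have := hf.1
    fun_prop
  have hint0 : Integrable fun η : ι → ℝ =>
      Complex.exp (2 * Real.pi * Complex.I * ∑ j, z j * η j) * f η := by
    refine (hf.integrable hΩ hz).mono (hmeas z).aestronglyMeasurable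
      (Filter.Eventually.of_forall fun η => ?_)
    rw [norm_mul, norm_exp_pairing, norm_expWeight_mul]
  have hbase : ∀ η w, w ∈ Metric.ball z r →
      ‖Complex.exp (2 * Real.pi * Complex.I * ∑ j, w j * η j) * f η‖ ≤
        Real.exp (c / 2 * ‖η‖) * (expWeight y η * ‖f η‖) := by
    intro η w hw
    rw [norm_mul, norm_exp_pairing, ← mul_assoc]
    refine mul_le_mul_of_nonneg_right ?_ (norm_nonneg _)
    rw [expWeight, expWeight, ← Real.exp_add, Real.exp_le_exp]
    have h1 : ∑ j, (y j - (w j).im) * η j ≤ n * (r * ‖η‖) := by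
      rw [hn, ← nsmul_eq_mul, ← Finset.card_univ]
      refine Finset.sum_le_card_nsmul _ _ _ fun j _ => (le_abs_self _).trans ?_
      rw [abs_mul]
      refine mul_le_mul ?_ (norm_le_pi_norm η j) (abs_nonneg _) hr0.le
      have : y j - (w j).im = ((z - w) j).im := by simp [hy]
      rw [this]
      refine (Complex.abs_im_le_norm _).trans ((norm_le_pi_norm _ j).trans ?_)
      rw [Metric.mem_ball, dist_comm, dist_eq_norm] at hw
      exact hw.le
    have h2 : 2 * Real.pi * (n * (r * ‖η‖)) ≤ c / 2 * ‖η‖ := by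
      have : 2 * Real.pi * n * r ≤ c / 2 := by
        rw [hr, ← mul_div_assoc, div_le_div_iff₀ (by positivity) (by norm_num)]
        nlinarith
      nlinarith [norm_nonneg η]
    have h3 : ∑ j, (y j - (w j).im) * η j = ∑ j, y j * η j - ∑ j, (w j).im * η j := by
      rw [← Finset.sum_sub_distrib]
      exact Finset.sum_congr rfl fun j _ => sub_mul _ _ _
    rw [h3] at h1
    nlinarith [mul_le_mul_of_nonneg_left h1 (by positivity : 0 ≤ 2 * Real.pi)]
  have hbound : ∀ η w, w ∈ Metric.ball z r →
      ‖(Complex.exp (2 * Real.pi * Complex.I * ∑ j, w j * η j) * f η) • ℓ η‖ ≤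
        2 * Real.pi * n * (2 / c) * (Real.exp (c * ‖η‖) * (expWeight y η * ‖f η‖)) := by
    intro η w hw
    rw [norm_smul]
    have h1 : ‖η‖ ≤ 2 / c * Real.exp (c / 2 * ‖η‖) := by
      have h3 := Real.add_one_le_exp (c / 2 * ‖η‖)
      rw [div_mul_eq_mul_div, le_div_iff₀ hc]
      nlinarith
    have h4 : Real.exp (c * ‖η‖) = Real.exp (c / 2 * ‖η‖) * Real.exp (c / 2 * ‖η‖) := by
      rw [← Real.exp_add]; congr 1; ring
    have hA : 0 ≤ expWeight y η * ‖f η‖ := mul_nonneg (expWeight_pos y η).le (norm_nonneg _)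
    calc _ ≤ (Real.exp (c / 2 * ‖η‖) * (expWeight y η * ‖f η‖)) *
          (2 * Real.pi * n * (2 / c * Real.exp (c / 2 * ‖η‖))) := by
          refine mul_le_mul (hbase η w hw) ((hℓn η).trans ?_) (norm_nonneg _) (by positivity)
          exact mul_le_mul_of_nonneg_left h1 (by positivity)
      _ = _ := by rw [h4]; ring
  have hF'm : AEStronglyMeasurable (fun η : ι → ℝ =>
      (Complex.exp (2 * Real.pi * Complex.I * ∑ j, z j * η j) * f η) • ℓ η) :=
    (hmeas z).aestronglyMeasurable.smul hℓc.aestronglyMeasurable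
  have hFint : Integrable (fun η : ι → ℝ =>
      (Complex.exp (2 * Real.pi * Complex.I * ∑ j, z j * η j) * f η) • ℓ η) :=
    (hint.const_mul (2 * Real.pi * n * (2 / c))).mono' hF'm
      (Filter.Eventually.of_forall fun η => hbound η z (Metric.mem_ball_self hr0))
  refine ⟨∫ η, (Complex.exp (2 * Real.pi * Complex.I * ∑ j, z j * η j) * f η) • ℓ η, ?_, ?_⟩
  · exact hasFDerivAt_integral_of_dominated_of_fderiv_le (Metric.ball_mem_nhds z hr0)
      (Filter.Eventually.of_forall fun w => (hmeas w).aestronglyMeasurable) hint0 hF'm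
      (Filter.Eventually.of_forall fun η w hw => hbound η w hw)
      (hint.const_mul (2 * Real.pi * n * (2 / c)))
      (Filter.Eventually.of_forall fun η w _ => hlin η w)
  · intro v
    rw [ContinuousLinearMap.integral_apply hFint]
    simp only [fourierLaplace, smul_apply, hℓa, smul_eq_mul]
    congr 1; ext η
    ring

theorem differentiableOn_fourierLaplace {Ω : Set (ι → ℝ)} (hΩ : IsOpen Ω) {f : (ι → ℝ) → ℂ}
    (hf : Admissible Ω f) : DifferentiableOn ℂ (fourierLaplace f) (tubeOver Ω) := fun _ hz =>
  let ⟨_, hL, _⟩ := hasFDerivAt_fourierLaplace hΩ hf hz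
  hL.differentiableAt.differentiableWithinAt

end Admissible

/-! ### A Paley–Wiener theorem for tubes over open convex sets. -/

section PaleyWiener

variable {ι : Type*} [Fintype ι]

/-- The Gaussian on the frequency side which corresponds to `gauss b` on the slice over `y`. -/
noncomputable def dualGauss (b y η : ι → ℝ) : ℂ :=
  Complex.exp (-(Real.pi : ℂ) * ∑ j, (η j : ℂ) ^ 2 +
    ∑ j, (2 * Real.pi * Complex.I * (b j - y j * Complex.I)) * η j)

theorem integrable_dualGauss (b y : ι → ℝ) : Integrable (dualGauss b y) :=
  GaussianFourier.integrable_cexp_neg_mul_sum_add (by simpa using Real.pi_pos) _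

theorem memLp_dualGauss (b y : ι → ℝ) : MemLp (dualGauss b y) 2 := by
  rw [memLp_two_iff_integrable_sq_norm (integrable_dualGauss b y).1]
  have h := (GaussianFourier.integrable_cexp_neg_mul_sum_add (ι := ι) (b := (2 * Real.pi : ℂ))
    (by simpa using Real.pi_pos)
    (fun j => 2 * (2 * Real.pi * Complex.I * (b j - y j * Complex.I)))).norm
  refine h.congr (Filter.Eventually.of_forall fun η => ?_)
  simp only
  rw [dualGauss, ← norm_pow, ← Complex.exp_nat_mul]
  congr 2
  simp only [mul_assoc, ← Finset.mul_sum]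
  push_cast
  ring

/-- The Gaussian integral with a complex linear term; the shift `iy` enters through that term, so no
contour has to be moved. -/
theorem fourierLaplace_dualGauss (b y x : ι → ℝ) :
    fourierLaplace (dualGauss b y) (fun j => -(x j : ℂ)) = gauss b (tubePoint x y) := by
  have h := GaussianFourier.integral_cexp_neg_mul_sum_add (ι := ι) (b := (Real.pi : ℂ))
    (by simpa using Real.pi_pos)
    (fun j => 2 * Real.pi * Complex.I * (b j - y j * Complex.I - x j))
  have hπ : (Real.pi : ℂ) ≠ 0 := by exact_mod_cast Real.pi_ne_zero
  rw [div_self hπ, Complex.one_cpow, one_mul] at h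
  rw [gauss, fourierLaplace]
  have e1 : (∑ j, (2 * Real.pi * Complex.I * (b j - y j * Complex.I - x j)) ^ 2) / (4 * Real.pi) =
      -Real.pi * ∑ j, (tubePoint x y j - b j) ^ 2 := by
    rw [Finset.sum_div, Finset.mul_sum]
    refine Finset.sum_congr rfl fun j _ => ?_
    rw [tubePoint, mul_pow, mul_pow, Complex.I_sq]
    field_simp
    ring
  rw [← e1, ← h]
  congr 1; ext η
  rw [dualGauss, ← Complex.exp_add]
  congr 1
  rw [add_left_comm, Finset.mul_sum Finset.univ _ (2 * Real.pi * Complex.I),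
    ← Finset.sum_add_distrib]
  congr 1
  refine Finset.sum_congr rfl fun j _ => ?_
  ring

/-- The modulus of `dualGauss`. -/
noncomputable def dualWeight (y η : ι → ℝ) : ℝ :=
  Real.exp (-Real.pi * ∑ j, η j ^ 2) * expWeight (-y) η

theorem dualWeight_pos (y η : ι → ℝ) : 0 < dualWeight y η :=
  mul_pos (Real.exp_pos _) (expWeight_pos _ _)

theorem continuous_dualWeight (y : ι → ℝ) : Continuous (dualWeight y) := by
  unfold dualWeight expWeight; fun_prop

theorem dualGauss_eq (b y η : ι → ℝ) : dualGauss b y η =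
    Complex.exp (2 * Real.pi * Complex.I * ∑ j, (b j : ℂ) * η j) * (dualWeight y η : ℂ) := by
  rw [dualWeight, expWeight, dualGauss, ← Real.exp_add, Complex.ofReal_exp, ← Complex.exp_add]
  congr 1
  push_cast
  simp only [Finset.mul_sum, Pi.neg_apply, Complex.ofReal_neg]
  rw [← Finset.sum_add_distrib, ← Finset.sum_add_distrib, ← Finset.sum_add_distrib]
  refine Finset.sum_congr rfl fun j _ => ?_
  linear_combination (-2 * Real.pi * (y j : ℂ) * η j) * Complex.I_mul_I

/-- Complete the square: the exponent is `π|y|² - π|y - η|²`. Hence multiplication by this weight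
preserves `L²`. -/
theorem dualWeight_le (y η : ι → ℝ) : dualWeight y η ≤ Real.exp (Real.pi * ∑ j, y j ^ 2) := by
  rw [dualWeight, expWeight, ← Real.exp_add, Real.exp_le_exp, ← sub_nonneg]
  have : Real.pi * ∑ j, y j ^ 2 - (-Real.pi * ∑ j, η j ^ 2 +
      -(2 * Real.pi) * ∑ j, (-y) j * η j) = Real.pi * ∑ j, (y j - η j) ^ 2 := by
    simp only [Finset.mul_sum]
    rw [← Finset.sum_add_distrib, ← Finset.sum_sub_distrib]
    refine Finset.sum_congr rfl fun j _ => ?_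
    simp only [Pi.neg_apply]
    ring
  rw [this]
  have := Real.pi_pos
  positivity

theorem memLp_dualWeight_mul {v : (ι → ℝ) → ℂ} (hv : MemLp v 2) (y : ι → ℝ) :
    MemLp (fun η => v η * (dualWeight y η : ℂ)) 2 := by
  refine (hv.const_mul (Real.exp (Real.pi * ∑ j, y j ^ 2) : ℂ)).mono
    (hv.1.mul (Complex.continuous_ofReal.comp (continuous_dualWeight y)).aestronglyMeasurable)
    (Filter.Eventually.of_forall fun η => ?_)
  rw [norm_mul, norm_mul, mul_comm, Complex.norm_real, Complex.norm_real,
    Real.norm_of_nonneg (Real.exp_pos _).le, Real.norm_of_nonneg (dualWeight_pos y η).le]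
  exact mul_le_mul_of_nonneg_right (dualWeight_le y η) (norm_nonneg _)

theorem integrable_dualWeight_mul {v : (ι → ℝ) → ℂ} (hv : MemLp v 2) (y : ι → ℝ) :
    Integrable (fun η => v η * (dualWeight y η : ℂ)) := by
  refine (hv.integrable_mul (memLp_dualGauss 0 y)).congr (Filter.Eventually.of_forall fun η => ?_)
  simp [dualGauss_eq]

theorem ae_eq_zero_of_fourierLaplace {d : (ι → ℝ) → ℂ} (hd : Integrable d) (hd2 : MemLp d 2)
    (h : ∀ b : ι → ℝ, fourierLaplace d (fun j => (b j : ℂ)) = 0) : ∀ᵐ η, d η = 0 := by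
  have h1 := lintegral_fourierLaplace_sq hd hd2
  simp only [h, enorm_zero] at h1
  have h2 : ∫⁻ η, ‖d η‖ₑ ^ 2 = 0 := by rw [← h1]; simp
  rw [lintegral_eq_zero_iff' (hd.1.enorm.pow_const 2)] at h2
  filter_upwards [h2] with η hη
  simpa using hη

theorem expWeight_mul_neg (y η : ι → ℝ) : expWeight y η * expWeight (-y) η = 1 := by
  rw [← expWeight_add, add_neg_cancel]
  simp [expWeight]

/-- Let `v y` be the Fourier transform of the slice above `y`. Pairing the slice with the Gaussian
at `b` gives the inverse transform of `v y * dualWeight y` at `b`. These pairings do not depend on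
`y`, so Fourier uniqueness and cancellation of `e^{-π|η|²}` show that `e^{2πy·η} v y` is a single
function `f`. -/
theorem exists_eq_fourierLaplace_of_measurable {Ω : Set (ι → ℝ)} (hΩ : IsOpen Ω)
    (hc : Convex ℝ Ω) (hne : Ω.Nonempty) {F : (ι → ℂ) → ℂ}
    (hF : DifferentiableOn ℂ F (tubeOver Ω)) (hFm : Measurable F)
    (hN : ∀ y ∈ Ω, ∃ C < ∞, ∀ᶠ y' in nhds y, sliceNorm F y' ≤ C) :
    ∃ f, Admissible Ω f ∧ ∀ z ∈ tubeOver Ω, F z = fourierLaplace f z := by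
  have hu : ∀ y ∈ Ω, MemLp (fun x => F (tubePoint x y)) 2 := by
    intro y hy
    obtain ⟨C, hC, hle⟩ := hN y hy
    exact (memLp_two_iff (hFm.comp (continuous_tubePoint_left y).measurable).aestronglyMeasurable).2
      (lt_of_le_of_lt hle.self_of_nhds hC)
  choose! v hv2 hvn hvp hvi using fun y hy => exists_fourier_of_memLp (hu y hy)
  have hpair : ∀ y ∈ Ω, ∀ b : ι → ℝ,
      fourierLaplace (fun η => v y η * (dualWeight y η : ℂ)) (fun j => (b j : ℂ)) =
        ∫ x, F (tubePoint x y) * gauss b (tubePoint x y) := by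
    intro y hy b
    have := hvp y hy (dualGauss b y) (integrable_dualGauss b y) (memLp_dualGauss b y)
    simp only [fourierLaplace_dualGauss] at this
    rw [← this, fourierLaplace]
    congr 1; ext η
    rw [dualGauss_eq]; ring
  have hind : ∀ y ∈ Ω, ∀ y' ∈ Ω, ∀ᵐ η,
      v y η * (dualWeight y η : ℂ) = v y' η * (dualWeight y' η : ℂ) := by
    intro y hy y' hy'
    have hi := integrable_dualWeight_mul (hv2 y hy) y
    have hi' := integrable_dualWeight_mul (hv2 y' hy') y'
    have h0 := ae_eq_zero_of_fourierLaplace (hi.sub hi')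
      ((memLp_dualWeight_mul (hv2 y hy) y).sub (memLp_dualWeight_mul (hv2 y' hy') y')) ?_
    · filter_upwards [h0] with η hη
      exact sub_eq_zero.1 hη
    · intro b
      have hE : ∀ k : (ι → ℝ) → ℂ, Integrable k → Integrable fun η : ι → ℝ =>
          Complex.exp (2 * Real.pi * Complex.I * ∑ j, (b j : ℂ) * η j) * k η := by
        intro k hk
        refine hk.mono ((Continuous.aestronglyMeasurable (by fun_prop)).mul hk.1)
          (Filter.Eventually.of_forall fun η => ?_)
        rw [norm_mul, norm_exp_pairing (fun j => (b j : ℂ))]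
        simp [expWeight]
      have : fourierLaplace ((fun η => v y η * (dualWeight y η : ℂ)) -
          fun η => v y' η * (dualWeight y' η : ℂ)) (fun j => (b j : ℂ)) =
          fourierLaplace (fun η => v y η * (dualWeight y η : ℂ)) (fun j => (b j : ℂ)) -
          fourierLaplace (fun η => v y' η * (dualWeight y' η : ℂ)) (fun j => (b j : ℂ)) := by
        simp only [fourierLaplace]
        rw [← integral_sub (hE _ hi) (hE _ hi')]
        simp only [Pi.sub_apply, mul_sub]
      rw [this, hpair y hy, hpair y' hy', sub_eq_zero]
      exact integral_mul_gauss_eq hΩ hc hF hFm hN b hy hy'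
  obtain ⟨y₀, hy₀⟩ := hne
  set v₀ := (hv2 y₀ hy₀).1.mk with hv₀
  have hv₀m : Measurable v₀ := (hv2 y₀ hy₀).1.stronglyMeasurable_mk.measurable
  have hv₀e := (hv2 y₀ hy₀).1.ae_eq_mk
  -- The common value is taken at a base point, from a measurable representative, so that `f` is
  -- genuinely measurable.
  set f : (ι → ℝ) → ℂ := fun η => (expWeight (-y₀) η : ℂ) * v₀ η with hf
  have hfm : Measurable f :=
    (Complex.continuous_ofReal.comp (continuous_expWeight _)).measurable.mul hv₀m
  have hvf : ∀ y ∈ Ω, v y =ᵐ[volume] fun η => (expWeight y η : ℂ) * f η := by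
    intro y hy
    filter_upwards [hind y hy y₀ hy₀, hv₀e] with η h1 h2
    have hw : (expWeight y η : ℂ) * expWeight (-y) η = 1 := by
      exact_mod_cast expWeight_mul_neg y η
    have hE : (Real.exp (-Real.pi * ∑ j, η j ^ 2) : ℂ) ≠ 0 := by
      exact_mod_cast (Real.exp_pos _).ne'
    simp only [dualWeight, Complex.ofReal_mul] at h1
    have h3 : v y η * (expWeight (-y) η : ℂ) = v y₀ η * (expWeight (-y₀) η : ℂ) := by
      refine mul_left_cancel₀ hE ?_
      linear_combination h1
    simp only [hf]
    rw [hv₀, ← h2]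
    linear_combination (expWeight y η : ℂ) * h3 - v y η * hw
  have hadm : Admissible Ω f := ⟨hfm, fun y hy => (memLp_congr_ae (hvf y hy)).1 (hv2 y hy)⟩
  refine ⟨f, hadm, fun z hz => ?_⟩
  set y : ι → ℝ := fun j => (z j).im with hy
  have hyΩ : y ∈ Ω := hz
  have hint := hadm.integrable hΩ hyΩ
  have h1 := hvi y hyΩ (hint.congr (hvf y hyΩ).symm)
  have h2 : (fun x => F (tubePoint x y)) =ᵐ[volume]
      fun x => fourierLaplace f (tubePoint x y) := by
    filter_upwards [h1] with x hx
    rw [hx, fourierLaplace_tubePoint]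
    simp only [fourierLaplace]
    refine integral_congr_ae ?_
    filter_upwards [hvf y hyΩ] with η hη
    rw [hη]
  -- Fourier inversion gives equality for almost every `x`; continuity of both sides makes it hold
  -- everywhere.
  have hc1 : Continuous fun x => F (tubePoint x y) :=
    hF.continuousOn.comp_continuous (continuous_tubePoint_left y) fun x => tubePoint_mem.2 hyΩ
  have hc2 : Continuous fun x => fourierLaplace f (tubePoint x y) := by
    simp only [fourierLaplace_tubePoint]
    exact continuous_fourierLaplace_ofReal hint
  have := congrFun ((Continuous.ae_eq_iff_eq volume hc1 hc2).1 h2) (fun j => (z j).re)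
  simpa only [hy, tubePoint_re_im] using this

theorem sliceNorm_congr {Ω : Set (ι → ℝ)} {F F' : (ι → ℂ) → ℂ}
    (h : Set.EqOn F F' (tubeOver Ω)) {y : ι → ℝ} (hy : y ∈ Ω) :
    sliceNorm F y = sliceNorm F' y := by
  simp only [sliceNorm]
  refine lintegral_congr fun x => ?_
  rw [h (tubePoint_mem.2 hy)]

/-- A Paley–Wiener theorem: a holomorphic function on a tube, with locally bounded `L²` norms of
its slices, is a Fourier–Laplace integral. -/
theorem exists_eq_fourierLaplace {Ω : Set (ι → ℝ)} (hΩ : IsOpen Ω)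
    (hc : Convex ℝ Ω) (hne : Ω.Nonempty) {F : (ι → ℂ) → ℂ}
    (hF : DifferentiableOn ℂ F (tubeOver Ω))
    (hN : ∀ y ∈ Ω, ∃ C < ∞, ∀ᶠ y' in nhds y, sliceNorm F y' ≤ C) :
    ∃ f, Admissible Ω f ∧ (∀ z ∈ tubeOver Ω, F z = fourierLaplace f z) ∧
      ∀ y ∈ Ω, sliceNorm F y = ∫⁻ η, ‖(expWeight y η : ℂ) * f η‖ₑ ^ 2 := by
  have he : Set.EqOn ((tubeOver Ω).indicator F) F (tubeOver Ω) :=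
    fun z hz => Set.indicator_of_mem hz F
  obtain ⟨f, hf, hfe⟩ := exists_eq_fourierLaplace_of_measurable hΩ hc hne (hF.congr he)
    (measurable_indicator_of_continuousOn hF.continuousOn (isOpen_tubeOver hΩ).measurableSet)
    (fun y hy => by
      obtain ⟨C, hC, hle⟩ := hN y hy
      refine ⟨C, hC, ?_⟩
      filter_upwards [hle, hΩ.mem_nhds hy] with y' h1 h2
      rwa [sliceNorm_congr he h2])
  have hfe' : ∀ z ∈ tubeOver Ω, F z = fourierLaplace f z := fun z hz => by
    rw [← hfe z hz, he hz]
  exact ⟨f, hf, hfe', fun y hy => by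
    rw [sliceNorm_congr hfe' hy, sliceNorm_fourierLaplace hΩ hf hy]⟩

end PaleyWiener

/-! ### The cone, its dual, and the support of Hardy space densities. -/

section Cone

theorem hardyNorm_sq (F : (Fin 3 → ℂ) → ℂ) : hardyNorm F ^ 2 = ⨆ y ∈ cone, sliceNorm F y := by
  rw [hardyNorm, ← ENNReal.rpow_natCast, ← ENNReal.rpow_mul]
  norm_num
  rfl

theorem isOpen_cone : IsOpen cone := by
  have h1 : IsOpen {y : Fin 3 → ℝ | 0 < det y} :=
    isOpen_lt continuous_const (by unfold det; fun_prop)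
  have h2 : IsOpen {y : Fin 3 → ℝ | 0 < y 0} := isOpen_lt continuous_const (by fun_prop)
  exact h1.inter h2

theorem cone_snd_pos {y : Fin 3 → ℝ} (hy : y ∈ cone) : 0 < y 1 := by
  obtain ⟨h1, h2⟩ := hy
  simp only [det] at h1
  by_contra h
  nlinarith [sq_nonneg (y 2)]

theorem smul_mem_cone {y : Fin 3 → ℝ} (hy : y ∈ cone) {t : ℝ} (ht : 0 < t) : t • y ∈ cone := by
  obtain ⟨h1, h2⟩ := hy
  refine ⟨?_, mul_pos ht h2⟩
  have : det (t • y) = t ^ 2 * det y := by simp [det]; ring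
  rw [this]
  positivity

theorem add_mem_cone {y y' : Fin 3 → ℝ} (hy : y ∈ cone) (hy' : y' ∈ cone) : y + y' ∈ cone := by
  have p1 := cone_snd_pos hy
  have p1' := cone_snd_pos hy'
  obtain ⟨h1, h2⟩ := hy
  obtain ⟨h1', h2'⟩ := hy'
  refine ⟨?_, add_pos h2 h2'⟩
  simp only [det, Pi.add_apply] at *
  have h3 : y 2 ^ 2 * y' 2 ^ 2 < (y 0 * y 1) * (y' 0 * y' 1) := by
    nlinarith [sq_nonneg (y 2), sq_nonneg (y' 2), mul_pos h2 p1, mul_pos h2' p1']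
  -- Combine the product of the two cone conditions with `4uv ≤ (u + v)²` for `u = y₀y'₁` and `v =
  -- y₁y'₀`.
  have h4 : |2 * (y 2 * y' 2)| < y 0 * y' 1 + y 1 * y' 0 := by
    refine abs_lt_of_sq_lt_sq ?_ (by positivity)
    nlinarith [sq_nonneg (y 0 * y' 1 - y 1 * y' 0)]
  nlinarith [le_abs_self (2 * (y 2 * y' 2))]

theorem convex_cone : Convex ℝ cone := by
  intro y hy y' hy' s t hs ht hst
  rcases hs.eq_or_lt with rfl | hs
  · rw [zero_add] at hst; subst hst; simpa using hy'
  rcases ht.eq_or_lt with rfl | ht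
  · rw [add_zero] at hst; subst hst; simpa using hy
  exact add_mem_cone (smul_mem_cone hy hs) (smul_mem_cone hy' ht)

theorem base_mem_cone {a b : ℝ} (ha : 0 < a) (hb : 0 < b) : ![a, b, 0] ∈ cone := by
  refine ⟨?_, by simpa using ha⟩
  simpa [det] using mul_pos ha hb

/-- The closed dual cone of `Σ` for the standard scalar product. -/
def dualCone : Set (Fin 3 → ℝ) := {η | 0 ≤ η 0 ∧ 0 ≤ η 1 ∧ η 2 ^ 2 ≤ 4 * (η 0 * η 1)}

theorem sum_mul_nonneg {y η : Fin 3 → ℝ} (hy : y ∈ cone) (hη : η ∈ dualCone) :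
    0 ≤ ∑ j, y j * η j := by
  have p1 := cone_snd_pos hy
  obtain ⟨h1, h2⟩ := hy
  obtain ⟨a, b, c⟩ := hη
  simp only [det] at h1
  rw [Fin.sum_univ_three]
  have h3 : y 2 ^ 2 * η 2 ^ 2 ≤ (y 0 * y 1) * (4 * (η 0 * η 1)) :=
    mul_le_mul (by linarith) c (sq_nonneg _) (by positivity)
  have h4 : |y 2 * η 2| ≤ y 0 * η 0 + y 1 * η 1 := by
    refine abs_le_of_sq_le_sq ?_ (by positivity)
    nlinarith [sq_nonneg (y 0 * η 0 - y 1 * η 1)]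
  linarith [neg_abs_le (y 2 * η 2)]

/-- The converse half of duality. If `η₀` or `η₁` is negative, a diagonal `y` works. Otherwise take
`y = (a, b, -t sgn η₂)` close to the boundary of the cone, with `a`, `b` slightly above `η₁`, `η₀`.
-/
theorem exists_sum_mul_neg {η : Fin 3 → ℝ} (hη : η ∉ dualCone) :
    ∃ y ∈ cone, ∑ j, y j * η j < 0 := by
  by_cases h0 : η 0 < 0
  · refine ⟨![1, -η 0 / (2 * (|η 1| + 1)), 0], base_mem_cone one_pos
      (div_pos (by linarith) (by positivity)), ?_⟩
    rw [Fin.sum_univ_three]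
    simp only [Matrix.cons_val]
    have : -η 0 / (2 * (|η 1| + 1)) * η 1 ≤ -η 0 / 2 := by
      rw [div_mul_eq_mul_div, div_le_div_iff₀ (by positivity) (by norm_num)]
      nlinarith [le_abs_self (η 1), abs_nonneg (η 1)]
    linarith
  by_cases h1 : η 1 < 0
  · refine ⟨![-η 1 / (2 * (|η 0| + 1)), 1, 0], base_mem_cone
      (div_pos (by linarith) (by positivity)) one_pos, ?_⟩
    rw [Fin.sum_univ_three]
    simp only [Matrix.cons_val]
    have : -η 1 / (2 * (|η 0| + 1)) * η 0 ≤ -η 1 / 2 := by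
      rw [div_mul_eq_mul_div, div_le_div_iff₀ (by positivity) (by norm_num)]
      nlinarith [le_abs_self (η 0), abs_nonneg (η 0)]
    linarith
  push Not at h0 h1
  have h2 : 4 * (η 0 * η 1) < η 2 ^ 2 := by
    by_contra h
    exact hη ⟨h0, h1, not_lt.1 h⟩
  -- The perturbation keeps `a` and `b` positive even when `η₀` or `η₁` is zero.
  obtain ⟨ε, hε, hlt⟩ : ∃ ε > 0, 4 * ((η 0 + ε) * (η 1 + ε)) < η 2 ^ 2 := by
    have hc : Continuous fun ε : ℝ => 4 * ((η 0 + ε) * (η 1 + ε)) := by fun_prop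
    have he : ∀ᶠ ε in nhds (0 : ℝ), 4 * ((η 0 + ε) * (η 1 + ε)) < η 2 ^ 2 :=
      hc.continuousAt.eventually_lt continuousAt_const (by simpa using h2)
    obtain ⟨r, hr, hb⟩ := Metric.eventually_nhds_iff.1 he
    exact ⟨r / 2, half_pos hr, hb (by rw [Real.dist_eq, sub_zero, abs_of_pos (half_pos hr)]; linarith)⟩
  set a := η 1 + ε with ha
  set b := η 0 + ε with hb
  have ha0 : 0 < a := by linarith
  have hb0 : 0 < b := by linarith
  set q := Real.sqrt (a * b) with hq
  have hq0 : 0 < q := Real.sqrt_pos.2 (mul_pos ha0 hb0)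
  have hqq : q ^ 2 = a * b := Real.sq_sqrt (mul_pos ha0 hb0).le
  have hqη : 2 * q < |η 2| := by
    refine lt_of_pow_lt_pow_left₀ 2 (abs_nonneg _) ?_
    rw [sq_abs]
    nlinarith
  have hη2 : 0 < |η 2| := by linarith
  -- The midpoint of `2q²/|η₂|` and `q`: `t < q` puts `y` in the cone, while `t|η₂| > 2q² = 2ab ≥
  -- aη₀ + bη₁` makes the product negative.
  set t := (2 * q ^ 2 / |η 2| + q) / 2 with ht
  have ht1 : 2 * q ^ 2 / |η 2| < q := by
    rw [div_lt_iff₀ hη2]; nlinarith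
  have ht2 : t < q := by rw [ht]; linarith
  have ht3 : 2 * q ^ 2 < t * |η 2| := by
    rw [← div_lt_iff₀ hη2, ht]; linarith
  have ht0 : 0 < t := by rw [ht]; positivity
  clear_value t
  refine ⟨![a, b, -(t * (η 2 / |η 2|))], ⟨?_, by simpa using ha0⟩, ?_⟩
  · simp only [det, Matrix.cons_val]
    have : (-(t * (η 2 / |η 2|))) ^ 2 = t ^ 2 := by
      rw [neg_sq, mul_pow, div_pow, sq_abs, div_self, mul_one]
      intro h
      rw [← sq_abs] at h
      exact hη2.ne' (pow_eq_zero_iff (two_ne_zero) |>.1 h)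
    rw [this, ← hqq]
    nlinarith
  · rw [Fin.sum_univ_three]
    simp only [Matrix.cons_val]
    have : -(t * (η 2 / |η 2|)) * η 2 = -(t * |η 2|) := by
      have h5 : η 2 * η 2 = |η 2| * |η 2| := (abs_mul_abs_self _).symm
      field_simp
      nlinarith
    rw [this]
    nlinarith

theorem expWeight_le_one {y η : Fin 3 → ℝ} (hy : y ∈ cone) (hη : η ∈ dualCone) :
    expWeight y η ≤ 1 := by
  rw [expWeight, Real.exp_le_one_iff]
  nlinarith [mul_nonneg Real.pi_pos.le (sum_mul_nonneg hy hη)]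

theorem measurableSet_dualCone : MeasurableSet dualCone := by
  have h0 : IsClosed {η : Fin 3 → ℝ | 0 ≤ η 0} := isClosed_le continuous_const (by fun_prop)
  have h1 : IsClosed {η : Fin 3 → ℝ | 0 ≤ η 1} := isClosed_le continuous_const (by fun_prop)
  have h2 : IsClosed {η : Fin 3 → ℝ | η 2 ^ 2 ≤ 4 * (η 0 * η 1)} :=
    isClosed_le (by fun_prop) (by fun_prop)
  exact (h0.inter (h1.inter h2)).measurableSet

theorem expWeight_smul {ι : Type*} [Fintype ι] (t : ℝ) (y η : ι → ℝ) :
    expWeight (t • y) η = Real.exp (t * (-(2 * Real.pi) * ∑ j, y j * η j)) := by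
  simp only [expWeight, Pi.smul_apply, smul_eq_mul, mul_assoc, ← Finset.mul_sum]
  congr 1; ring

theorem enorm_expWeight_mul {ι : Type*} [Fintype ι] (y η : ι → ℝ) (c : ℂ) :
    ‖(expWeight y η : ℂ) * c‖ₑ = ENNReal.ofReal (expWeight y η) * ‖c‖ₑ := by
  rw [enorm_mul, ← ofReal_norm (expWeight y η : ℂ), Complex.norm_real,
    Real.norm_of_nonneg (expWeight_pos y η).le]

theorem measurable_enorm_expWeight_mul {ι : Type*} [Fintype ι] {f : (ι → ℝ) → ℂ}
    (hf : Measurable f) (y : ι → ℝ) :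
    Measurable fun η => ‖(expWeight y η : ℂ) * f η‖ₑ ^ 2 := by
  have := (continuous_expWeight y).measurable
  fun_prop

/-- Fatou along `y = y₀ / (n + 1) → 0`, where the weights tend to one. -/
theorem lintegral_le_of_forall_cone {f : (Fin 3 → ℝ) → ℂ} (hf : Measurable f) {C : ℝ≥0∞}
    (h : ∀ y ∈ cone, ∫⁻ η, ‖(expWeight y η : ℂ) * f η‖ₑ ^ 2 ≤ C) : ∫⁻ η, ‖f η‖ₑ ^ 2 ≤ C := by
  set y₀ : Fin 3 → ℝ := ![1, 1, 0] with hy₀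
  have hm : y₀ ∈ cone := base_mem_cone one_pos one_pos
  have h1 : ∀ η, Filter.Tendsto (fun n : ℕ =>
      ‖(expWeight ((1 / ((n : ℝ) + 1)) • y₀) η : ℂ) * f η‖ₑ ^ 2) Filter.atTop
      (nhds (‖f η‖ₑ ^ 2)) := by
    intro η
    have h2 : Continuous fun t : ℝ => ‖(expWeight (t • y₀) η : ℂ) * f η‖ₑ ^ 2 := by
      simp only [expWeight_smul]
      refine (ENNReal.continuous_pow 2).comp (Continuous.enorm ?_)
      fun_prop
    exact (h2.tendsto' 0 (‖f η‖ₑ ^ 2) (by simp [expWeight])).comp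
      (tendsto_one_div_add_atTop_nhds_zero_nat (𝕜 := ℝ))
  calc ∫⁻ η, ‖f η‖ₑ ^ 2 = ∫⁻ η, Filter.liminf (fun n : ℕ =>
        ‖(expWeight ((1 / ((n : ℝ) + 1)) • y₀) η : ℂ) * f η‖ₑ ^ 2) Filter.atTop :=
        lintegral_congr fun η => (h1 η).liminf_eq.symm
    _ ≤ Filter.liminf (fun n : ℕ =>
        ∫⁻ η, ‖(expWeight ((1 / ((n : ℝ) + 1)) • y₀) η : ℂ) * f η‖ₑ ^ 2) Filter.atTop :=
        lintegral_liminf_le fun n => measurable_enorm_expWeight_mul hf _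
    _ ≤ C := by
        refine (Filter.liminf_le_liminf (Filter.Eventually.of_forall fun n : ℕ =>
          h _ (smul_mem_cone hm (by positivity : 0 < 1 / ((n : ℝ) + 1))))).trans ?_
        simp

/-- Fatou along the ray `(n + 1)y`: where `y·η < 0` the weight blows up, so the uniform bound forces
`f = 0` almost everywhere there. -/
theorem ae_eq_zero_of_forall_cone {f : (Fin 3 → ℝ) → ℂ} (hf : Measurable f) {C : ℝ≥0∞}
    (hC : C < ∞) (h : ∀ y ∈ cone, ∫⁻ η, ‖(expWeight y η : ℂ) * f η‖ₑ ^ 2 ≤ C) :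
    ∀ᵐ η, η ∉ dualCone → f η = 0 := by
  have key : ∀ y ∈ cone, ∀ᵐ η, ∑ j, y j * η j < 0 → f η = 0 := by
    intro y hy
    have h1 : ∫⁻ η, Filter.liminf (fun n : ℕ =>
        ‖(expWeight (((n : ℝ) + 1) • y) η : ℂ) * f η‖ₑ ^ 2) Filter.atTop ≤ C := by
      refine (lintegral_liminf_le fun n => measurable_enorm_expWeight_mul hf _).trans ?_
      refine (Filter.liminf_le_liminf (Filter.Eventually.of_forall fun n : ℕ =>
          h _ (smul_mem_cone hy (by positivity : 0 < (n : ℝ) + 1)))).trans ?_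
      simp
    have h2 := ae_lt_top (Measurable.liminf fun n : ℕ =>
      measurable_enorm_expWeight_mul hf (((n : ℝ) + 1) • y)) (h1.trans_lt hC).ne
    filter_upwards [h2] with η hη hneg
    by_contra hne
    have h3 : Filter.Tendsto (fun n : ℕ =>
        ‖(expWeight (((n : ℝ) + 1) • y) η : ℂ) * f η‖ₑ ^ 2) Filter.atTop (nhds ∞) := by
      have h4 : Filter.Tendsto (fun n : ℕ => ENNReal.ofReal
          (expWeight (((n : ℝ) + 1) • y) η) * ‖f η‖ₑ) Filter.atTop (nhds ∞) := by
        have h5 : Filter.Tendsto (fun n : ℕ => ENNReal.ofReal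
            (expWeight (((n : ℝ) + 1) • y) η)) Filter.atTop (nhds ∞) := by
          refine ENNReal.tendsto_ofReal_atTop.comp ?_
          simp only [expWeight_smul]
          refine Real.tendsto_exp_atTop.comp ?_
          refine Filter.Tendsto.atTop_mul_const ?_ ?_
          · nlinarith [Real.pi_pos]
          · exact Filter.tendsto_atTop_add_const_right _ _ tendsto_natCast_atTop_atTop
        have := ENNReal.Tendsto.mul_const (b := ‖f η‖ₑ) h5 (Or.inl ENNReal.top_ne_zero)
        rwa [ENNReal.top_mul (by simpa using hne)] at this
      have h6 := ((ENNReal.continuous_pow 2).tendsto ∞).comp h4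
      simp only [ENNReal.top_pow two_ne_zero] at h6
      refine h6.congr fun n => ?_
      simp only [Function.comp, enorm_expWeight_mul]
    rw [h3.liminf_eq] at hη
    exact lt_irrefl _ hη
  -- The exceptional null set depends on `y`. Countably many `y` suffice, since for each `η` the
  -- admissible `y` with `y·η < 0` form an open set.
  obtain ⟨s, hsc, hsd⟩ := TopologicalSpace.exists_countable_dense (Fin 3 → ℝ)
  have hall : ∀ᵐ η, ∀ y ∈ s, y ∈ cone → ∑ j, y j * η j < 0 → f η = 0 := by
    rw [ae_ball_iff hsc]
    intro y _
    by_cases hy : y ∈ cone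
    · filter_upwards [key y hy] with η hη _ using hη
    · exact Filter.Eventually.of_forall fun η h => absurd h hy
  filter_upwards [hall] with η hη hnot
  obtain ⟨y, hy, hneg⟩ := exists_sum_mul_neg hnot
  have hopen : IsOpen (cone ∩ {y : Fin 3 → ℝ | ∑ j, y j * η j < 0}) :=
    isOpen_cone.inter (isOpen_lt (by fun_prop) continuous_const)
  obtain ⟨y', ⟨hy'1, hy'2⟩, hy's⟩ := hsd.inter_open_nonempty _ hopen ⟨y, hy, hneg⟩
  exact hη y' hy's hy'1 hy'2

theorem iSup_cone_lintegral {f : (Fin 3 → ℝ) → ℂ} (hf : Measurable f)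
    (h0 : ∀ η, η ∉ dualCone → f η = 0) :
    ⨆ y ∈ cone, ∫⁻ η, ‖(expWeight y η : ℂ) * f η‖ₑ ^ 2 = ∫⁻ η, ‖f η‖ₑ ^ 2 := by
  refine le_antisymm (iSup₂_le fun y hy => lintegral_mono fun η => ?_)
    (lintegral_le_of_forall_cone hf fun y hy => le_iSup₂ (f := fun y _ =>
      ∫⁻ η, ‖(expWeight y η : ℂ) * f η‖ₑ ^ 2) y hy)
  by_cases hη : η ∈ dualCone
  · rw [enorm_expWeight_mul]
    gcongr
    exact mul_le_of_le_one_left' (ENNReal.ofReal_le_one.2 (expWeight_le_one hy hη))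
  · simp [h0 η hη]

theorem admissible_of_dualCone {f : (Fin 3 → ℝ) → ℂ} (hf : Measurable f) (hf2 : MemLp f 2)
    (h0 : ∀ η, η ∉ dualCone → f η = 0) : Admissible cone f := by
  refine ⟨hf, fun y hy => hf2.mono ?_ (Filter.Eventually.of_forall fun η => ?_)⟩
  · have := (continuous_expWeight y).measurable
    exact Measurable.aestronglyMeasurable (by fun_prop)
  · rw [norm_expWeight_mul]
    by_cases hη : η ∈ dualCone
    · exact mul_le_of_le_one_left (norm_nonneg _) (expWeight_le_one hy hη)
    · simp [h0 η hη]

end Cone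

/-! ### The action of `□` on densities. -/

section Box

theorem integrable_fourierLaplace {ι : Type*} [Fintype ι] {Ω : Set (ι → ℝ)} (hΩ : IsOpen Ω)
    {f : (ι → ℝ) → ℂ} (hf : Admissible Ω f) {z : ι → ℂ} (hz : z ∈ tubeOver Ω) :
    Integrable fun η : ι → ℝ =>
      Complex.exp (2 * Real.pi * Complex.I * ∑ j, z j * η j) * f η := by
  refine (hf.integrable hΩ hz).mono ?_ (Filter.Eventually.of_forall fun η => ?_)
  · have := hf.1
    exact Measurable.aestronglyMeasurable (by fun_prop)
  · rw [norm_mul, norm_exp_pairing, norm_expWeight_mul]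

/-- The symbol of `□` in the frequency variable of `fourierLaplace`. -/
noncomputable def boxSymbol (η : Fin 3 → ℝ) : ℝ :=
  4 * Real.pi ^ 2 * (4 * (η 0 * η 1) - η 2 ^ 2)

variable {F : (Fin 3 → ℂ) → ℂ} {f : (Fin 3 → ℝ) → ℂ}

/-- Differentiation under the integral brings down `2πi η_j`, and the factor `1/i` removes the `i`.
Equality is asked only on the tube, which is open, so the rule can be iterated. -/
theorem partialD_fourierLaplace (hf : Admissible cone f)
    (hF : Set.EqOn F (fourierLaplace f) tube) (j : Fin 3) :
    Set.EqOn (partialD j F) (fourierLaplace fun η => (2 * Real.pi) * ((η j : ℂ) * f η)) tube := by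
  intro z hz
  obtain ⟨L, hL, hLv⟩ := hasFDerivAt_fourierLaplace isOpen_cone hf hz
  have hF' : HasFDerivAt F L z := by
    refine hL.congr_of_eventuallyEq ?_
    filter_upwards [(isOpen_tubeOver isOpen_cone).mem_nhds hz] with w hw using hF hw
  have h1 := ((hF'.restrictScalars ℝ).hasLineDerivAt (Pi.single j 1)).lineDeriv
  rw [partialD, h1, ContinuousLinearMap.coe_restrictScalars', hLv, fourierLaplace, fourierLaplace,
    ← integral_const_mul]
  congr 1; ext η
  simp only [Pi.single_apply, ite_mul, one_mul, zero_mul, Finset.sum_ite_eq', Finset.mem_univ,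
    if_true]
  field_simp

theorem box_fourierLaplace (hf : Admissible cone f) (hF : Set.EqOn F (fourierLaplace f) tube) :
    Admissible cone (fun η => (boxSymbol η : ℂ) * f η) ∧
      Set.EqOn (box F) (fourierLaplace fun η => (boxSymbol η : ℂ) * f η) tube := by
  have hadm : ∀ (j : Fin 3) {g : (Fin 3 → ℝ) → ℂ}, Admissible cone g →
      Admissible cone fun η => (2 * Real.pi) * ((η j : ℂ) * g η) :=
    fun j g hg => (hg.coord_mul isOpen_cone j).const_mul _
  have h01 := hadm 0 (hadm 1 hf)
  have h22 := hadm 2 (hadm 2 hf)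
  have e : (fun η => (boxSymbol η : ℂ) * f η) = fun η =>
      4 * (2 * Real.pi * ((η 0 : ℂ) * (2 * Real.pi * ((η 1 : ℂ) * f η)))) +
      (-1) * (2 * Real.pi * ((η 2 : ℂ) * (2 * Real.pi * ((η 2 : ℂ) * f η)))) := by
    ext η
    simp only [boxSymbol]
    push_cast
    ring
  rw [e]
  refine ⟨(h01.const_mul 4).add (h22.const_mul (-1)), fun z hz => ?_⟩
  rw [box, partialD_fourierLaplace (hadm 1 hf) (partialD_fourierLaplace hf hF 1) 0 hz,
    partialD_fourierLaplace (hadm 2 hf) (partialD_fourierLaplace hf hF 2) 2 hz]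
  have i1 := (integrable_fourierLaplace isOpen_cone h01 hz).const_mul 4
  have i2 := integrable_fourierLaplace isOpen_cone h22 hz
  simp only [fourierLaplace]
  rw [← integral_const_mul, ← integral_sub i1 i2]
  congr 1; ext η
  ring

theorem box_iterate_fourierLaplace (hf : Admissible cone f)
    (hF : Set.EqOn F (fourierLaplace f) tube) (m : ℕ) :
    Admissible cone (fun η => (boxSymbol η : ℂ) ^ m * f η) ∧
      Set.EqOn (box^[m] F) (fourierLaplace fun η => (boxSymbol η : ℂ) ^ m * f η) tube := by
  induction m with
  | zero => simpa using ⟨hf, hF⟩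
  | succ k ih =>
    have h := box_fourierLaplace ih.1 ih.2
    rw [← Function.iterate_succ_apply' box k F] at h
    simpa only [pow_succ', mul_assoc] using h

end Box

/-! ### Integrating out the third variable, and Bergman norms through slices. -/

section Fubini

/-- The point `(a₀, a₁, s)`. -/
def glue (s : ℝ) (a : Fin 2 → ℝ) : Fin 3 → ℝ := ![a 0, a 1, s]

theorem measurePreserving_glue :
    MeasurePreserving (fun p : ℝ × (Fin 2 → ℝ) => glue p.1 p.2) := by
  have h := (volume_preserving_piFinSuccAbove (fun _ : Fin 3 => ℝ) 2).symm
  convert h using 1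
  ext p j
  fin_cases j <;> simp [glue, MeasurableEquiv.piFinSuccAbove] <;> rfl

theorem measurableEmbedding_glue :
    MeasurableEmbedding (fun p : ℝ × (Fin 2 → ℝ) => glue p.1 p.2) := by
  have h := (MeasurableEquiv.piFinSuccAbove (fun _ : Fin 3 => ℝ) 2).symm.measurableEmbedding
  convert h using 1
  ext p j
  fin_cases j <;> simp [glue, MeasurableEquiv.piFinSuccAbove] <;> rfl

theorem measurable_glue : Measurable fun p : ℝ × (Fin 2 → ℝ) => glue p.1 p.2 :=
  measurableEmbedding_glue.measurable

theorem lintegral_glue {g : (Fin 3 → ℝ) → ℝ≥0∞} (hg : Measurable g) :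
    ∫⁻ η, g η = ∫⁻ a, ∫⁻ s, g (glue s a) := by
  rw [← measurePreserving_glue.lintegral_comp_emb measurableEmbedding_glue, Measure.volume_eq_prod]
  exact lintegral_prod_symm' _ (hg.comp measurable_glue)

theorem integral_glue {g : (Fin 3 → ℝ) → ℂ} (hg : Integrable g) :
    ∫ η, g η = ∫ a, ∫ s, g (glue s a) := by
  have h := (measurePreserving_glue.integrable_comp_emb measurableEmbedding_glue).2 hg
  rw [← measurePreserving_glue.integral_comp measurableEmbedding_glue]
  exact integral_prod_symm _ h

theorem integrable_integral_glue {g : (Fin 3 → ℝ) → ℂ} (hg : Integrable g) :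
    Integrable fun a => ∫ s, g (glue s a) :=
  ((measurePreserving_glue.integrable_comp_emb measurableEmbedding_glue).2 hg).integral_prod_right

theorem exp_pairing_glue (z : Fin 2 → ℂ) (s : ℝ) (a : Fin 2 → ℝ) :
    ∑ j, (![z 0, z 1, 0] : Fin 3 → ℂ) j * (glue s a j : ℂ) = ∑ j, z j * a j := by
  simp [Fin.sum_univ_three, Fin.sum_univ_two, glue]

theorem mem_tube_of_pos {z : Fin 2 → ℂ} (h0 : 0 < (z 0).im) (h1 : 0 < (z 1).im) :
    (![z 0, z 1, 0] : Fin 3 → ℂ) ∈ tube := by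
  simp only [tube, cone, det, Set.mem_ofPred_eq, Matrix.cons_val, Complex.zero_im]
  exact ⟨by nlinarith [mul_pos h0 h1], h0⟩

/-- At `z₃ = 0` the exponential does not involve `s`, so Fubini moves the `s`-integral onto the
density. -/
theorem fourierLaplace_glue {h : (Fin 3 → ℝ) → ℂ} (hh : Admissible cone h) {z : Fin 2 → ℂ}
    (h0 : 0 < (z 0).im) (h1 : 0 < (z 1).im) :
    fourierLaplace h ![z 0, z 1, 0] = fourierLaplace (fun a => ∫ s, h (glue s a)) z := by
  rw [fourierLaplace, integral_glue (integrable_fourierLaplace isOpen_cone hh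
    (mem_tube_of_pos h0 h1)), fourierLaplace]
  simp only [exp_pairing_glue, integral_const_mul]

theorem expWeight_glue (y a : Fin 2 → ℝ) (s : ℝ) :
    expWeight ![y 0, y 1, 0] (glue s a) = expWeight y a := by
  simp [expWeight, Fin.sum_univ_three, Fin.sum_univ_two, glue]

theorem integrable_expWeight_mul_integral_glue {h : (Fin 3 → ℝ) → ℂ} (hh : Admissible cone h)
    {y : Fin 2 → ℝ} (h0 : 0 < y 0) (h1 : 0 < y 1) :
    Integrable fun a => (expWeight y a : ℂ) * ∫ s, h (glue s a) := by
  have := integrable_integral_glue (hh.integrable isOpen_cone (base_mem_cone h0 h1))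
  simpa only [expWeight_glue, integral_const_mul] using this

theorem lintegral_pi_two {g : (Fin 2 → ℝ) → ℝ≥0∞} (hg : Measurable g) :
    ∫⁻ x, g x = ∫⁻ s, ∫⁻ t, g ![s, t] := by
  have h := (volume_preserving_finTwoArrow ℝ).symm
  rw [← h.lintegral_comp_emb (MeasurableEquiv.measurableEmbedding _), Measure.volume_eq_prod]
  exact lintegral_prod _ (hg.comp (MeasurableEquiv.measurable _)).aemeasurable

theorem lintegral_complex {g : ℂ → ℝ≥0∞} (hg : Measurable g) :
    ∫⁻ z, g z = ∫⁻ y : ℝ, ∫⁻ x : ℝ, g (x + y * Complex.I) := by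
  have h := Complex.volume_preserving_equiv_real_prod.symm
  rw [← h.lintegral_comp_emb (MeasurableEquiv.measurableEmbedding _), Measure.volume_eq_prod]
  refine (lintegral_prod_symm' _ (hg.comp (MeasurableEquiv.measurable _))).trans ?_
  refine lintegral_congr fun y => lintegral_congr fun x => ?_
  have : Complex.measurableEquivRealProd.symm (x, y) = x + y * Complex.I := by
    apply Complex.ext <;> simp
  rw [← this]
  rfl

theorem lintegral_complex_prod {g : ℂ × ℂ → ℝ≥0∞} (hg : Measurable g) :
    ∫⁻ z, g z = ∫⁻ y : Fin 2 → ℝ, ∫⁻ x : Fin 2 → ℝ, g (tubePoint x y 0, tubePoint x y 1) := by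
  have hm : Measurable fun p : (Fin 2 → ℝ) × (Fin 2 → ℝ) =>
      g (tubePoint p.2 p.1 0, tubePoint p.2 p.1 1) := by
    refine hg.comp (Continuous.measurable ?_)
    unfold tubePoint
    fun_prop
  rw [lintegral_pi_two hm.lintegral_prod_right', Measure.volume_eq_prod,
    lintegral_prod _ hg.aemeasurable, lintegral_complex hg.lintegral_prod_right']
  refine lintegral_congr fun y₀ => ?_
  have h1 : ∀ x₀ : ℝ, ∫⁻ w, g ((x₀ : ℂ) + y₀ * Complex.I, w) =
      ∫⁻ y₁ : ℝ, ∫⁻ x₁ : ℝ, g ((x₀ : ℂ) + y₀ * Complex.I, (x₁ : ℂ) + y₁ * Complex.I) := fun x₀ =>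
    lintegral_complex (hg.comp (by fun_prop))
  simp only [h1]
  rw [lintegral_lintegral_swap]
  · refine lintegral_congr fun y₁ => ?_
    have hm' : Measurable fun x : Fin 2 → ℝ =>
        g (tubePoint x ![y₀, y₁] 0, tubePoint x ![y₀, y₁] 1) :=
      hm.comp (measurable_const.prodMk measurable_id)
    rw [lintegral_pi_two hm']
    simp [tubePoint]
  · refine Measurable.aemeasurable ?_
    have hm3 : Measurable fun q : (ℝ × ℝ) × ℝ =>
        g ((q.1.1 : ℂ) + y₀ * Complex.I, (q.2 : ℂ) + q.1.2 * Complex.I) :=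
      hg.comp (by fun_prop)
    exact hm3.lintegral_prod_right'

/-- The open positive quadrant. -/
def quadrant : Set (Fin 2 → ℝ) := {y | 0 < y 0 ∧ 0 < y 1}

theorem isOpen_quadrant : IsOpen quadrant := by
  have h0 : IsOpen {y : Fin 2 → ℝ | 0 < y 0} := isOpen_lt continuous_const (by fun_prop)
  have h1 : IsOpen {y : Fin 2 → ℝ | 0 < y 1} := isOpen_lt continuous_const (by fun_prop)
  exact h0.inter h1

theorem convex_quadrant : Convex ℝ quadrant := by
  intro y hy y' hy' s t hs ht hst
  have key : ∀ u v : ℝ, 0 < u → 0 < v → 0 < s * u + t * v := by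
    intro u v hu hv
    rcases hs.eq_or_lt with rfl | hs
    · rw [zero_add] at hst; subst hst; simpa using hv
    · have := mul_pos hs hu
      have := mul_nonneg ht hv.le
      linarith
  exact ⟨key _ _ hy.1 hy'.1, key _ _ hy.2 hy'.2⟩

/-- A function on `ℂ × ℂ` as a function on `ℂ²`. -/
def onPi (G : ℂ × ℂ → ℂ) : (Fin 2 → ℂ) → ℂ := fun z => G (z 0, z 1)

theorem differentiableOn_onPi {G : ℂ × ℂ → ℂ} (hG : DifferentiableOn ℂ G biHalfPlane) :
    DifferentiableOn ℂ (onPi G) (tubeOver quadrant) :=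
  hG.comp (f := fun z : Fin 2 → ℂ => (z 0, z 1)) (by fun_prop) fun _ hz => hz

theorem isOpen_biHalfPlane : IsOpen biHalfPlane := by
  have h0 : IsOpen {z : ℂ × ℂ | 0 < z.1.im} := isOpen_lt continuous_const (by fun_prop)
  have h1 : IsOpen {z : ℂ × ℂ | 0 < z.2.im} := isOpen_lt continuous_const (by fun_prop)
  exact h0.inter h1

/-- The weight depends only on the imaginary parts, so Tonelli reduces the norm to slice norms.
Continuity serves only for the measurability of the cut-off function. -/
theorem bergmanNorm_sq (α β : ℝ) {G : ℂ × ℂ → ℂ} (hG : ContinuousOn G biHalfPlane) :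
    bergmanNorm α β G ^ 2 = ∫⁻ y in quadrant,
      ENNReal.ofReal (y 0 ^ α * y 1 ^ β) * sliceNorm (onPi G) y := by
  have e0 : bergmanNorm α β G ^ 2 = ∫⁻ z in biHalfPlane,
      ‖G z‖ₑ ^ 2 * ENNReal.ofReal (z.1.im ^ α * z.2.im ^ β) := by
    rw [bergmanNorm, ← ENNReal.rpow_natCast, ← ENNReal.rpow_mul]
    norm_num
  have hGm := measurable_indicator_of_continuousOn hG isOpen_biHalfPlane.measurableSet
  have hm : Measurable fun z : ℂ × ℂ => ‖biHalfPlane.indicator G z‖ₑ ^ 2 *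
      ENNReal.ofReal (z.1.im ^ α * z.2.im ^ β) := by
    refine (hGm.enorm.pow_const 2).mul (Measurable.ennreal_ofReal ?_)
    exact ((Complex.measurable_im.comp measurable_fst).pow_const _).mul
      ((Complex.measurable_im.comp measurable_snd).pow_const _)
  have e1 : ∫⁻ z in biHalfPlane, ‖G z‖ₑ ^ 2 * ENNReal.ofReal (z.1.im ^ α * z.2.im ^ β) =
      ∫⁻ z, ‖biHalfPlane.indicator G z‖ₑ ^ 2 * ENNReal.ofReal (z.1.im ^ α * z.2.im ^ β) := by
    rw [← lintegral_indicator isOpen_biHalfPlane.measurableSet]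
    refine lintegral_congr fun z => ?_
    by_cases hz : z ∈ biHalfPlane <;> simp [hz]
  rw [e0, e1, lintegral_complex_prod hm, ← lintegral_indicator isOpen_quadrant.measurableSet]
  refine lintegral_congr fun y => ?_
  by_cases hy : y ∈ quadrant
  · have hz : ∀ x, (tubePoint x y 0, tubePoint x y 1) ∈ biHalfPlane := fun x => by
      simpa [biHalfPlane, quadrant, tubePoint] using hy
    rw [Set.indicator_of_mem hy, sliceNorm, ← lintegral_const_mul' _ _ ENNReal.ofReal_ne_top]
    refine lintegral_congr fun x => ?_
    rw [Set.indicator_of_mem (hz x), mul_comm]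
    simp [onPi, tubePoint]
  · have hz : ∀ x, (tubePoint x y 0, tubePoint x y 1) ∉ biHalfPlane := fun x => by
      simpa [biHalfPlane, quadrant, tubePoint] using hy
    simp [Set.indicator_of_notMem hy, Set.indicator_of_notMem (hz _)]

end Fubini

/-! ### Laplace integrals of powers and integrals of `(r² - s²)ᵏ`. -/

section Integrals

/-- `∫₀^∞ y^α e^{-4π y t} dy`. -/
noncomputable def laplaceWeight (α t : ℝ) : ℝ≥0∞ :=
  ∫⁻ y in Set.Ioi (0 : ℝ), ENNReal.ofReal (y ^ α * Real.exp (-(4 * Real.pi * t * y)))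

theorem laplaceWeight_of_pos {α t : ℝ} (hα : -1 < α) (ht : 0 < t) :
    laplaceWeight α t = ENNReal.ofReal (Real.Gamma (α + 1) / (4 * Real.pi * t) ^ (α + 1)) := by
  have hr : 0 < 4 * Real.pi * t := by positivity
  have h := Real.integral_rpow_mul_exp_neg_mul_Ioi (a := α + 1) (r := 4 * Real.pi * t)
    (by linarith) hr
  rw [add_sub_cancel_right] at h
  have hpos : 0 < (1 / (4 * Real.pi * t)) ^ (α + 1) * Real.Gamma (α + 1) :=
    mul_pos (by positivity) (Real.Gamma_pos_of_pos (by linarith))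
  -- A nonintegrable function would have integral `0` by convention, whereas the known value is
  -- positive.
  have hi : Integrable (fun y : ℝ => y ^ α * Real.exp (-(4 * Real.pi * t * y)))
      (volume.restrict (Set.Ioi 0)) := by
    by_contra hn
    rw [integral_undef hn] at h
    exact hpos.ne h
  rw [laplaceWeight, ← ofReal_integral_eq_lintegral_ofReal hi, h]
  · congr 1
    rw [one_div, Real.inv_rpow hr.le]
    ring
  · filter_upwards [ae_restrict_mem measurableSet_Ioi] with y hy
    have : (0 : ℝ) < y := hy
    simp only [Pi.zero_apply]
    positivity

/-- The exponential is at least one, and no power is integrable on the whole half-line. This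
infinity is what confines the density of a Bergman function to the quadrant. -/
theorem laplaceWeight_of_nonpos {α t : ℝ} (ht : t ≤ 0) : laplaceWeight α t = ∞ := by
  by_contra hne
  refine not_integrableOn_Ioi_rpow α ⟨by fun_prop, ?_⟩
  rw [hasFiniteIntegral_iff_norm]
  refine lt_of_le_of_lt (setLIntegral_mono' measurableSet_Ioi fun y hy => ?_)
    (lt_top_iff_ne_top.2 hne)
  have hy' : (0 : ℝ) < y := hy
  refine ENNReal.ofReal_le_ofReal ?_
  rw [Real.norm_of_nonneg (by positivity)]
  refine le_mul_of_one_le_right (by positivity) (Real.one_le_exp ?_)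
  have := mul_nonneg (mul_nonneg Real.pi_pos.le hy'.le) (neg_nonneg.2 ht)
  linarith

theorem laplaceWeight_ne_zero {α : ℝ} (hα : -1 < α) (t : ℝ) : laplaceWeight α t ≠ 0 := by
  rcases lt_or_ge 0 t with ht | ht
  · rw [laplaceWeight_of_pos hα ht]
    have : 0 < Real.Gamma (α + 1) / (4 * Real.pi * t) ^ (α + 1) :=
      div_pos (Real.Gamma_pos_of_pos (by linarith)) (by positivity)
    simpa using this
  · rw [laplaceWeight_of_nonpos ht]
    exact ENNReal.top_ne_zero

theorem measurable_laplaceWeight (α : ℝ) : Measurable (laplaceWeight α) := by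
  have : Measurable fun p : ℝ × ℝ =>
      ENNReal.ofReal (p.2 ^ α * Real.exp (-(4 * Real.pi * p.1 * p.2))) := by
    fun_prop
  exact this.lintegral_prod_right'

theorem lintegral_quadrant_expWeight (α : ℝ) (a : Fin 2 → ℝ) :
    ∫⁻ y in quadrant, ENNReal.ofReal (y 0 ^ α * y 1 ^ α) * ENNReal.ofReal (expWeight y a) ^ 2 =
      laplaceWeight α (a 0) * laplaceWeight α (a 1) := by
  have hm : Measurable fun y : Fin 2 → ℝ => quadrant.indicator (fun y =>
      ENNReal.ofReal (y 0 ^ α * y 1 ^ α) * ENNReal.ofReal (expWeight y a) ^ 2) y := by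
    refine Measurable.indicator ?_ isOpen_quadrant.measurableSet
    unfold expWeight
    fun_prop
  rw [← lintegral_indicator isOpen_quadrant.measurableSet, lintegral_pi_two hm, laplaceWeight,
    laplaceWeight, ← lintegral_indicator measurableSet_Ioi, ← lintegral_indicator measurableSet_Ioi,
    ← lintegral_mul_const]
  swap
  · exact Measurable.indicator (by fun_prop) measurableSet_Ioi
  refine lintegral_congr fun s => ?_
  rw [← lintegral_const_mul]
  swap
  · exact Measurable.indicator (by fun_prop) measurableSet_Ioi
  refine lintegral_congr fun t => ?_
  by_cases hs : 0 < s
  · by_cases ht : 0 < t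
    · rw [Set.indicator_of_mem (show ![s, t] ∈ quadrant from ⟨by simpa using hs, by simpa using ht⟩),
        Set.indicator_of_mem (Set.mem_Ioi.2 hs), Set.indicator_of_mem (Set.mem_Ioi.2 ht),
        ← ENNReal.ofReal_pow (expWeight_pos _ _).le, ← ENNReal.ofReal_mul (by simp; positivity),
        ← ENNReal.ofReal_mul (by positivity)]
      congr 1
      simp only [Matrix.cons_val, expWeight, Fin.sum_univ_two]
      rw [← Real.exp_nat_mul]
      have : s ^ α * Real.exp (-(4 * Real.pi * a 0 * s)) *
          (t ^ α * Real.exp (-(4 * Real.pi * a 1 * t))) = s ^ α * t ^ α *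
          (Real.exp (-(4 * Real.pi * a 0 * s)) * Real.exp (-(4 * Real.pi * a 1 * t))) := by ring
      rw [this, ← Real.exp_add]
      congr 2
      push_cast
      ring
    · rw [Set.indicator_of_notMem (show ![s, t] ∉ quadrant from fun h => ht (by simpa using h.2)),
        Set.indicator_of_notMem (show t ∉ Set.Ioi 0 from ht), mul_zero]
  · rw [Set.indicator_of_notMem (show ![s, t] ∉ quadrant from fun h => hs (by simpa using h.1)),
      Set.indicator_of_notMem (show s ∉ Set.Ioi 0 from hs), zero_mul]

/-- Tonelli: the `y`-integral of the weight against `e^{-4πy·a}` splits into two one-dimensional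
Laplace integrals. -/
theorem lintegral_quadrant_mul_lintegral (α : ℝ) {g : (Fin 2 → ℝ) → ℂ} (hg : Measurable g) :
    ∫⁻ y in quadrant, ENNReal.ofReal (y 0 ^ α * y 1 ^ α) *
        ∫⁻ a, ‖(expWeight y a : ℂ) * g a‖ₑ ^ 2 =
      ∫⁻ a, ‖g a‖ₑ ^ 2 * (laplaceWeight α (a 0) * laplaceWeight α (a 1)) := by
  have hm : Measurable fun p : (Fin 2 → ℝ) × (Fin 2 → ℝ) => ENNReal.ofReal (p.1 0 ^ α * p.1 1 ^ α) *
      (ENNReal.ofReal (expWeight p.1 p.2) ^ 2 * ‖g p.2‖ₑ ^ 2) := by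
    unfold expWeight
    fun_prop
  simp only [enorm_expWeight_mul, mul_pow]
  simp_rw [← lintegral_const_mul' _ _ ENNReal.ofReal_ne_top]
  rw [lintegral_lintegral_swap hm.aemeasurable]
  refine lintegral_congr fun a => ?_
  rw [← lintegral_quadrant_expWeight, ← lintegral_const_mul]
  · refine lintegral_congr fun y => ?_
    ring
  · unfold expWeight
    fun_prop

/-- The value of `∫_{-1}^1 (1 - s²)^k ds`. -/
noncomputable def ballConst (k : ℕ) : ℝ :=
  Real.sqrt Real.pi * (Nat.factorial k : ℝ) / Real.Gamma (k + 3 / 2)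

theorem ballConst_pos (k : ℕ) : 0 < ballConst k :=
  div_pos (mul_pos (Real.sqrt_pos.2 Real.pi_pos) (by positivity))
    (Real.Gamma_pos_of_pos (by positivity))

theorem ballConst_succ (k : ℕ) : ballConst (k + 1) = ballConst k * ((2 * k + 2) / (2 * k + 3)) := by
  have h1 : ((k + 1 : ℕ) : ℝ) + 3 / 2 = (k + 3 / 2) + 1 := by push_cast; ring
  have h2 : (k : ℝ) + 3 / 2 ≠ 0 := by positivity
  have h3 : Real.Gamma ((k : ℝ) + 3 / 2) ≠ 0 := (Real.Gamma_pos_of_pos (by positivity)).ne'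
  rw [ballConst, ballConst, h1, Real.Gamma_add_one h2, Nat.factorial_succ]
  push_cast
  field_simp

theorem ballConst_zero : ballConst 0 = 2 := by
  have h : Real.Gamma (3 / 2) = 1 / 2 * Real.sqrt Real.pi := by
    have := Real.Gamma_add_one (s := 1 / 2) (by norm_num)
    rw [Real.Gamma_one_half_eq] at this
    rw [← this]; norm_num
  have hπ : Real.sqrt Real.pi ≠ 0 := (Real.sqrt_pos.2 Real.pi_pos).ne'
  rw [ballConst]
  norm_num [h]
  field_simp

theorem two_mul_prod_eq_ballConst (k : ℕ) :
    2 * ∏ i ∈ Finset.range k, (2 * (i : ℝ) + 2) / (2 * i + 3) = ballConst k := by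
  induction k with
  | zero => simp [ballConst_zero]
  | succ k ih => rw [Finset.prod_range_succ, ← mul_assoc, ballConst_succ, ih]

/-- The substitution `s = cos θ` turns this into the Wallis integral of `sin^{2k+1}` over `[0, π]`.
-/
theorem integral_one_sub_sq_pow (k : ℕ) : ∫ s in (-1 : ℝ)..1, (1 - s ^ 2) ^ k = ballConst k := by
  have h1 := integral_sin_pow_odd_mul_cos_pow (a := 0) (b := Real.pi) k 0
  simp only [pow_zero, mul_one, one_mul, Real.cos_pi, Real.cos_zero] at h1
  rw [← h1, integral_sin_pow_odd, two_mul_prod_eq_ballConst]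

theorem integral_sq_sub_sq_pow {r : ℝ} (hr : 0 < r) (k : ℕ) :
    ∫ s in (-r)..r, (r ^ 2 - s ^ 2) ^ k = r ^ (2 * k + 1) * ballConst k := by
  have h := intervalIntegral.integral_comp_mul_left (a := -1) (b := 1)
    (fun s => (r ^ 2 - s ^ 2) ^ k) hr.ne'
  rw [mul_neg_one, mul_one] at h
  have h2 : ∀ s : ℝ, (r ^ 2 - (r * s) ^ 2) ^ k = r ^ (2 * k) * (1 - s ^ 2) ^ k := by
    intro s
    rw [pow_mul, ← mul_pow]
    congr 1; ring
  simp only [h2, intervalIntegral.integral_const_mul, integral_one_sub_sq_pow] at h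
  rw [smul_eq_mul, eq_inv_mul_iff_mul_eq₀ hr.ne'] at h
  rw [← h]; ring

theorem lintegral_sq_sub_sq_pow {r : ℝ} (hr : 0 < r) (k : ℕ) :
    ∫⁻ s in Set.Icc (-r) r, ENNReal.ofReal ((r ^ 2 - s ^ 2) ^ k) =
      ENNReal.ofReal (r ^ (2 * k + 1) * ballConst k) := by
  rw [← integral_sq_sub_sq_pow hr, intervalIntegral.integral_of_le (by linarith),
    ← integral_Icc_eq_integral_Ioc, ofReal_integral_eq_lintegral_ofReal]
  · exact Continuous.integrableOn_Icc (by fun_prop)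
  · filter_upwards [ae_restrict_mem measurableSet_Icc] with s hs
    have : s ^ 2 ≤ r ^ 2 := sq_le_sq' hs.1 hs.2
    exact pow_nonneg (by linarith) k

end Integrals

/-! ### The Bergman weight as a power of `√(a₀a₁)`. -/

section Constants

theorem sqrt_pow_eq_rpow {x : ℝ} (hx : 0 ≤ x) (n : ℕ) :
    x ^ ((n : ℝ) / 2) = Real.sqrt x ^ n := by
  rw [Real.sqrt_eq_rpow, ← Real.rpow_natCast, ← Real.rpow_mul hx]
  congr 1; ring

/-- Since `α + 1 = (4m + 1)/2`, the product is an integer power of `√(a₀a₁)`, which can cancel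
against powers of the slice length. -/
theorem laplaceWeight_mul (m : ℕ) {a : Fin 2 → ℝ} (ha : a ∈ quadrant) :
    laplaceWeight (2 * m - 1 / 2) (a 0) * laplaceWeight (2 * m - 1 / 2) (a 1) =
      ENNReal.ofReal (Real.Gamma (2 * m + 1 / 2) ^ 2 /
        ((4 * Real.pi) ^ (4 * m + 1) * Real.sqrt (a 0 * a 1) ^ (4 * m + 1))) := by
  obtain ⟨h0, h1⟩ := ha
  have hα : (-1 : ℝ) < 2 * m - 1 / 2 := by
    have : (0 : ℝ) ≤ m := m.cast_nonneg
    linarith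
  have e : (2 * (m : ℝ) - 1 / 2) + 1 = 2 * m + 1 / 2 := by ring
  have e2 : 2 * (m : ℝ) + 1 / 2 = ((4 * m + 1 : ℕ) : ℝ) / 2 := by push_cast; ring
  have hp : 0 ≤ 4 * Real.pi := by positivity
  have e3 : (4 * Real.pi) ^ (4 * m + 1) =
      (4 * Real.pi) ^ (2 * (m : ℝ) + 1 / 2) * (4 * Real.pi) ^ (2 * (m : ℝ) + 1 / 2) := by
    rw [← Real.rpow_add (by positivity), ← Real.rpow_natCast]
    congr 1; push_cast; ring
  rw [laplaceWeight_of_pos hα h0, laplaceWeight_of_pos hα h1, e,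
    ← ENNReal.ofReal_mul (div_nonneg (Real.Gamma_pos_of_pos (by positivity)).le (by positivity)),
    Real.mul_rpow hp h0.le, Real.mul_rpow hp h1.le,
    ← sqrt_pow_eq_rpow (mul_pos h0 h1).le, ← e2, Real.mul_rpow h0.le h1.le, e3]
  congr 1
  field_simp

end Constants

/-! ### The restriction inequality. -/

section Restriction

theorem exists_of_memHardy {F : (Fin 3 → ℂ) → ℂ} (hF : MemHardy F) :
    ∃ f : (Fin 3 → ℝ) → ℂ, Admissible cone f ∧ (∀ η, η ∉ dualCone → f η = 0) ∧
      Set.EqOn F (fourierLaplace f) tube ∧ ∫⁻ η, ‖f η‖ₑ ^ 2 ≤ hardyNorm F ^ 2 := by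
  have hC : hardyNorm F ^ 2 < ∞ := ENNReal.pow_lt_top hF.2
  have hle : ∀ y ∈ cone, sliceNorm F y ≤ hardyNorm F ^ 2 := fun y hy => by
    rw [hardyNorm_sq]; exact le_iSup₂ (f := fun y _ => sliceNorm F y) y hy
  obtain ⟨f, hf, hFf, hs⟩ := exists_eq_fourierLaplace isOpen_cone convex_cone
    ⟨_, base_mem_cone one_pos one_pos⟩ hF.1 (fun y hy => ⟨_, hC, by
      filter_upwards [isOpen_cone.mem_nhds hy] with y' hy' using hle y' hy'⟩)
  have hb : ∀ y ∈ cone, ∫⁻ η, ‖(expWeight y η : ℂ) * f η‖ₑ ^ 2 ≤ hardyNorm F ^ 2 :=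
    fun y hy => (hs y hy).symm.trans_le (hle y hy)
  have h0 := ae_eq_zero_of_forall_cone hf.1 hC hb
  -- The density is replaced by its cut-off, so that it vanishes off the dual cone at every point
  -- and every slice integral can use this.
  have hae : dualCone.indicator f =ᵐ[volume] f := by
    filter_upwards [h0] with η hη
    by_cases h : η ∈ dualCone
    · rw [Set.indicator_of_mem h]
    · rw [Set.indicator_of_notMem h, hη h]
  have hm : Measurable (dualCone.indicator f) := hf.1.indicator measurableSet_dualCone
  have hz : ∀ η, η ∉ dualCone → dualCone.indicator f η = 0 :=
    fun η h => Set.indicator_of_notMem h f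
  have hn : ∫⁻ η, ‖dualCone.indicator f η‖ₑ ^ 2 ≤ hardyNorm F ^ 2 := by
    refine le_trans (le_of_eq (lintegral_congr_ae ?_)) (lintegral_le_of_forall_cone hf.1 hb)
    filter_upwards [hae] with η hη
    rw [hη]
  refine ⟨_, admissible_of_dualCone hm ((memLp_two_iff hm.aestronglyMeasurable).2
    (hn.trans_lt hC)) hz, hz, fun z hz => ?_, hn⟩
  rw [hFf z hz, fourierLaplace, fourierLaplace]
  refine integral_congr_ae ?_
  filter_upwards [hae] with η hη
  rw [hη]

theorem measurable_integral_glue {h : (Fin 3 → ℝ) → ℂ} (hh : Measurable h) :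
    Measurable fun a => ∫ s, h (glue s a) :=
  (StronglyMeasurable.integral_prod_left' (f := fun p : ℝ × (Fin 2 → ℝ) => h (glue p.1 p.2))
    (hh.comp measurable_glue).stronglyMeasurable).measurable

theorem lintegral_mul_sq_le {X : Type*} [MeasurableSpace X] {μ : Measure X} {A B : X → ℝ≥0∞}
    (hA : AEMeasurable A μ) (hB : AEMeasurable B μ) :
    (∫⁻ x, A x * B x ∂μ) ^ 2 ≤ (∫⁻ x, A x ^ 2 ∂μ) * ∫⁻ x, B x ^ 2 ∂μ := by
  have h := ENNReal.lintegral_mul_le_Lp_mul_Lq μ Real.HolderConjugate.two_two hA hB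
  simp only [ENNReal.rpow_ofNat, Pi.mul_apply] at h
  calc _ ≤ ((∫⁻ x, A x ^ 2 ∂μ) ^ (1 / 2 : ℝ) * (∫⁻ x, B x ^ 2 ∂μ) ^ (1 / 2 : ℝ)) ^ 2 := by
        gcongr
    _ = _ := by
        rw [mul_pow, ← ENNReal.rpow_natCast, ← ENNReal.rpow_natCast, ← ENNReal.rpow_mul,
          ← ENNReal.rpow_mul]
        norm_num

theorem glue_mem_dualCone {a : Fin 2 → ℝ} (ha : a ∈ quadrant) (s : ℝ) :
    glue s a ∈ dualCone ↔
      s ∈ Set.Icc (-(2 * Real.sqrt (a 0 * a 1))) (2 * Real.sqrt (a 0 * a 1)) := by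
  have hp := mul_pos ha.1 ha.2
  rw [Set.mem_Icc, ← abs_le, ← abs_of_nonneg (by positivity : 0 ≤ 2 * Real.sqrt (a 0 * a 1)),
    ← sq_le_sq, mul_pow, Real.sq_sqrt hp.le]
  simp only [dualCone, glue, Set.mem_ofPred_eq, Matrix.cons_val]
  constructor
  · rintro ⟨-, -, h⟩; linarith
  · intro h; exact ⟨ha.1.le, ha.2.le, by linarith⟩

theorem boxSymbol_glue {a : Fin 2 → ℝ} (ha : a ∈ quadrant) (s : ℝ) :
    boxSymbol (glue s a) = 4 * Real.pi ^ 2 * ((2 * Real.sqrt (a 0 * a 1)) ^ 2 - s ^ 2) := by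
  have hp := mul_pos ha.1 ha.2
  rw [mul_pow, Real.sq_sqrt hp.le]
  simp only [boxSymbol, glue, Matrix.cons_val]
  ring

/-- Off the open quadrant the conditions `a₀, a₁ ≥ 0`, `s² ≤ 4a₀a₁` leave at most `s = 0`, a null
set. -/
theorem integral_glue_eq_zero {h : (Fin 3 → ℝ) → ℂ} (h0 : ∀ η, η ∉ dualCone → h η = 0)
    {a : Fin 2 → ℝ} (ha : a ∉ quadrant) : ∫ s, h (glue s a) = 0 := by
  refine integral_eq_zero_of_ae ?_
  have : ∀ᵐ s : ℝ, s ≠ 0 := by simp [ae_iff]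
  filter_upwards [this] with s hs
  refine h0 _ fun hmem => ha ?_
  simp only [dualCone, glue, Set.mem_ofPred_eq, Matrix.cons_val] at hmem
  obtain ⟨h1, h2, h3⟩ := hmem
  have h4 : 0 < a 0 * a 1 := by
    have : 0 < s ^ 2 := by positivity
    linarith
  exact ⟨lt_of_le_of_ne h1 fun h => by simp [← h] at h4,
    lt_of_le_of_ne h2 fun h => by simp [← h] at h4⟩

/-- Cauchy–Schwarz on the slice `|s| ≤ r`, with the `2m`-th power of the symbol integrated
explicitly. -/
theorem enorm_integral_glue_sq_le {f : (Fin 3 → ℝ) → ℂ} (hf : Measurable f)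
    (h0 : ∀ η, η ∉ dualCone → f η = 0) (m : ℕ) {a : Fin 2 → ℝ} (ha : a ∈ quadrant) :
    ‖∫ s, (boxSymbol (glue s a) : ℂ) ^ m * f (glue s a)‖ₑ ^ 2 ≤
      ENNReal.ofReal ((4 * Real.pi ^ 2) ^ (2 * m) *
        ((2 * Real.sqrt (a 0 * a 1)) ^ (4 * m + 1) * ballConst (2 * m))) *
      ∫⁻ s, ‖f (glue s a)‖ₑ ^ 2 := by
  set r := 2 * Real.sqrt (a 0 * a 1) with hr
  have hr0 : 0 < r := mul_pos two_pos (Real.sqrt_pos.2 (mul_pos ha.1 ha.2))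
  set A : ℝ → ℝ≥0∞ := (Set.Icc (-r) r).indicator
    fun s => ENNReal.ofReal ((4 * Real.pi ^ 2 * (r ^ 2 - s ^ 2)) ^ m) with hA
  have hAm : Measurable A := Measurable.indicator (by fun_prop) measurableSet_Icc
  have hBm : Measurable fun s => ‖f (glue s a)‖ₑ :=
    (hf.comp (measurable_glue.comp (measurable_id.prodMk measurable_const))).enorm
  have h1 : ‖∫ s, (boxSymbol (glue s a) : ℂ) ^ m * f (glue s a)‖ₑ ≤
      ∫⁻ s, A s * ‖f (glue s a)‖ₑ := by
    refine (enorm_integral_le_lintegral_enorm _).trans (le_of_eq (lintegral_congr fun s => ?_))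
    by_cases hs : s ∈ Set.Icc (-r) r
    · have hs2 : s ^ 2 ≤ r ^ 2 := sq_le_sq' hs.1 hs.2
      have h3 : 0 ≤ (4 * Real.pi ^ 2 * (r ^ 2 - s ^ 2)) ^ m :=
        pow_nonneg (mul_nonneg (by positivity) (by linarith)) m
      rw [hA, Set.indicator_of_mem hs, enorm_mul, boxSymbol_glue ha, ← hr, ← Complex.ofReal_pow,
        ← ofReal_norm (((4 * Real.pi ^ 2 * (r ^ 2 - s ^ 2)) ^ m : ℝ) : ℂ), Complex.norm_real,
        Real.norm_of_nonneg h3]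
    · rw [h0 _ (fun h => hs ((glue_mem_dualCone ha s).1 h))]
      simp
  have h2 : ∫⁻ s, A s ^ 2 = ENNReal.ofReal ((4 * Real.pi ^ 2) ^ (2 * m) *
        (r ^ (4 * m + 1) * ballConst (2 * m))) := by
    have e : 4 * m + 1 = 2 * (2 * m) + 1 := by ring
    rw [ENNReal.ofReal_mul (by positivity), e, ← lintegral_sq_sub_sq_pow hr0,
      ← lintegral_const_mul _ (by fun_prop), ← lintegral_indicator measurableSet_Icc]
    refine lintegral_congr fun s => ?_
    by_cases hs : s ∈ Set.Icc (-r) r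
    · have hs2 : s ^ 2 ≤ r ^ 2 := sq_le_sq' hs.1 hs.2
      rw [hA, Set.indicator_of_mem hs, Set.indicator_of_mem hs,
        ← ENNReal.ofReal_pow (pow_nonneg (mul_nonneg (by positivity) (by linarith)) m),
        ← ENNReal.ofReal_mul (by positivity)]
      congr 1
      rw [mul_pow, mul_pow, ← pow_mul, ← pow_mul, mul_comm m 2]
    · simp [hA, hs]
  calc _ ≤ (∫⁻ s, A s * ‖f (glue s a)‖ₑ) ^ 2 := by gcongr
    _ ≤ (∫⁻ s, A s ^ 2) * ∫⁻ s, ‖f (glue s a)‖ₑ ^ 2 :=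
      lintegral_mul_sq_le hAm.aemeasurable hBm.aemeasurable
    _ = _ := by rw [h2]

/-- The sharp constant in the restriction inequality. -/
noncomputable def restrictConst (m : ℕ) : ℝ :=
  ballConst (2 * m) * Real.Gamma (2 * m + 1 / 2) ^ 2 / (2 * Real.pi)

/-- After `Γ(2m + 3/2)` is reduced by its functional equation, the two sides differ only in the
factors `1/(2π)` and `4π²`. -/
theorem restrictConst_le (m : ℕ) : restrictConst m ≤
    4 * Real.pi ^ (5 / 2 : ℝ) * (Nat.factorial (2 * m) : ℝ) *
      Real.Gamma (2 * m + 1 / 2) / (2 * m + 1 / 2) := by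
  have hG : 0 < Real.Gamma (2 * m + 1 / 2) := Real.Gamma_pos_of_pos (by positivity)
  have h1 : (((2 * m : ℕ) : ℝ) + 3 / 2) = (2 * m + 1 / 2) + 1 := by push_cast; ring
  have h2 : (2 * (m : ℝ) + 1 / 2) ≠ 0 := by positivity
  have hπ := Real.pi_gt_three
  have h5 : Real.pi ^ (5 / 2 : ℝ) = Real.pi ^ 2 * Real.sqrt Real.pi := by
    rw [Real.sqrt_eq_rpow, ← Real.rpow_natCast, ← Real.rpow_add (by positivity)]
    norm_num
  have e : restrictConst m = (1 / (2 * Real.pi)) * (Real.sqrt Real.pi *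
      (Nat.factorial (2 * m) : ℝ) * Real.Gamma (2 * m + 1 / 2) / (2 * m + 1 / 2)) := by
    rw [restrictConst, ballConst, h1, Real.Gamma_add_one h2]
    field_simp
  have e' : 4 * Real.pi ^ (5 / 2 : ℝ) * (Nat.factorial (2 * m) : ℝ) *
      Real.Gamma (2 * m + 1 / 2) / (2 * m + 1 / 2) = (4 * Real.pi ^ 2) * (Real.sqrt Real.pi *
      (Nat.factorial (2 * m) : ℝ) * Real.Gamma (2 * m + 1 / 2) / (2 * m + 1 / 2)) := by
    rw [h5]; ring
  rw [e, e']
  refine mul_le_mul_of_nonneg_right ?_ (by positivity)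
  rw [div_le_iff₀ (by positivity)]
  nlinarith [sq_nonneg Real.pi]

/-- The powers of `p = √(a₀a₁)` cancel: this is where the exponent `2m - 1/2` is forced. -/
theorem restrict_const_identity (m : ℕ) {p : ℝ} (hp : 0 < p) :
    (4 * Real.pi ^ 2) ^ (2 * m) * ((2 * p) ^ (4 * m + 1) * ballConst (2 * m)) *
      (Real.Gamma (2 * m + 1 / 2) ^ 2 / ((4 * Real.pi) ^ (4 * m + 1) * p ^ (4 * m + 1))) =
      restrictConst m := by
  have hπ := Real.pi_pos
  have e1 : (4 * Real.pi) ^ (4 * m + 1) = (4 * Real.pi ^ 2) ^ (2 * m) * 2 ^ (4 * m) * (4 * Real.pi) := by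
    have : (2 : ℝ) ^ (4 * m) = 4 ^ (2 * m) := by
      rw [show 4 * m = 2 * (2 * m) by ring, pow_mul]; norm_num
    rw [this, ← mul_pow, pow_succ, show 4 * m = 2 * (2 * m) by ring, pow_mul]
    congr 2; ring
  rw [e1, restrictConst, mul_pow 2 p, pow_succ (2 : ℝ)]
  field_simp
  ring

theorem restrict_box_eq {F : (Fin 3 → ℂ) → ℂ} {f : (Fin 3 → ℝ) → ℂ} (hf : Admissible cone f)
    (hF : Set.EqOn F (fourierLaplace f) tube) (m : ℕ) {z : ℂ × ℂ} (hz : z ∈ biHalfPlane) :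
    restrict (box^[m] F) z = fourierLaplace
      (fun a => ∫ s, (boxSymbol (glue s a) : ℂ) ^ m * f (glue s a)) ![z.1, z.2] := by
  obtain ⟨hadm, hbox⟩ := box_iterate_fourierLaplace hf hF m
  have h0 : 0 < ((![z.1, z.2] : Fin 2 → ℂ) 0).im := hz.1
  have h1 : 0 < ((![z.1, z.2] : Fin 2 → ℂ) 1).im := hz.2
  have hmem := mem_tube_of_pos h0 h1
  have := fourierLaplace_glue hadm h0 h1
  rw [← this, restrict]
  exact hbox hmem

theorem differentiableOn_restrict_box {F : (Fin 3 → ℂ) → ℂ} {f : (Fin 3 → ℝ) → ℂ}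
    (hf : Admissible cone f) (hF : Set.EqOn F (fourierLaplace f) tube) (m : ℕ) :
    DifferentiableOn ℂ (restrict (box^[m] F)) biHalfPlane := by
  obtain ⟨hadm, hbox⟩ := box_iterate_fourierLaplace hf hF m
  have hd : DifferentiableOn ℂ (box^[m] F) tube :=
    (differentiableOn_fourierLaplace isOpen_cone hadm).congr hbox
  refine hd.comp (f := fun z : ℂ × ℂ => ![z.1, z.2, 0]) ?_ fun z hz => ?_
  · refine Differentiable.differentiableOn (differentiable_pi.2 fun j => ?_)
    fin_cases j
    · exact differentiable_fst
    · exact differentiable_snd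
    · exact differentiable_const _
  · exact mem_tube_of_pos (z := ![z.1, z.2]) hz.1 hz.2

theorem restrict_box_le {F : (Fin 3 → ℂ) → ℂ} (hF : MemHardy F) (m : ℕ) :
    MemBergman (2 * m - 1 / 2) (2 * m - 1 / 2) (restrict (box^[m] F)) ∧
      bergmanNorm (2 * m - 1 / 2) (2 * m - 1 / 2) (restrict (box^[m] F)) ^ 2 ≤
        ENNReal.ofReal (restrictConst m) * hardyNorm F ^ 2 := by
  obtain ⟨f, hf, h0, hFf, hn⟩ := exists_of_memHardy hF
  have hd := differentiableOn_restrict_box hf hFf m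
  obtain ⟨hadm, -⟩ := box_iterate_fourierLaplace hf hFf m
  set g : (Fin 2 → ℝ) → ℂ := fun a => ∫ s, (boxSymbol (glue s a) : ℂ) ^ m * f (glue s a) with hg
  have hgm : Measurable g := measurable_integral_glue hadm.1
  have hslice : ∀ y ∈ quadrant, sliceNorm (onPi (restrict (box^[m] F))) y ≤
      ∫⁻ a, ‖(expWeight y a : ℂ) * g a‖ₑ ^ 2 := by
    intro y hy
    refine le_trans (le_of_eq ?_)
      (lintegral_fourierLaplace_sq_le (integrable_expWeight_mul_integral_glue hadm hy.1 hy.2))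
    refine lintegral_congr fun x => ?_
    have hz : (tubePoint x y 0, tubePoint x y 1) ∈ biHalfPlane := by
      simpa [biHalfPlane, quadrant, tubePoint] using hy
    rw [onPi, restrict_box_eq hf hFf m hz, ← fourierLaplace_tubePoint]
    congr 3
    ext j
    fin_cases j <;> rfl
  have hle : bergmanNorm (2 * m - 1 / 2) (2 * m - 1 / 2) (restrict (box^[m] F)) ^ 2 ≤
      ENNReal.ofReal (restrictConst m) * hardyNorm F ^ 2 := by
    rw [bergmanNorm_sq _ _ hd.continuousOn]
    calc _ ≤ ∫⁻ y in quadrant, ENNReal.ofReal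
            (y 0 ^ (2 * (m : ℝ) - 1 / 2) * y 1 ^ (2 * (m : ℝ) - 1 / 2)) *
            ∫⁻ a, ‖(expWeight y a : ℂ) * g a‖ₑ ^ 2 :=
          setLIntegral_mono' isOpen_quadrant.measurableSet fun y hy => by
            gcongr; exact hslice y hy
      _ = ∫⁻ a, ‖g a‖ₑ ^ 2 * (laplaceWeight (2 * m - 1 / 2) (a 0) *
            laplaceWeight (2 * m - 1 / 2) (a 1)) := lintegral_quadrant_mul_lintegral _ hgm
      _ ≤ ∫⁻ a, ENNReal.ofReal (restrictConst m) * ∫⁻ s, ‖f (glue s a)‖ₑ ^ 2 := by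
          refine lintegral_mono fun a => ?_
          by_cases ha : a ∈ quadrant
          · have hp : 0 < Real.sqrt (a 0 * a 1) := Real.sqrt_pos.2 (mul_pos ha.1 ha.2)
            have hb := ballConst_pos (2 * m)
            simp only
            rw [laplaceWeight_mul m ha, ← restrict_const_identity m hp,
              ENNReal.ofReal_mul (by positivity), mul_right_comm]
            exact mul_le_mul_left (enorm_integral_glue_sq_le hf.1 h0 m ha) _
          · have : g a = 0 := integral_glue_eq_zero
              (h := fun η => (boxSymbol η : ℂ) ^ m * f η) (fun η hη => by simp [h0 η hη]) ha
            simp [this]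
      _ = ENNReal.ofReal (restrictConst m) * ∫⁻ η, ‖f η‖ₑ ^ 2 := by
          rw [lintegral_const_mul' _ _ ENNReal.ofReal_ne_top,
            ← lintegral_glue (g := fun η => ‖f η‖ₑ ^ 2) (hf.1.enorm.pow_const 2)]
      _ ≤ _ := by gcongr
  refine ⟨⟨hd, ?_⟩, hle⟩
  have := hle.trans_lt (ENNReal.mul_lt_top ENNReal.ofReal_lt_top (ENNReal.pow_lt_top hF.2))
  simpa [ENNReal.pow_lt_top_iff] using this

end Restriction

/-! ### Local boundedness of slice norms in the Bergman space. -/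

section LocalBound

theorem enorm_sq_le_lintegral_bidisc {G : ℂ × ℂ → ℂ} (hG : DifferentiableOn ℂ G biHalfPlane)
    {r : ℝ} (hr : 0 < r) {z : ℂ × ℂ} (h0 : r ≤ z.1.im) (h1 : r ≤ z.2.im) :
    ENNReal.ofReal (Real.pi * r ^ 2) * (ENNReal.ofReal (Real.pi * r ^ 2) * ‖G z‖ₑ ^ 2) ≤
      ∫⁻ w₀ in Metric.ball z.1 r, ∫⁻ w₁ in Metric.ball z.2 r, ‖G (w₀, w₁)‖ₑ ^ 2 := by
  have him : ∀ {c w : ℂ}, r ≤ c.im → w ∈ Metric.ball c r → 0 < w.im := by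
    intro c w hc hw
    rw [Metric.mem_ball, dist_eq_norm] at hw
    have := (abs_lt.1 ((Complex.abs_im_le_norm (w - c)).trans_lt hw)).1
    rw [Complex.sub_im] at this
    linarith
  have key : ∀ w₀ ∈ Metric.ball z.1 r, ENNReal.ofReal (Real.pi * r ^ 2) * ‖G (w₀, z.2)‖ₑ ^ 2 ≤
      ∫⁻ w₁ in Metric.ball z.2 r, ‖G (w₀, w₁)‖ₑ ^ 2 := fun w₀ hw₀ =>
    enorm_sq_le_lintegral_ball (g := fun w₁ => G (w₀, w₁)) (hG.comp (f := fun w₁ => (w₀, w₁))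
      (by fun_prop) fun w₁ hw₁ => ⟨him h0 hw₀, him h1 hw₁⟩) hr
  have h2 : ENNReal.ofReal (Real.pi * r ^ 2) * ‖G z‖ₑ ^ 2 ≤
      ∫⁻ w₀ in Metric.ball z.1 r, ‖G (w₀, z.2)‖ₑ ^ 2 :=
    enorm_sq_le_lintegral_ball (g := fun w₀ => G (w₀, z.2)) (hG.comp (f := fun w₀ => (w₀, z.2))
      (by fun_prop) fun w₀ hw₀ => ⟨him h0 hw₀, hr.trans_le h1⟩) hr
  calc _ ≤ ENNReal.ofReal (Real.pi * r ^ 2) *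
        ∫⁻ w₀ in Metric.ball z.1 r, ‖G (w₀, z.2)‖ₑ ^ 2 := by gcongr
    _ = ∫⁻ w₀ in Metric.ball z.1 r, ENNReal.ofReal (Real.pi * r ^ 2) * ‖G (w₀, z.2)‖ₑ ^ 2 :=
        (lintegral_const_mul' _ _ ENNReal.ofReal_ne_top).symm
    _ ≤ _ := setLIntegral_mono' Metric.isOpen_ball.measurableSet key

/-- Real and imaginary parts are bounded by the modulus, so the bidisc lies in a product of two
sup-norm balls, one for each part. -/
theorem lintegral_bidisc_le {S : ℂ × ℂ → ℝ≥0∞} (hS : Measurable S) {r : ℝ} (hr : 0 < r)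
    (x y : Fin 2 → ℝ) :
    ∫⁻ w₀ in Metric.ball (tubePoint x y 0) r, ∫⁻ w₁ in Metric.ball (tubePoint x y 1) r, S (w₀, w₁) ≤
      ∫⁻ v in Metric.ball y r, ∫⁻ u in Metric.ball (0 : Fin 2 → ℝ) r,
        S (tubePoint (x + u) v 0, tubePoint (x + u) v 1) := by
  have hms : MeasurableSet (Metric.ball (tubePoint x y 0) r ×ˢ Metric.ball (tubePoint x y 1) r) :=
    Metric.isOpen_ball.measurableSet.prod Metric.isOpen_ball.measurableSet
  rw [← lintegral_prod (μ := volume.restrict (Metric.ball (tubePoint x y 0) r))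
    (ν := volume.restrict (Metric.ball (tubePoint x y 1) r)) S hS.aemeasurable,
    Measure.prod_restrict, ← lintegral_indicator hms, ← Measure.volume_eq_prod,
    lintegral_complex_prod (hS.indicator hms), ← lintegral_indicator Metric.isOpen_ball.measurableSet]
  refine lintegral_mono fun v => ?_
  by_cases hv : v ∈ Metric.ball y r
  · rw [Set.indicator_of_mem hv, ← lintegral_add_left_eq_self _ x,
      ← lintegral_indicator Metric.isOpen_ball.measurableSet]
    refine lintegral_mono fun u => ?_
    by_cases hu : u ∈ Metric.ball (0 : Fin 2 → ℝ) r
    · simp only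
      rw [Set.indicator_of_mem hu]
      exact Set.indicator_le_self _ _ _
    · simp only
      rw [Set.indicator_of_notMem, Set.indicator_of_notMem hu]
      rintro ⟨ha, hb⟩
      refine hu ?_
      rw [mem_ball_zero_iff, pi_norm_lt_iff hr]
      intro j
      rw [Real.norm_eq_abs]
      have h : ∀ k, tubePoint (x + u) v k ∈ Metric.ball (tubePoint x y k) r → |u k| < r := by
        intro k hk
        rw [mem_ball_iff_norm] at hk
        refine lt_of_le_of_lt ?_ hk
        have := Complex.abs_re_le_norm (tubePoint (x + u) v k - tubePoint x y k)
        simpa [tubePoint] using this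
      fin_cases j
      · exact h 0 ha
      · exact h 1 hb
  · rw [Set.indicator_of_notMem hv]
    refine le_of_eq (lintegral_eq_zero_of_ae_eq_zero (Filter.Eventually.of_forall fun u => ?_))
    refine Set.indicator_of_notMem ?_ _
    rintro ⟨ha, hb⟩
    refine hv ?_
    rw [mem_ball_iff_norm, pi_norm_lt_iff hr]
    intro j
    rw [Real.norm_eq_abs]
    have h : ∀ k, tubePoint u v k ∈ Metric.ball (tubePoint x y k) r → |(v - y) k| < r := by
      intro k hk
      rw [mem_ball_iff_norm] at hk
      refine lt_of_le_of_lt ?_ hk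
      have := Complex.abs_im_le_norm (tubePoint u v k - tubePoint x y k)
      simpa [tubePoint] using this
    fin_cases j
    · exact h 0 ha
    · exact h 1 hb

/-- Once the integral over `x` is taken, the shift by `u` has no effect and the `u`-integral
contributes only the volume of `B`. -/
theorem lintegral_translate_average {T : (Fin 2 → ℝ) → (Fin 2 → ℝ) → ℝ≥0∞}
    (hT : Measurable (Function.uncurry T)) (A B : Set (Fin 2 → ℝ)) :
    ∫⁻ x, ∫⁻ v in A, ∫⁻ u in B, T (x + u) v = ∫⁻ v in A, volume B * ∫⁻ x, T x v := by
  have h1 : Measurable fun q : ((Fin 2 → ℝ) × (Fin 2 → ℝ)) × (Fin 2 → ℝ) =>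
      Function.uncurry T (q.1.1 + q.2, q.1.2) :=
    hT.comp (by fun_prop)
  have h2 : Measurable fun p : (Fin 2 → ℝ) × (Fin 2 → ℝ) => ∫⁻ u in B, T (p.1 + u) p.2 :=
    h1.lintegral_prod_right'
  rw [lintegral_lintegral_swap h2.aemeasurable]
  refine lintegral_congr fun v => ?_
  have h3 : Measurable fun p : (Fin 2 → ℝ) × (Fin 2 → ℝ) =>
      Function.uncurry T (p.1 + p.2, v) := hT.comp (by fun_prop)
  have h4 := lintegral_lintegral_swap (μ := volume) (ν := volume.restrict B)
    (f := fun x u => T (x + u) v) h3.aemeasurable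
  rw [h4]
  have h5 : ∀ u : Fin 2 → ℝ, ∫⁻ x, T (x + u) v = ∫⁻ x, T x v := fun u =>
    lintegral_add_right_eq_self (fun x => T x v) u
  simp only [h5]
  rw [setLIntegral_const, mul_comm]

theorem sliceNorm_le_lintegral_ball {G : ℂ × ℂ → ℂ} (hG : DifferentiableOn ℂ G biHalfPlane)
    {r : ℝ} (hr : 0 < r) {y : Fin 2 → ℝ} (h0 : r ≤ y 0) (h1 : r ≤ y 1) :
    ENNReal.ofReal (Real.pi * r ^ 2) * (ENNReal.ofReal (Real.pi * r ^ 2) * sliceNorm (onPi G) y) ≤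
      volume (Metric.ball (0 : Fin 2 → ℝ) r) * ∫⁻ v in Metric.ball y r, sliceNorm (onPi G) v := by
  set Gm := biHalfPlane.indicator G with hGm
  have hm : Measurable Gm :=
    measurable_indicator_of_continuousOn hG.continuousOn isOpen_biHalfPlane.measurableSet
  have hS : Measurable fun z => ‖Gm z‖ₑ ^ 2 := hm.enorm.pow_const 2
  have hpt : ∀ x, ENNReal.ofReal (Real.pi * r ^ 2) * (ENNReal.ofReal (Real.pi * r ^ 2) *
      ‖onPi G (tubePoint x y)‖ₑ ^ 2) ≤ ∫⁻ v in Metric.ball y r,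
      ∫⁻ u in Metric.ball (0 : Fin 2 → ℝ) r, ‖Gm (tubePoint (x + u) v 0, tubePoint (x + u) v 1)‖ₑ ^ 2 := by
    intro x
    refine le_trans (enorm_sq_le_lintegral_bidisc hG hr (z := (tubePoint x y 0, tubePoint x y 1))
      (by simpa [tubePoint] using h0) (by simpa [tubePoint] using h1)) ?_
    refine le_trans ?_ (lintegral_bidisc_le hS hr x y)
    have him : ∀ {k : Fin 2} {w : ℂ}, r ≤ y k → w ∈ Metric.ball (tubePoint x y k) r → 0 < w.im := by
      intro k w hc hw
      rw [Metric.mem_ball, dist_eq_norm] at hw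
      have := (abs_lt.1 ((Complex.abs_im_le_norm (w - tubePoint x y k)).trans_lt hw)).1
      simp only [Complex.sub_im, congrFun (tubePoint_im x y) k] at this
      linarith
    refine setLIntegral_mono' Metric.isOpen_ball.measurableSet fun w₀ hw₀ =>
      setLIntegral_mono' Metric.isOpen_ball.measurableSet fun w₁ hw₁ => le_of_eq ?_
    rw [hGm, Set.indicator_of_mem (show (w₀, w₁) ∈ biHalfPlane from ⟨him h0 hw₀, him h1 hw₁⟩)]
  have hT : Measurable (Function.uncurry fun x v : Fin 2 → ℝ =>
      ‖Gm (tubePoint x v 0, tubePoint x v 1)‖ₑ ^ 2) := by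
    refine hS.comp (Continuous.measurable (f := fun p : (Fin 2 → ℝ) × (Fin 2 → ℝ) =>
      (tubePoint p.1 p.2 0, tubePoint p.1 p.2 1)) ?_)
    unfold tubePoint
    fun_prop
  calc _ = ∫⁻ x, ENNReal.ofReal (Real.pi * r ^ 2) * (ENNReal.ofReal (Real.pi * r ^ 2) *
        ‖onPi G (tubePoint x y)‖ₑ ^ 2) := by
        rw [lintegral_const_mul' _ _ ENNReal.ofReal_ne_top,
          lintegral_const_mul' _ _ ENNReal.ofReal_ne_top, sliceNorm]
    _ ≤ ∫⁻ x, ∫⁻ v in Metric.ball y r, ∫⁻ u in Metric.ball (0 : Fin 2 → ℝ) r,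
        ‖Gm (tubePoint (x + u) v 0, tubePoint (x + u) v 1)‖ₑ ^ 2 := lintegral_mono hpt
    _ = ∫⁻ v in Metric.ball y r, volume (Metric.ball (0 : Fin 2 → ℝ) r) * sliceNorm (onPi G) v := by
        refine (lintegral_translate_average hT _ _).trans
          (setLIntegral_congr_fun Metric.isOpen_ball.measurableSet fun v hv => ?_)
        have hvq : ∀ x, (tubePoint x v 0, tubePoint x v 1) ∈ biHalfPlane := by
          intro x
          have hk : ∀ k, r ≤ y k → 0 < v k := fun k hk => by
            rw [mem_ball_iff_norm, pi_norm_lt_iff hr] at hv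
            have := (abs_lt.1 (hv k)).1
            simp only [Pi.sub_apply] at this
            linarith
          simpa [biHalfPlane, tubePoint] using ⟨hk 0 h0, hk 1 h1⟩
        congr 1
        refine lintegral_congr fun x => ?_
        rw [hGm, Set.indicator_of_mem (hvq x), onPi]
    _ = _ := lintegral_const_mul' _ _ measure_ball_lt_top.ne

/-- Near `y` the weight is bounded below, so slice norms are integrable over a ball about `y`; the
mean value inequality turns this average into a pointwise bound. -/
theorem sliceNorm_locally_bounded {α : ℝ} {G : ℂ × ℂ → ℂ} (hG : MemBergman α α G)
    {y : Fin 2 → ℝ} (hy : y ∈ quadrant) :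
    ∃ C < ∞, ∀ᶠ y' in nhds y, sliceNorm (onPi G) y' ≤ C := by
  have hw : ContinuousOn (fun t : Fin 2 → ℝ => t 0 ^ α * t 1 ^ α) quadrant := by
    refine ContinuousOn.mul ?_ ?_
    · exact ContinuousOn.rpow_const (by fun_prop) fun t ht => Or.inl ht.1.ne'
    · exact ContinuousOn.rpow_const (by fun_prop) fun t ht => Or.inl ht.2.ne'
  set c : ℝ := y 0 ^ α * y 1 ^ α / 2 with hc
  have hpos : 0 < y 0 ^ α * y 1 ^ α :=
    mul_pos (Real.rpow_pos_of_pos hy.1 _) (Real.rpow_pos_of_pos hy.2 _)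
  have hc0 : 0 < c := half_pos hpos
  have hev : ∀ᶠ t in nhds y, t ∈ quadrant ∧ c < t 0 ^ α * t 1 ^ α :=
    (isOpen_quadrant.eventually_mem hy).and
      (((hw.continuousAt (isOpen_quadrant.mem_nhds hy)).eventually_const_lt (half_lt_self hpos)))
  obtain ⟨R, hR, hball⟩ := Metric.eventually_nhds_iff_ball.1 hev
  -- For `y'` within `r` of `y` this gives `y'_k ≥ y_k / 2 ≥ r`, so the bidiscs stay in the domain,
  -- and the ball of radius `r` about `y'` stays in that of radius `R` about `y`.
  set r := min (R / 2) (min (y 0 / 2) (y 1 / 2)) with hr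
  have hr0 : 0 < r := lt_min (half_pos hR) (lt_min (half_pos hy.1) (half_pos hy.2))
  have hrR : r ≤ R / 2 := min_le_left _ _
  have hry0 : r ≤ y 0 / 2 := (min_le_right _ _).trans (min_le_left _ _)
  have hry1 : r ≤ y 1 / 2 := (min_le_right _ _).trans (min_le_right _ _)
  have hint : ENNReal.ofReal c * ∫⁻ t in Metric.ball y R, sliceNorm (onPi G) t ≤
      bergmanNorm α α G ^ 2 := by
    rw [bergmanNorm_sq α α hG.1.continuousOn, ← lintegral_const_mul' _ _ ENNReal.ofReal_ne_top]
    refine le_trans (setLIntegral_mono' Metric.isOpen_ball.measurableSet fun t ht => ?_)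
      (lintegral_mono_set fun t ht => (hball t ht).1)
    gcongr
    exact (hball t ht).2.le
  have hfin : ∫⁻ t in Metric.ball y R, sliceNorm (onPi G) t < ∞ := by
    have h1 := hint.trans_lt (ENNReal.pow_lt_top hG.2)
    by_contra h
    rw [not_lt_top_iff.1 h, ENNReal.mul_top (by simpa using hc0)] at h1
    exact lt_irrefl _ h1
  set K := ENNReal.ofReal (Real.pi * r ^ 2) with hK
  have hK0 : K ≠ 0 := by
    have : 0 < Real.pi * r ^ 2 := by positivity
    simpa [hK] using this
  refine ⟨(volume (Metric.ball (0 : Fin 2 → ℝ) r) *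
    ∫⁻ t in Metric.ball y R, sliceNorm (onPi G) t) / (K * K), ?_, ?_⟩
  · exact ENNReal.div_lt_top (ENNReal.mul_lt_top measure_ball_lt_top hfin).ne
      (mul_ne_zero hK0 hK0)
  · filter_upwards [Metric.ball_mem_nhds y hr0] with y' hy'
    rw [ENNReal.le_div_iff_mul_le (Or.inl (mul_ne_zero hK0 hK0))
      (Or.inl (ENNReal.mul_ne_top ENNReal.ofReal_ne_top ENNReal.ofReal_ne_top)), mul_comm, mul_assoc]
    have hk : ∀ k, r ≤ y k / 2 → r ≤ y' k := fun k hk => by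
      rw [mem_ball_iff_norm, pi_norm_lt_iff hr0] at hy'
      have := (abs_lt.1 (hy' k)).1
      simp only [Pi.sub_apply] at this
      linarith
    refine (sliceNorm_le_lintegral_ball hG.1 hr0 (hk 0 hry0) (hk 1 hry1)).trans ?_
    gcongr
    intro t ht
    rw [Metric.mem_ball] at ht hy' ⊢
    linarith [dist_triangle t y' y]

end LocalBound

/-! ### Construction of the extension and its norm. -/

section Extension

/-- The integral of the `m`-th power of `boxSymbol` over the slice of `dualCone` above `a`. -/
noncomputable def sliceIntegral (m : ℕ) (a : Fin 2 → ℝ) : ℝ :=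
  (4 * Real.pi ^ 2) ^ m * ((2 * Real.sqrt (a 0 * a 1)) ^ (2 * m + 1) * ballConst m)

/-- The points of `dualCone` above the open quadrant. -/
def openDualCone : Set (Fin 3 → ℝ) := dualCone ∩ {η | 0 < η 0 ∧ 0 < η 1}

/-- The density on `dualCone` that is constant on the slices above the quadrant and whose product
with the `m`-th power of `boxSymbol` has the slice integrals `g`. -/
noncomputable def extendDensity (m : ℕ) (g : (Fin 2 → ℝ) → ℂ) : (Fin 3 → ℝ) → ℂ :=
  openDualCone.indicator fun η => g ![η 0, η 1] / (sliceIntegral m ![η 0, η 1] : ℂ)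

/-- The constant in the norm identity for the extension. -/
noncomputable def extendConst (m : ℕ) : ℝ :=
  4 * Real.Gamma (m + 3 / 2) ^ 2 / (Real.Gamma (2 * m + 1 / 2) * (Nat.factorial m : ℝ)) ^ 2

variable {m : ℕ} {g : (Fin 2 → ℝ) → ℂ}

theorem sliceIntegral_pos (m : ℕ) {a : Fin 2 → ℝ} (ha : a ∈ quadrant) : 0 < sliceIntegral m a := by
  have := Real.sqrt_pos.2 (mul_pos ha.1 ha.2)
  have := ballConst_pos m
  unfold sliceIntegral
  positivity

theorem measurable_extendDensity (hg : Measurable g) : Measurable (extendDensity m g) := by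
  have h0 : MeasurableSet {η : Fin 3 → ℝ | 0 < η 0} := measurableSet_lt (by fun_prop) (by fun_prop)
  have h1 : MeasurableSet {η : Fin 3 → ℝ | 0 < η 1} := measurableSet_lt (by fun_prop) (by fun_prop)
  refine Measurable.indicator ?_ (measurableSet_dualCone.inter (h0.inter h1))
  have hp : Measurable fun η : Fin 3 → ℝ => ![η 0, η 1] :=
    Continuous.measurable (by fun_prop)
  have hs : Measurable (sliceIntegral m) := by
    unfold sliceIntegral
    fun_prop
  exact (hg.comp hp).div (Complex.measurable_ofReal.comp (hs.comp hp))

theorem extendDensity_eq_zero {η : Fin 3 → ℝ} (hη : η ∉ dualCone) : extendDensity m g η = 0 :=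
  Set.indicator_of_notMem (fun h => hη h.1) _

theorem extendDensity_glue {a : Fin 2 → ℝ} (ha : a ∈ quadrant) (s : ℝ) :
    extendDensity m g (glue s a) = (Set.Icc (-(2 * Real.sqrt (a 0 * a 1)))
      (2 * Real.sqrt (a 0 * a 1))).indicator (fun _ => g a / (sliceIntegral m a : ℂ)) s := by
  have e : ![glue s a 0, glue s a 1] = a := by
    ext j; fin_cases j <;> rfl
  by_cases hs : s ∈ Set.Icc (-(2 * Real.sqrt (a 0 * a 1))) (2 * Real.sqrt (a 0 * a 1))
  · rw [Set.indicator_of_mem hs, extendDensity, Set.indicator_of_mem, e]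
    exact ⟨(glue_mem_dualCone ha s).2 hs, ha⟩
  · rw [Set.indicator_of_notMem hs]
    exact extendDensity_eq_zero fun h => hs ((glue_mem_dualCone ha s).1 h)

theorem extendDensity_glue_of_notMem {a : Fin 2 → ℝ} (ha : a ∉ quadrant) (s : ℝ) :
    extendDensity m g (glue s a) = 0 :=
  Set.indicator_of_notMem (fun h => ha h.2) _

theorem integral_boxSymbol_mul_extendDensity {a : Fin 2 → ℝ} (ha : a ∈ quadrant) :
    ∫ s, (boxSymbol (glue s a) : ℂ) ^ m * extendDensity m g (glue s a) = g a := by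
  have hp : 0 < Real.sqrt (a 0 * a 1) := Real.sqrt_pos.2 (mul_pos ha.1 ha.2)
  set r := 2 * Real.sqrt (a 0 * a 1) with hr
  have hr0 : 0 < r := by positivity
  have h1 : ∀ s, (boxSymbol (glue s a) : ℂ) ^ m * extendDensity m g (glue s a) =
      (Set.Icc (-r) r).indicator (fun s => (((4 * Real.pi ^ 2) ^ m * (r ^ 2 - s ^ 2) ^ m : ℝ) : ℂ) *
        (g a / (sliceIntegral m a : ℂ))) s := by
    intro s
    rw [extendDensity_glue ha, boxSymbol_glue ha, ← hr]
    by_cases hs : s ∈ Set.Icc (-r) r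
    · rw [Set.indicator_of_mem hs, Set.indicator_of_mem hs, ← mul_pow (4 * Real.pi ^ 2),
        Complex.ofReal_pow]
    · rw [Set.indicator_of_notMem hs, Set.indicator_of_notMem hs, mul_zero]
  simp only [h1]
  rw [integral_indicator measurableSet_Icc, integral_mul_const, integral_complex_ofReal,
    integral_const_mul, integral_Icc_eq_integral_Ioc,
    ← intervalIntegral.integral_of_le (by linarith), integral_sq_sub_sq_pow hr0]
  have h2 : (sliceIntegral m a : ℂ) ≠ 0 := by exact_mod_cast (sliceIntegral_pos m ha).ne'
  exact mul_div_cancel₀ _ h2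

/-- The left side is the squared norm of the slice constant for `g(a) = 1`: the inverse square of
the slice integral times the slice length `2r = 4p`. It is again `p^{-(4m+1)}` up to a constant,
hence proportional to the Bergman weight. -/
theorem extend_const_identity (m : ℕ) {p : ℝ} (hp : 0 < p) :
    (1 / ((4 * Real.pi ^ 2) ^ m * ((2 * p) ^ (2 * m + 1) * ballConst m))) ^ 2 * (2 * (2 * p)) =
      extendConst m *
      (Real.Gamma (2 * m + 1 / 2) ^ 2 / ((4 * Real.pi) ^ (4 * m + 1) * p ^ (4 * m + 1))) := by
  have hπ := Real.pi_pos
  have hG : 0 < Real.Gamma (2 * m + 1 / 2) := Real.Gamma_pos_of_pos (by positivity)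
  have hG2 : 0 < Real.Gamma (m + 3 / 2) := Real.Gamma_pos_of_pos (by positivity)
  have e1 : (4 * Real.pi) ^ (4 * m + 1) =
      ((4 * Real.pi ^ 2) ^ m) ^ 2 * ((2 : ℝ) ^ (2 * m)) ^ 2 * (4 * Real.pi) := by
    have h16 : (4 * Real.pi) ^ (4 * m) = ((4 * Real.pi ^ 2) ^ m) ^ 2 * ((2 : ℝ) ^ (2 * m)) ^ 2 := by
      rw [pow_mul (2 : ℝ), pow_right_comm (4 * Real.pi ^ 2), pow_right_comm ((2 : ℝ) ^ 2),
        ← mul_pow, pow_mul]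
      congr 1; ring
    rw [pow_succ, h16]
  have e2 : Real.sqrt Real.pi ^ 2 = Real.pi := Real.sq_sqrt hπ.le
  have e3 : p ^ (4 * m + 1) = (p ^ (2 * m)) ^ 2 * p := by ring
  have hs : 0 < Real.sqrt Real.pi := Real.sqrt_pos.2 hπ
  rw [e1, e3, extendConst, ballConst, mul_pow 2 p, pow_succ (2 : ℝ), pow_succ p]
  field_simp
  rw [e2]

theorem lintegral_extendDensity_sq (hg : Measurable g) (h0 : ∀ᵐ a, a ∉ quadrant → g a = 0) :
    ∫⁻ η, ‖extendDensity m g η‖ₑ ^ 2 = ENNReal.ofReal (extendConst m) *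
      ∫⁻ a, ‖g a‖ₑ ^ 2 * (laplaceWeight (2 * m - 1 / 2) (a 0) *
        laplaceWeight (2 * m - 1 / 2) (a 1)) := by
  rw [lintegral_glue ((measurable_extendDensity hg).enorm.pow_const 2),
    ← lintegral_const_mul' _ _ ENNReal.ofReal_ne_top]
  refine lintegral_congr_ae ?_
  filter_upwards [h0] with a ha0
  by_cases ha : a ∈ quadrant
  · have hp : 0 < Real.sqrt (a 0 * a 1) := Real.sqrt_pos.2 (mul_pos ha.1 ha.2)
    have hs := sliceIntegral_pos m ha
    set r := 2 * Real.sqrt (a 0 * a 1) with hr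
    have hK : 0 ≤ extendConst m := by unfold extendConst; positivity
    have h1 : ∀ s, ‖extendDensity m g (glue s a)‖ₑ ^ 2 = (Set.Icc (-r) r).indicator
        (fun _ => ‖g a / (sliceIntegral m a : ℂ)‖ₑ ^ 2) s := by
      intro s
      rw [extendDensity_glue ha, ← hr]
      by_cases hs : s ∈ Set.Icc (-r) r <;> simp [hs]
    simp only [h1]
    rw [lintegral_indicator measurableSet_Icc, setLIntegral_const, Real.volume_Icc,
      laplaceWeight_mul m ha, mul_left_comm, ← ENNReal.ofReal_mul hK,
      ← extend_const_identity m hp, div_eq_mul_inv, enorm_mul, mul_pow, mul_assoc]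
    congr 1
    have h2 : ‖(sliceIntegral m a : ℂ)⁻¹‖ₑ = ENNReal.ofReal (1 / sliceIntegral m a) := by
      rw [← ofReal_norm, norm_inv, Complex.norm_real, Real.norm_of_nonneg hs.le, one_div]
    rw [h2, ← ENNReal.ofReal_pow (by positivity), ← ENNReal.ofReal_mul (by positivity),
      sliceIntegral]
    congr 2
    ring
  · simp [extendDensity_glue_of_notMem ha, ha0 ha]

/-- Paley–Wiener over the quadrant provides the density `g` of `G`. Its spread over the slices of
the dual cone is a Hardy density, whose norm is exact because the supremum over the cone is attained
in the limit `y → 0`. -/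
theorem exists_extension {G : ℂ × ℂ → ℂ} (hG : MemBergman (2 * m - 1 / 2) (2 * m - 1 / 2) G) :
    ∃ F : (Fin 3 → ℂ) → ℂ, MemHardy F ∧ IsExtension (box^[m] F) G ∧
      hardyNorm F ^ 2 = ENNReal.ofReal (extendConst m) *
        bergmanNorm (2 * m - 1 / 2) (2 * m - 1 / 2) G ^ 2 := by
  have hα : (-1 : ℝ) < 2 * m - 1 / 2 := by
    have : (0 : ℝ) ≤ m := m.cast_nonneg
    linarith
  obtain ⟨g, hg, hGg, hs⟩ := exists_eq_fourierLaplace isOpen_quadrant convex_quadrant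
    ⟨![1, 1], by simp [quadrant]⟩ (differentiableOn_onPi hG.1)
    (fun y hy => sliceNorm_locally_bounded hG hy)
  have hB : bergmanNorm (2 * m - 1 / 2) (2 * m - 1 / 2) G ^ 2 =
      ∫⁻ a, ‖g a‖ₑ ^ 2 * (laplaceWeight (2 * m - 1 / 2) (a 0) *
        laplaceWeight (2 * m - 1 / 2) (a 1)) := by
    rw [bergmanNorm_sq _ _ hG.1.continuousOn, ← lintegral_quadrant_mul_lintegral _ hg.1]
    refine setLIntegral_congr_fun isOpen_quadrant.measurableSet fun y hy => ?_
    rw [hs y hy]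
  have hBfin : bergmanNorm (2 * m - 1 / 2) (2 * m - 1 / 2) G ^ 2 < ∞ := ENNReal.pow_lt_top hG.2
  have h0 : ∀ᵐ a, a ∉ quadrant → g a = 0 := by
    have hm : Measurable fun a : Fin 2 → ℝ => ‖g a‖ₑ ^ 2 * (laplaceWeight (2 * m - 1 / 2) (a 0) *
        laplaceWeight (2 * m - 1 / 2) (a 1)) :=
      (hg.1.enorm.pow_const 2).mul
        (((measurable_laplaceWeight _).comp (measurable_pi_apply 0)).mul
          ((measurable_laplaceWeight _).comp (measurable_pi_apply 1)))
    -- The weighted integral is finite, so its integrand is finite almost everywhere, while off the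
    -- quadrant the weight is infinite; the other Laplace factor is nonzero, so the product stays
    -- infinite.
    filter_upwards [ae_lt_top hm (hB ▸ hBfin).ne] with a ha hnot
    by_contra hne
    have htop : laplaceWeight (2 * m - 1 / 2) (a 0) * laplaceWeight (2 * m - 1 / 2) (a 1) = ∞ := by
      by_cases h : 0 < a 0
      · have h1 : a 1 ≤ 0 := not_lt.1 fun h1 => hnot ⟨h, h1⟩
        rw [laplaceWeight_of_nonpos h1, ENNReal.mul_top (laplaceWeight_ne_zero hα _)]
      · rw [laplaceWeight_of_nonpos (not_lt.1 h), ENNReal.top_mul (laplaceWeight_ne_zero hα _)]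
    rw [htop, ENNReal.mul_top (by simpa using hne)] at ha
    exact lt_irrefl _ ha
  set f := extendDensity m g with hf
  have hfm : Measurable f := measurable_extendDensity hg.1
  have hfn : ∫⁻ η, ‖f η‖ₑ ^ 2 = ENNReal.ofReal (extendConst m) *
      bergmanNorm (2 * m - 1 / 2) (2 * m - 1 / 2) G ^ 2 := by
    rw [hB]; exact lintegral_extendDensity_sq hg.1 h0
  have hf0 : ∀ η, η ∉ dualCone → f η = 0 := fun η hη => extendDensity_eq_zero hη
  have hfin : ∫⁻ η, ‖f η‖ₑ ^ 2 < ∞ := by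
    rw [hfn]; exact ENNReal.mul_lt_top ENNReal.ofReal_lt_top hBfin
  have hadm : Admissible cone f :=
    admissible_of_dualCone hfm ((memLp_two_iff hfm.aestronglyMeasurable).2 hfin) hf0
  have hnorm : hardyNorm (fourierLaplace f) ^ 2 = ∫⁻ η, ‖f η‖ₑ ^ 2 := by
    rw [hardyNorm_sq, ← iSup_cone_lintegral hfm hf0]
    exact iSup_congr fun y => iSup_congr fun hy => sliceNorm_fourierLaplace isOpen_cone hadm hy
  refine ⟨fourierLaplace f, ⟨differentiableOn_fourierLaplace isOpen_cone hadm, ?_⟩, ?_,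
    hnorm.trans hfn⟩
  · have := hnorm.trans_lt hfin
    simpa [ENNReal.pow_lt_top_iff] using this
  · intro z hz
    rw [restrict_box_eq hadm (Set.eqOn_refl _ _) m hz]
    have hz' : (![z.1, z.2] : Fin 2 → ℂ) ∈ tubeOver quadrant := hz
    have h1 : G z = fourierLaplace g ![z.1, z.2] := hGg _ hz'
    rw [h1]
    refine integral_congr_ae ?_
    filter_upwards [h0] with a ha0
    congr 1
    by_cases ha : a ∈ quadrant
    · exact integral_boxSymbol_mul_extendDensity ha
    · rw [ha0 ha]
      simp [hf, extendDensity_glue_of_notMem ha]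

end Extension

end TubeSigma

theorem mainTheorem9 (m : ℕ) :
    (∀ F : (Fin 3 → ℂ) → ℂ, TubeSigma.MemHardy F →
      TubeSigma.MemBergman (2 * m - 1 / 2) (2 * m - 1 / 2)
        (TubeSigma.restrict (TubeSigma.box^[m] F)) ∧
      TubeSigma.bergmanNorm (2 * m - 1 / 2) (2 * m - 1 / 2)
          (TubeSigma.restrict (TubeSigma.box^[m] F)) ^ 2 ≤
        ENNReal.ofReal (4 * Real.pi ^ (5 / 2 : ℝ) * (Nat.factorial (2 * m) : ℝ) *
            Real.Gamma (2 * m + 1 / 2) / (2 * m + 1 / 2)) *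
          TubeSigma.hardyNorm F ^ 2) ∧
    (∀ G : ℂ × ℂ → ℂ, TubeSigma.MemBergman (2 * m - 1 / 2) (2 * m - 1 / 2) G →
      ∃ F : (Fin 3 → ℂ) → ℂ, TubeSigma.MemHardy F ∧
        TubeSigma.IsExtension (TubeSigma.box^[m] F) G ∧
        TubeSigma.hardyNorm F ^ 2 =
          ENNReal.ofReal (4 * Real.Gamma (m + 3 / 2) ^ 2 /
              (Real.Gamma (2 * m + 1 / 2) * (Nat.factorial m : ℝ)) ^ 2) *
            TubeSigma.bergmanNorm (2 * m - 1 / 2) (2 * m - 1 / 2) G ^ 2) := by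
  refine ⟨fun F hF => ?_, fun G hG => TubeSigma.exists_extension hG⟩
  obtain ⟨h1, h2⟩ := TubeSigma.restrict_box_le hF m
  refine ⟨h1, h2.trans ?_⟩
  gcongr
  exact TubeSigma.restrictConst_le m
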